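/- Let $(M,J)$ be a smooth, finite-dimensional, Hausdorff, second countable almost complex manifold and let $L\subset M$ be an embedded pseudoholomorphic submanifold, i.e. $J(TL)=TL$. Let $\chi:TM|_L\to N_LM=TM|_L/TL$ be the natural projection, $\pi:N_LM\to L$ the bundle projection, $\rho:L\to N_LM$ the zero section, and $R^t:N_LM\to N_LM$, $v\mapsto tv$, the dilatation along the fibres. Let $N_J(X,Y)=[JX,JY]-J[JX,Y]-J[X,JY]-[X,Y]$ be the Nijenhuis tensor; an almost complex structure is called integrable if its Nijenhuis tensor vanishes. A linear connection $\nabla$ is called minimal if $\nabla J=0$ and its torsion is $T_\nabla=\frac14N_J$. There exist smooth $J$-invariant subbundles $F\subset TM|_L$ with $TL\oplus F=TM|_L$, and there exist minimal connections $\nabla$ on open neighbourhoods of $L$ in $M$ for which $L$ is totally geodesic. For any $J$-invariant complement $F$ and any minimal connection $\nabla$ on a neighbourhood of $L$, let $\varphi$ be the map $v\mapsto\exp^\nabla(v)$ for $v\in F\simeq N_LM$ (where $F\simeq N_LM$ via $\chi$). It is defined on an open neighbourhood of the zero section of $N_LM$ and is a local diffeomorphism into $M$ there. Put $$J^\varphi=\varphi_*^{-1}\,J\,\varphi_*,\qquad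 J_t=R^{1/t}_*\,J^\varphi\,R^t_*\qquad(t\ne0).$$ Then there is a unique smooth almost complex structure $\check J$ on the total space $N_LM$ such that for all choices of $F$ and $\nabla$ one has $\check J=\lim_{t\to0}J_t$ at every point of $N_LM$; in particular this limit exists and does not depend on the choices. Moreover: 1. The maps $\pi:(N_LM,\check J)\to(L,J|_L)$ and $\rho:(L,J|_L)\to(N_LM,\check J)$ are pseudoholomorphic. 2. $\check J$ is integrable if and only if the following three conditions hold: - $J|_L$ is integrable; - $N_J(TL,TM|_L)\subset TL$; - the normal component $N_J^\perp=\chi\circ N_J$ vanishes on $TL$ to second order, i.e. for all local vector fields $X,Y$ on $M$ that are tangent to $L$ at the points of $L$, the normal component of $N_J(X,Y)$ and its first derivatives (in all directions of $M$) vanish at the points of $L$. (When the first two conditions hold, $N_J(X,Y)=0$ along $L$, so that these derivatives do not depend on coordinates.) -/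

import Mathlib

open Set Filter Topology Bundle Manifold
open scoped Manifold ContDiff

noncomputable section

/-- An embedded smooth submanifold of `M` (modelled on `E`), given by a smooth embedding of a
manifold `L` (modelled on `E₁`); `F` is a model for the normal spaces. -/
structure EmbeddedSubmanifold (E₁ F L E M : Type*)
    [NormedAddCommGroup E₁] [NormedSpace ℝ E₁] [NormedAddCommGroup F] [NormedSpace ℝ F]
    [TopologicalSpace L] [ChartedSpace E₁ L]
    [NormedAddCommGroup E] [NormedSpace ℝ E] [TopologicalSpace M] [ChartedSpace E M] where
  incl : L → M
  isEmbedding : IsEmbedding incl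
  isImmersion : IsImmersionOfComplement F 𝓘(ℝ, E₁) 𝓘(ℝ, E) ∞ incl

namespace EmbeddedSubmanifold

variable {E₁ F L E M : Type*}
    [NormedAddCommGroup E₁] [NormedSpace ℝ E₁] [NormedAddCommGroup F] [NormedSpace ℝ F]
    [TopologicalSpace L] [ChartedSpace E₁ L]
    [NormedAddCommGroup E] [NormedSpace ℝ E] [TopologicalSpace M] [ChartedSpace E M]
    (S : EmbeddedSubmanifold E₁ F L E M)

/-- The differential of the inclusion. -/
def dincl (p : L) : TangentSpace 𝓘(ℝ, E₁) p →L[ℝ] TangentSpace 𝓘(ℝ, E) (S.incl p) :=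
  mfderiv 𝓘(ℝ, E₁) 𝓘(ℝ, E) S.incl p

/-- `T_pL` as a subspace of `T_pM`. -/
def tangent (p : L) : Submodule ℝ (TangentSpace 𝓘(ℝ, E) (S.incl p)) := (S.dincl p).range

/-- The fibre `(N_LM)_p = T_pM / T_pL` of the normal bundle. -/
abbrev Normal (p : L) : Type _ := TangentSpace 𝓘(ℝ, E) (S.incl p) ⧸ S.tangent p

/-- The natural projection `χ : TM|_L → N_LM`. -/
def proj (p : L) : TangentSpace 𝓘(ℝ, E) (S.incl p) →L[ℝ] S.Normal p := (S.tangent p).mkQL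

/-! #### The smooth vector bundle structure of the normal bundle

A slice chart of `M` around a point of `L`, in which `L` is given by `u ↦ (u, 0) ∈ E₁ × F`,
trivializes `TM|_L`; its second component trivializes the quotient `TM|_L / TL`. -/

def domChart (p₀ : L) : OpenPartialHomeomorph L E₁ := (S.isImmersion p₀).domChart
def codChart (p₀ : L) : OpenPartialHomeomorph M E := (S.isImmersion p₀).codChart
def sliceEquiv (p₀ : L) : (E₁ × F) ≃L[ℝ] E := (S.isImmersion p₀).equiv

/-- The differential of the slice chart of `M`. -/
def codDeriv (p₀ : L) (x : M) : TangentSpace 𝓘(ℝ, E) x →L[ℝ] E :=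
  (NormedSpace.fromTangentSpace (𝕜 := ℝ) (S.codChart p₀ x)).toContinuousLinearMap.comp
    (mfderiv 𝓘(ℝ, E) 𝓘(ℝ, E) (S.codChart p₀) x)

/-- The `F`-component of a tangent vector of `M` in the slice chart. -/
def normalCoord (p₀ p : L) : TangentSpace 𝓘(ℝ, E) (S.incl p) →L[ℝ] F :=
  (ContinuousLinearMap.snd ℝ E₁ F).comp
    ((S.sliceEquiv p₀).symm.toContinuousLinearMap.comp (S.codDeriv p₀ (S.incl p)))

lemma codChart_mem (p₀ : L) : S.codChart p₀ ∈ IsManifold.maximalAtlas 𝓘(ℝ, E) ∞ M :=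
  (S.isImmersion p₀).codChart_mem_maximalAtlas

lemma domChart_mem (p₀ : L) : S.domChart p₀ ∈ IsManifold.maximalAtlas 𝓘(ℝ, E₁) ∞ L :=
  (S.isImmersion p₀).domChart_mem_maximalAtlas

lemma mapsTo_source (p₀ : L) {p : L} (hp : p ∈ (S.domChart p₀).source) :
    S.incl p ∈ (S.codChart p₀).source :=
  (S.isImmersion p₀).mapsto_domChart_source_codChart_source hp

/-- In slice charts the inclusion is `u ↦ (u, 0)`. -/
lemma codChart_incl (p₀ : L) {p : L} (hp : p ∈ (S.domChart p₀).source) :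
    S.codChart p₀ (S.incl p) = S.sliceEquiv p₀ (S.domChart p₀ p, 0) := by
  have h : (S.domChart p₀).extend 𝓘(ℝ, E₁) p ∈ ((S.domChart p₀).extend 𝓘(ℝ, E₁)).target :=
    ((S.domChart p₀).extend 𝓘(ℝ, E₁)).map_source (by simpa using hp)
  have h3 := (S.isImmersion p₀).writtenInCharts h
  have h2 : (S.domChart p₀).symm (S.domChart p₀ p) = p := (S.domChart p₀).left_inv hp
  simp only [Function.comp_apply, OpenPartialHomeomorph.extend_coe,
    OpenPartialHomeomorph.extend_coe_symm, modelWithCornersSelf_coe,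
    modelWithCornersSelf_coe_symm, id_eq] at h3
  change S.codChart p₀ (S.incl ((S.domChart p₀).symm (S.domChart p₀ p))) = _ at h3
  rw [h2] at h3
  exact h3

lemma exists_equiv (p₀ : L) {x : M} (hx : x ∈ (S.codChart p₀).source) :
    ∃ e : TangentSpace 𝓘(ℝ, E) x ≃L[ℝ] E,
      (e : TangentSpace 𝓘(ℝ, E) x →L[ℝ] E) = S.codDeriv p₀ x := by
  have h1 := IsManifold.maximalAtlas_subset_of_le (I := 𝓘(ℝ, E)) (M := M)
    (show (1 : WithTop ℕ∞) ≤ ∞ by simp) (S.codChart_mem p₀)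
  have hd : (S.codChart p₀).MDifferentiable 𝓘(ℝ, E) 𝓘(ℝ, E) :=
    ⟨fun y hy => (mdifferentiableAt_of_mem_maximalAtlas h1 hy).mdifferentiableWithinAt,
     fun y hy => (mdifferentiableAt_symm_of_mem_maximalAtlas h1 hy).mdifferentiableWithinAt⟩
  exact ⟨(hd.mfderiv hx).trans (NormedSpace.fromTangentSpace (𝕜 := ℝ) (S.codChart p₀ x)), rfl⟩

lemma codDeriv_bijective (p₀ : L) {x : M} (hx : x ∈ (S.codChart p₀).source) :
    Function.Bijective (S.codDeriv p₀ x) := by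
  obtain ⟨e, he⟩ := S.exists_equiv p₀ hx
  rw [← he]
  exact e.bijective

/-- The differential of the slice chart of `L`. -/
def domDeriv (p₀ p : L) : TangentSpace 𝓘(ℝ, E₁) p →L[ℝ] E₁ :=
  (NormedSpace.fromTangentSpace (𝕜 := ℝ) (S.domChart p₀ p)).toContinuousLinearMap.comp
    (mfderiv 𝓘(ℝ, E₁) 𝓘(ℝ, E₁) (S.domChart p₀) p)

lemma domDeriv_bijective (p₀ : L) {x : L} (hx : x ∈ (S.domChart p₀).source) :
    Function.Bijective (S.domDeriv p₀ x) := by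
  have h1 := IsManifold.maximalAtlas_subset_of_le (I := 𝓘(ℝ, E₁)) (M := L)
    (show (1 : WithTop ℕ∞) ≤ ∞ by simp) (S.domChart_mem p₀)
  have hd : (S.domChart p₀).MDifferentiable 𝓘(ℝ, E₁) 𝓘(ℝ, E₁) :=
    ⟨fun y hy => (mdifferentiableAt_of_mem_maximalAtlas h1 hy).mdifferentiableWithinAt,
     fun y hy => (mdifferentiableAt_symm_of_mem_maximalAtlas h1 hy).mdifferentiableWithinAt⟩
  exact (NormedSpace.fromTangentSpace (𝕜 := ℝ) (S.domChart p₀ x)).bijective.comp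
    (hd.mfderiv_bijective hx)

lemma codDeriv_dincl (p₀ : L) {p : L} (hp : p ∈ (S.domChart p₀).source)
    (w : TangentSpace 𝓘(ℝ, E₁) p) :
    S.codDeriv p₀ (S.incl p) (S.dincl p w) = S.sliceEquiv p₀ (S.domDeriv p₀ p w, 0) := by
  have h1 := IsManifold.maximalAtlas_subset_of_le (I := 𝓘(ℝ, E)) (M := M)
    (show (1 : WithTop ℕ∞) ≤ ∞ by simp) (S.codChart_mem p₀)
  have h1' := IsManifold.maximalAtlas_subset_of_le (I := 𝓘(ℝ, E₁)) (M := L)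
    (show (1 : WithTop ℕ∞) ≤ ∞ by simp) (S.domChart_mem p₀)
  have hc := mdifferentiableAt_of_mem_maximalAtlas h1 (S.mapsTo_source p₀ hp)
  have hd := mdifferentiableAt_of_mem_maximalAtlas h1' hp
  have hi : MDifferentiableAt 𝓘(ℝ, E₁) 𝓘(ℝ, E) S.incl p :=
    (S.isImmersion.contMDiff p).mdifferentiableAt (by simp)
  let A : E₁ →L[ℝ] E :=
    (S.sliceEquiv p₀).toContinuousLinearMap.comp (ContinuousLinearMap.inl ℝ E₁ F)
  have key : (S.codChart p₀) ∘ S.incl =ᶠ[𝓝 p] A ∘ (S.domChart p₀) := by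
    filter_upwards [(S.domChart p₀).open_source.mem_nhds hp] with q hq
    exact S.codChart_incl p₀ hq
  have e1 : mfderiv 𝓘(ℝ, E₁) 𝓘(ℝ, E) ((S.codChart p₀) ∘ S.incl) p
      = (mfderiv 𝓘(ℝ, E) 𝓘(ℝ, E) (S.codChart p₀) (S.incl p)).comp (S.dincl p) :=
    mfderiv_comp p hc hi
  have e2 : mfderiv 𝓘(ℝ, E₁) 𝓘(ℝ, E) (A ∘ (S.domChart p₀)) p
      = (mfderiv 𝓘(ℝ, E₁) 𝓘(ℝ, E) A (S.domChart p₀ p)).comp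
        (mfderiv 𝓘(ℝ, E₁) 𝓘(ℝ, E₁) (S.domChart p₀) p) :=
    mfderiv_comp p (A.differentiableAt.mdifferentiableAt) hd
  have e3 : mfderiv 𝓘(ℝ, E₁) 𝓘(ℝ, E) A (S.domChart p₀ p) = A := by
    rw [mfderiv_eq_fderiv]; exact A.fderiv
  rw [key.mfderiv_eq, e2, e3] at e1
  exact (DFunLike.congr_fun e1 w).symm

lemma normalCoord_ker (p₀ : L) {p : L} (hp : p ∈ (S.domChart p₀).source)
    (v : TangentSpace 𝓘(ℝ, E) (S.incl p)) : S.normalCoord p₀ p v = 0 ↔ v ∈ S.tangent p := by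
  constructor
  · intro hv
    obtain ⟨w, hw⟩ := (S.domDeriv_bijective p₀ hp).2
      ((S.sliceEquiv p₀).symm (S.codDeriv p₀ (S.incl p) v)).1
    refine ⟨w, (S.codDeriv_bijective p₀ (S.mapsTo_source p₀ hp)).1 ?_⟩
    rw [← (S.sliceEquiv p₀).symm.injective.eq_iff]
    refine ((congrArg (S.sliceEquiv p₀).symm (S.codDeriv_dincl p₀ hp w)).trans ?_)
    rw [ContinuousLinearEquiv.symm_apply_apply, hw]
    exact Prod.ext rfl hv.symm
  · rintro ⟨w, rfl⟩
    change ((S.sliceEquiv p₀).symm (S.codDeriv p₀ (S.incl p) (S.dincl p w))).2 = 0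
    rw [S.codDeriv_dincl p₀ hp w, ContinuousLinearEquiv.symm_apply_apply]

/-- A vector at `x` with prescribed coordinates in the slice chart. -/
def ofCoord (p₀ : L) (x : M) : E →L[ℝ] TangentSpace 𝓘(ℝ, E) x := (S.codDeriv p₀ x).inverse

lemma codDeriv_ofCoord (p₀ : L) {x : M} (hx : x ∈ (S.codChart p₀).source) (u : E) :
    S.codDeriv p₀ x (S.ofCoord p₀ x u) = u := by
  obtain ⟨e, he⟩ := S.exists_equiv p₀ hx
  rw [ofCoord, ← he, ContinuousLinearMap.inverse_equiv]
  exact e.apply_symm_apply u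

lemma ofCoord_codDeriv (p₀ : L) {x : M} (hx : x ∈ (S.codChart p₀).source)
    (v : TangentSpace 𝓘(ℝ, E) x) : S.ofCoord p₀ x (S.codDeriv p₀ x v) = v := by
  obtain ⟨e, he⟩ := S.exists_equiv p₀ hx
  rw [ofCoord, ← he, ContinuousLinearMap.inverse_equiv]
  exact e.symm_apply_apply v

/-- The tangent vector of `M` with coordinates `(0, f)` in the slice chart. -/
def normalLift (p₀ p : L) : F →L[ℝ] TangentSpace 𝓘(ℝ, E) (S.incl p) :=
  (S.ofCoord p₀ (S.incl p)).comp ((S.sliceEquiv p₀).toContinuousLinearMap.comp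
    (ContinuousLinearMap.inr ℝ E₁ F))

lemma normalCoord_normalLift (p₀ : L) {p : L} (hp : p ∈ (S.domChart p₀).source) (f : F) :
    S.normalCoord p₀ p (S.normalLift p₀ p f) = f := by
  change ((S.sliceEquiv p₀).symm (S.codDeriv p₀ (S.incl p)
    (S.ofCoord p₀ (S.incl p) (S.sliceEquiv p₀ (0, f))))).2 = f
  rw [S.codDeriv_ofCoord p₀ (S.mapsTo_source p₀ hp), ContinuousLinearEquiv.symm_apply_apply]

open Classical in
/-- `normalCoord` as a map on the quotient `T_pM / T_pL`. -/
def normalCoordQ (p₀ p : L) : S.Normal p →L[ℝ] F :=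
  if h : S.tangent p ≤ LinearMap.ker (S.normalCoord p₀ p).toLinearMap then
    (S.tangent p).liftQL (S.normalCoord p₀ p) h
  else 0

lemma normalCoordQ_proj (p₀ : L) {p : L} (hp : p ∈ (S.domChart p₀).source)
    (v : TangentSpace 𝓘(ℝ, E) (S.incl p)) :
    S.normalCoordQ p₀ p (S.proj p v) = S.normalCoord p₀ p v := by
  have h : S.tangent p ≤ LinearMap.ker (S.normalCoord p₀ p).toLinearMap :=
    fun w hw => (S.normalCoord_ker p₀ hp w).2 hw
  rw [normalCoordQ, dif_pos h]
  rfl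

lemma normalCoordQ_lift (p₀ : L) {p : L} (hp : p ∈ (S.domChart p₀).source) (f : F) :
    S.normalCoordQ p₀ p (S.proj p (S.normalLift p₀ p f)) = f := by
  rw [S.normalCoordQ_proj p₀ hp, S.normalCoord_normalLift p₀ hp]

lemma proj_lift_normalCoordQ (p₀ : L) {p : L} (hp : p ∈ (S.domChart p₀).source)
    (n : S.Normal p) : S.proj p (S.normalLift p₀ p (S.normalCoordQ p₀ p n)) = n := by
  obtain ⟨v, rfl⟩ := (S.tangent p).mkQ_surjective n
  change S.proj p (S.normalLift p₀ p (S.normalCoordQ p₀ p (S.proj p v))) = S.proj p v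
  rw [S.normalCoordQ_proj p₀ hp]
  refine (Submodule.Quotient.eq _).2 ?_
  rw [← S.normalCoord_ker p₀ hp, map_sub, S.normalCoord_normalLift p₀ hp, sub_self]

/-- The local trivialization of the normal bundle given by a slice chart. -/
def pretriv (p₀ : L) : Pretrivialization F (π F S.Normal) where
  toFun a := (a.proj, S.normalCoordQ p₀ a.proj a.2)
  invFun b := ⟨b.1, S.proj b.1 (S.normalLift p₀ b.1 b.2)⟩
  source := π F S.Normal ⁻¹' (S.domChart p₀).source
  target := (S.domChart p₀).source ×ˢ univ
  map_source' a ha := ⟨ha, mem_univ _⟩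
  map_target' b hb := hb.1
  left_inv' a ha := by
    obtain ⟨p, n⟩ := a
    exact congrArg (TotalSpace.mk p) (S.proj_lift_normalCoordQ p₀ ha n)
  right_inv' b hb := Prod.ext rfl (S.normalCoordQ_lift p₀ hb.1 b.2)
  open_target := (S.domChart p₀).open_source.prod isOpen_univ
  baseSet := (S.domChart p₀).source
  open_baseSet := (S.domChart p₀).open_source
  source_eq := rfl
  target_eq := rfl
  proj_toFun _ _ := rfl

lemma pretriv_symm (p₀ : L) {p : L} (hp : p ∈ (S.domChart p₀).source) (f : F) :
    (S.pretriv p₀).symm p f = S.proj p (S.normalLift p₀ p f) := by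
  rw [Pretrivialization.symm_apply _ hp]
  rfl

/-- The transition functions of the normal bundle. -/
def coordChange (p₀ p₁ p : L) : F →L[ℝ] F :=
  (S.normalCoord p₁ p).comp (S.normalLift p₀ p)

lemma chartChange_smooth (p₀ p₁ : L) :
    ContDiffOn ℝ ∞ (S.codChart p₁ ∘ (S.codChart p₀).symm)
      ((S.codChart p₀).symm.trans (S.codChart p₁)).source := by
  rw [← contMDiffOn_iff_contDiffOn]
  have h1 := contMDiffOn_of_mem_maximalAtlas (S.codChart_mem p₁)
  have h0 := contMDiffOn_symm_of_mem_maximalAtlas (S.codChart_mem p₀)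
  exact h1.comp (h0.mono fun x hx => hx.1) fun x hx => hx.2

lemma codDeriv_change (p₀ p₁ : L) {x : M} (h0 : x ∈ (S.codChart p₀).source)
    (h1 : x ∈ (S.codChart p₁).source) (u : E) :
    S.codDeriv p₁ x (S.ofCoord p₀ x u) =
      fderiv ℝ (S.codChart p₁ ∘ (S.codChart p₀).symm) (S.codChart p₀ x) u := by
  set v := S.ofCoord p₀ x u with hv
  have hu : S.codDeriv p₀ x v = u := S.codDeriv_ofCoord p₀ h0 u
  have m0 := IsManifold.maximalAtlas_subset_of_le (I := 𝓘(ℝ, E)) (M := M)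
    (show (1 : WithTop ℕ∞) ≤ ∞ by simp) (S.codChart_mem p₀)
  have hx : S.codChart p₀ x ∈ ((S.codChart p₀).symm.trans (S.codChart p₁)).source :=
    ⟨(S.codChart p₀).map_source h0, by
      simpa [(S.codChart p₀).left_inv h0] using h1⟩
  have hg : DifferentiableAt ℝ (S.codChart p₁ ∘ (S.codChart p₀).symm) (S.codChart p₀ x) :=
    ((S.chartChange_smooth p₀ p₁).contDiffAt
      (((S.codChart p₀).symm.trans (S.codChart p₁)).open_source.mem_nhds hx)).differentiableAt
      (by simp)
  have key : S.codChart p₁ =ᶠ[𝓝 x] (S.codChart p₁ ∘ (S.codChart p₀).symm) ∘ S.codChart p₀ := by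
    filter_upwards [(S.codChart p₀).open_source.mem_nhds h0] with y hy
    simp [(S.codChart p₀).left_inv hy]
  have e2 := mfderiv_comp (I := 𝓘(ℝ, E)) (I' := 𝓘(ℝ, E)) (I'' := 𝓘(ℝ, E)) x hg.mdifferentiableAt
    (mdifferentiableAt_of_mem_maximalAtlas m0 h0)
  rw [← key.mfderiv_eq, mfderiv_eq_fderiv] at e2
  have e3 := DFunLike.congr_fun e2 v
  rw [← hu]
  exact e3

lemma coordChange_smooth (p₀ p₁ : L) :
    ContMDiffOn 𝓘(ℝ, E₁) 𝓘(ℝ, F →L[ℝ] F) ∞ (S.coordChange p₀ p₁)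
      ((S.domChart p₀).source ∩ (S.domChart p₁).source) := by
  set g : E → E := S.codChart p₁ ∘ (S.codChart p₀).symm with hg
  set U : Set E := ((S.codChart p₀).symm.trans (S.codChart p₁)).source with hU
  have hd : ContDiffOn ℝ ∞ (fderiv ℝ g) U :=
    (S.chartChange_smooth p₀ p₁).fderiv_of_isOpen
      ((S.codChart p₀).symm.trans (S.codChart p₁)).open_source (by simp)
  have hc : ContMDiffOn 𝓘(ℝ, E₁) 𝓘(ℝ, E) ∞ (fun p => S.codChart p₀ (S.incl p))
      ((S.domChart p₀).source ∩ (S.domChart p₁).source) :=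
    (contMDiffOn_of_mem_maximalAtlas (S.codChart_mem p₀)).comp
      S.isImmersion.contMDiff.contMDiffOn (fun p hp => S.mapsTo_source p₀ hp.1)
  have hm : MapsTo (fun p => S.codChart p₀ (S.incl p))
      ((S.domChart p₀).source ∩ (S.domChart p₁).source) U := fun p hp =>
    ⟨(S.codChart p₀).map_source (S.mapsTo_source p₀ hp.1), by
      simpa [(S.codChart p₀).left_inv (S.mapsTo_source p₀ hp.1)] using S.mapsTo_source p₁ hp.2⟩
  have h2 : ContMDiffOn 𝓘(ℝ, E₁) 𝓘(ℝ, E →L[ℝ] E) ∞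
      (fun p => fderiv ℝ g (S.codChart p₀ (S.incl p)))
      ((S.domChart p₀).source ∩ (S.domChart p₁).source) :=
    (contMDiffOn_iff_contDiffOn.2 hd).comp hc hm
  let A : F →L[ℝ] E := (S.sliceEquiv p₀).toContinuousLinearMap.comp
    (ContinuousLinearMap.inr ℝ E₁ F)
  let B : E →L[ℝ] F := (ContinuousLinearMap.snd ℝ E₁ F).comp
    (S.sliceEquiv p₁).symm.toContinuousLinearMap
  have h3 : ContMDiffOn 𝓘(ℝ, E₁) 𝓘(ℝ, F →L[ℝ] F) ∞
      (fun p => B.comp ((fderiv ℝ g (S.codChart p₀ (S.incl p))).comp A))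
      ((S.domChart p₀).source ∩ (S.domChart p₁).source) :=
    contMDiffOn_const.clm_comp (h2.clm_comp contMDiffOn_const)
  refine h3.congr fun p hp => ?_
  ext f
  exact congrArg B (S.codDeriv_change p₀ p₁ (S.mapsTo_source p₀ hp.1)
    (S.mapsTo_source p₁ hp.2) (A f))

lemma coordChange_apply (p₀ p₁ : L) {p : L}
    (hp : p ∈ (S.domChart p₀).source ∩ (S.domChart p₁).source) (f : F) :
    S.coordChange p₀ p₁ p f = (S.pretriv p₁ ⟨p, (S.pretriv p₀).symm p f⟩).2 := by
  rw [S.pretriv_symm p₀ hp.1]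
  exact (S.normalCoordQ_proj p₁ hp.2 _).symm

/-- The normal bundle `N_LM`, with total space `TotalSpace F S.Normal`. -/
def prebundle : VectorPrebundle ℝ F S.Normal where
  pretrivializationAtlas := range S.pretriv
  pretrivialization_linear' := by
    rintro _ ⟨p₀, rfl⟩
    exact ⟨fun p _ => (S.normalCoordQ p₀ p).toLinearMap.isLinear⟩
  pretrivializationAt := S.pretriv
  mem_base_pretrivializationAt p := (S.isImmersion p).mem_domChart_source
  pretrivialization_mem_atlas p := ⟨p, rfl⟩
  exists_coordChange := by
    rintro _ ⟨p₀, rfl⟩ _ ⟨p₁, rfl⟩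
    exact ⟨S.coordChange p₀ p₁, (S.coordChange_smooth p₀ p₁).continuousOn,
      fun p hp f => S.coordChange_apply p₀ p₁ hp f⟩
  totalSpaceMk_isInducing p := by
    have hp : p ∈ (S.domChart p).source := (S.isImmersion p).mem_domChart_source
    let e : S.Normal p ≃ₜ F :=
      { toFun := S.normalCoordQ p p
        invFun := fun f => S.proj p (S.normalLift p p f)
        left_inv := S.proj_lift_normalCoordQ p hp
        right_inv := S.normalCoordQ_lift p hp
        continuous_toFun := (S.normalCoordQ p p).continuous
        continuous_invFun := ((S.proj p).comp (S.normalLift p p)).continuous }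
    exact isInducing_const_prod.mpr e.isInducing

instance : S.prebundle.IsContMDiff 𝓘(ℝ, E₁) ∞ where
  exists_contMDiffCoordChange := by
    rintro _ ⟨p₀, rfl⟩ _ ⟨p₁, rfl⟩
    exact ⟨S.coordChange p₀ p₁, S.coordChange_smooth p₀ p₁,
      fun p hp f => S.coordChange_apply p₀ p₁ hp f⟩

instance : TopologicalSpace (TotalSpace F S.Normal) := S.prebundle.totalSpaceTopology
instance : FiberBundle F S.Normal := S.prebundle.toFiberBundle
instance : VectorBundle ℝ F S.Normal := S.prebundle.toVectorBundle
instance : ContMDiffVectorBundle ∞ F S.Normal 𝓘(ℝ, E₁) :=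
  S.prebundle.contMDiffVectorBundle 𝓘(ℝ, E₁)

end EmbeddedSubmanifold

/-! ### Almost complex structures on a manifold -/

section AlmostComplex

variable {V H X : Type*} [NormedAddCommGroup V] [NormedSpace ℝ V] [TopologicalSpace H]
  (I : ModelWithCorners ℝ V H) [TopologicalSpace X] [ChartedSpace H X]

/-- A vector field is smooth near (more precisely, `C^∞` at) the point `x`. -/
def SmoothFieldAt (Y : ∀ x : X, TangentSpace I x) (x : X) [IsManifold I 1 X] : Prop :=
  ContMDiffAt I I.tangent ∞ (fun y => (⟨y, Y y⟩ : TangentBundle I X)) x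

/-- `J` is a smooth almost complex structure. -/
structure IsAlmostComplex [IsManifold I 1 X]
    (J : ∀ x : X, TangentSpace I x →L[ℝ] TangentSpace I x) : Prop where
  smooth : ContMDiff I (I.prod 𝓘(ℝ, V →L[ℝ] V)) ∞
    (fun x => (⟨x, J x⟩ : TotalSpace (V →L[ℝ] V)
      (fun x : X => TangentSpace I x →L[ℝ] TangentSpace I x)))
  sq : ∀ (x : X) (v : TangentSpace I x), J x (J x v) = -v

variable {I}

/-- The Nijenhuis expression `[JY, JZ] - J[JY, Z] - J[Y, JZ] - [Y, Z]`. -/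
def nijenhuis (J : ∀ x : X, TangentSpace I x →L[ℝ] TangentSpace I x)
    (Y Z : ∀ x : X, TangentSpace I x) (x : X) : TangentSpace I x :=
  VectorField.mlieBracket I (fun y => J y (Y y)) (fun y => J y (Z y)) x
    - J x (VectorField.mlieBracket I (fun y => J y (Y y)) Z x)
    - J x (VectorField.mlieBracket I Y (fun y => J y (Z y)) x)
    - VectorField.mlieBracket I Y Z x

/-- Integrability: the Nijenhuis tensor vanishes. -/
def IsIntegrable [IsManifold I 1 X]
    (J : ∀ x : X, TangentSpace I x →L[ℝ] TangentSpace I x) : Prop :=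
  ∀ (x : X) (Y Z : ∀ x : X, TangentSpace I x), SmoothFieldAt I Y x → SmoothFieldAt I Z x →
    nijenhuis J Y Z x = 0

variable {V' H' X' : Type*} [NormedAddCommGroup V'] [NormedSpace ℝ V'] [TopologicalSpace H']
  {I' : ModelWithCorners ℝ V' H'} [TopologicalSpace X'] [ChartedSpace H' X']

/-- A smooth map whose differential intertwines the fields `J` and `J'` of endomorphisms. -/
def IsPseudoholomorphic (J : ∀ x : X, TangentSpace I x →L[ℝ] TangentSpace I x)
    (J' : ∀ x : X', TangentSpace I' x →L[ℝ] TangentSpace I' x) (f : X → X') : Prop :=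
  ContMDiff I I' ∞ f ∧ ∀ (x : X) (v : TangentSpace I x),
    mfderiv I I' f x (J x v) = J' (f x) (mfderiv I I' f x v)

/-- The pull-back `f_*⁻¹ ∘ J' ∘ f_*` of a field of endomorphisms (meaningful where the
differential of `f` is invertible). -/
def pullbackEnd (f : X → X') (J' : ∀ x : X', TangentSpace I' x →L[ℝ] TangentSpace I' x) (x : X) :
    TangentSpace I x →L[ℝ] TangentSpace I x :=
  (mfderiv I I' f x).inverse.comp ((J' (f x)).comp (mfderiv I I' f x))

end AlmostComplex

/-! ### Minimal connections and geodesics -/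

section Connection

variable {E M : Type*} [NormedAddCommGroup E] [NormedSpace ℝ E]
  [TopologicalSpace M] [ChartedSpace E M]

/-- The vector field near `x` with constant components `v` in the preferred chart at `x`. -/
def coordField [IsManifold 𝓘(ℝ, E) 1 M] (x : M) (v : TangentSpace 𝓘(ℝ, E) x) :
    ∀ y : M, TangentSpace 𝓘(ℝ, E) y :=
  FiberBundle.extend E v

/-- A smooth linear connection `∇` on the open set `U`, where `cov Y x v` stands for `∇_v Y` at
`x`, that is minimal: `∇J = 0` and the torsion is `¼ N_J`. -/
structure IsMinimalConnectionOn [IsManifold 𝓘(ℝ, E) 1 M]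
    (J : ∀ x : M, TangentSpace 𝓘(ℝ, E) x →L[ℝ] TangentSpace 𝓘(ℝ, E) x) (U : Set M)
    (cov : (∀ x : M, TangentSpace 𝓘(ℝ, E) x) →
      (∀ x : M, TangentSpace 𝓘(ℝ, E) x →L[ℝ] TangentSpace 𝓘(ℝ, E) x)) : Prop where
  isOpen : IsOpen U
  isCovariantDerivativeOn : IsCovariantDerivativeOn E cov U
  smooth : ContMDiffCovariantDerivativeOn E ∞ cov U
  preserves : ∀ x ∈ U, ∀ Y : (∀ x : M, TangentSpace 𝓘(ℝ, E) x), SmoothFieldAt 𝓘(ℝ, E) Y x →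
    ∀ v, cov (fun y => J y (Y y)) x v = J x (cov Y x v)
  torsion : ∀ x ∈ U, ∀ Y Z : (∀ x : M, TangentSpace 𝓘(ℝ, E) x),
    SmoothFieldAt 𝓘(ℝ, E) Y x → SmoothFieldAt 𝓘(ℝ, E) Z x →
    cov Z x (Y x) - cov Y x (Z x) - VectorField.mlieBracket 𝓘(ℝ, E) Y Z x
      = (1 / 4 : ℝ) • nijenhuis J Y Z x

/-- The velocity `γ̇(t)`. -/
def velocity (γ : ℝ → M) (t : ℝ) : TangentSpace 𝓘(ℝ, E) (γ t) :=
  mfderiv 𝓘(ℝ, ℝ) 𝓘(ℝ, E) γ t (1 : ℝ)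

/-- The second derivative `γ̈(t)` of the components of `γ` in the preferred chart at `γ t`; the
differential of that chart is the identification of the tangent space at `γ t` with `E`. -/
def chartAcceleration (γ : ℝ → M) (t : ℝ) : TangentSpace 𝓘(ℝ, E) (γ t) :=
  show E from deriv (deriv (extChartAt 𝓘(ℝ, E) (γ t) ∘ γ)) t

/-- `γ` is a geodesic in `U` on the set `s` of parameters. In the preferred chart at `γ t` the
equation reads `γ̈ᵏ + Γᵏᵢⱼ γ̇ⁱ γ̇ʲ = 0` at the time `t`, with `Γᵏᵢⱼ ∂ₖ = ∇_{∂ᵢ} ∂ⱼ`. -/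
structure IsGeodesicOn [IsManifold 𝓘(ℝ, E) 1 M]
    (cov : (∀ x : M, TangentSpace 𝓘(ℝ, E) x) →
      (∀ x : M, TangentSpace 𝓘(ℝ, E) x →L[ℝ] TangentSpace 𝓘(ℝ, E) x)) (U : Set M)
    (γ : ℝ → M) (s : Set ℝ) : Prop where
  smooth : ContMDiffOn 𝓘(ℝ, ℝ) 𝓘(ℝ, E) ∞ γ s
  mapsTo : MapsTo γ s U
  equation : ∀ t ∈ s, chartAcceleration γ t +
    cov (coordField (γ t) (velocity γ t)) (γ t) (velocity γ t) = 0

/-- `y = γ(1)` for a geodesic `γ` in `U`, defined near `[0, 1]`, with `γ(0) = x`, `γ̇(0) = v`. -/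
def IsExp [IsManifold 𝓘(ℝ, E) 1 M]
    (cov : (∀ x : M, TangentSpace 𝓘(ℝ, E) x) →
      (∀ x : M, TangentSpace 𝓘(ℝ, E) x →L[ℝ] TangentSpace 𝓘(ℝ, E) x)) (U : Set M)
    (x : M) (v : TangentSpace 𝓘(ℝ, E) x) (y : M) : Prop :=
  ∃ (γ : ℝ → M) (s : Set ℝ), IsOpen s ∧ Icc (0 : ℝ) 1 ⊆ s ∧ IsGeodesicOn cov U γ s ∧
    (⟨γ 0, velocity γ 0⟩ : TangentBundle 𝓘(ℝ, E) M) = ⟨x, v⟩ ∧ γ 1 = y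

open Classical in
/-- The exponential map; where it is not defined we use the value `x`. -/
def expMap [IsManifold 𝓘(ℝ, E) 1 M]
    (cov : (∀ x : M, TangentSpace 𝓘(ℝ, E) x) →
      (∀ x : M, TangentSpace 𝓘(ℝ, E) x →L[ℝ] TangentSpace 𝓘(ℝ, E) x)) (U : Set M)
    (x : M) (v : TangentSpace 𝓘(ℝ, E) x) : M :=
  if h : ∃ y, IsExp cov U x v y then h.choose else x

/-- The derivative at `x`, in the direction `v`, of the components of the vector field `Z` in the
preferred chart at `x`. (If `Z x = 0`, this does not depend on the chart.) -/
def fieldDeriv [IsManifold 𝓘(ℝ, E) 1 M] (Z : ∀ x : M, TangentSpace 𝓘(ℝ, E) x) (x : M)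
    (v : TangentSpace 𝓘(ℝ, E) x) : TangentSpace 𝓘(ℝ, E) x :=
  (trivializationAt E (TangentSpace 𝓘(ℝ, E)) x).symm x
    (show E from mfderiv 𝓘(ℝ, E) 𝓘(ℝ, E)
      (fun y => (trivializationAt E (TangentSpace 𝓘(ℝ, E)) x ⟨y, Z y⟩).2) x v)

end Connection

/-! ### The normal bundle of a pseudoholomorphic submanifold -/

namespace EmbeddedSubmanifold

variable {E₁ F L E M : Type*}
    [NormedAddCommGroup E₁] [NormedSpace ℝ E₁] [NormedAddCommGroup F] [NormedSpace ℝ F]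
    [TopologicalSpace L] [ChartedSpace E₁ L]
    [NormedAddCommGroup E] [NormedSpace ℝ E] [TopologicalSpace M] [ChartedSpace E M]
    (S : EmbeddedSubmanifold E₁ F L E M)
    (J : ∀ x : M, TangentSpace 𝓘(ℝ, E) x →L[ℝ] TangentSpace 𝓘(ℝ, E) x)

/-- `TL` is `J`-invariant. -/
def IsPHSubmanifold : Prop :=
  ∀ (p : L), ∀ v ∈ S.tangent p, J (S.incl p) v ∈ S.tangent p

open Classical in
/-- The restriction `J|_L`: the endomorphism `K` of `T_pL` with `dι ∘ K = J ∘ dι`, where `ι` is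
the inclusion (see `dincl_restrict` and `dincl_injective` for existence and uniqueness). -/
def restrict (p : L) : TangentSpace 𝓘(ℝ, E₁) p →L[ℝ] TangentSpace 𝓘(ℝ, E₁) p :=
  if h : ∃ K : TangentSpace 𝓘(ℝ, E₁) p →L[ℝ] TangentSpace 𝓘(ℝ, E₁) p,
      ∀ w, S.dincl p (K w) = J (S.incl p) (S.dincl p w) then h.choose
  else 0

lemma dincl_injective (p : L) : Function.Injective (S.dincl p) := by
  intro w w' h
  have hp : p ∈ (S.domChart p).source := (S.isImmersion p).mem_domChart_source
  apply (S.domDeriv_bijective p hp).1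
  have h1 := S.codDeriv_dincl p hp w
  rw [h, S.codDeriv_dincl p hp w'] at h1
  exact (congrArg Prod.fst ((S.sliceEquiv p).injective h1)).symm

lemma dincl_restrict [FiniteDimensional ℝ E₁] (hJ : S.IsPHSubmanifold J) (p : L)
    (w : TangentSpace 𝓘(ℝ, E₁) p) :
    S.dincl p (S.restrict J p w) = J (S.incl p) (S.dincl p w) := by
  have h : ∃ K : TangentSpace 𝓘(ℝ, E₁) p →L[ℝ] TangentSpace 𝓘(ℝ, E₁) p,
      ∀ w, S.dincl p (K w) = J (S.incl p) (S.dincl p w) := by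
    choose k hk using fun w : TangentSpace 𝓘(ℝ, E₁) p => hJ p (S.dincl p w) ⟨w, rfl⟩
    have hk' : ∀ w, S.dincl p (k w) = J (S.incl p) (S.dincl p w) := hk
    let K : TangentSpace 𝓘(ℝ, E₁) p →ₗ[ℝ] TangentSpace 𝓘(ℝ, E₁) p :=
      { toFun := k
        map_add' := fun a b => S.dincl_injective p (by simp only [map_add, hk'])
        map_smul' := fun c a => S.dincl_injective p (by simp only [map_smul, hk', RingHom.id_apply]) }
    have hc : Continuous K := by
      let K' : E₁ →ₗ[ℝ] E₁ := K
      exact K'.continuous_of_finiteDimensional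
    exact ⟨⟨K, hc⟩, hk'⟩
  rw [restrict, dif_pos h]
  exact h.choose_spec w

/-- `(M, J)` is normally integrable along `L`: `N_J(TL, TM|_L) ⊂ TL`. -/
def IsNormallyIntegrable [IsManifold 𝓘(ℝ, E) 1 M] : Prop :=
  ∀ (p : L) (Y Z : ∀ x : M, TangentSpace 𝓘(ℝ, E) x),
    SmoothFieldAt 𝓘(ℝ, E) Y (S.incl p) → SmoothFieldAt 𝓘(ℝ, E) Z (S.incl p) →
    Y (S.incl p) ∈ S.tangent p → nijenhuis J Y Z (S.incl p) ∈ S.tangent p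

/-- The vector field `Y` of `M` is tangent to `L` at the points of `L` near `p`. -/
def TangentNear (Y : ∀ x : M, TangentSpace 𝓘(ℝ, E) x) (p : L) : Prop :=
  ∀ᶠ q in 𝓝 p, Y (S.incl q) ∈ S.tangent q

/-- The normal component `N_J^⊥ = χ ∘ N_J` vanishes on `TL` to the second order: for vector fields
`Y`, `Z` of `M` that are tangent to `L` along `L`, the value and the first derivatives of the
normal component of `N_J(Y, Z)` vanish at the points of `L`. -/
def NormalNijenhuisVanishesToSecondOrder [IsManifold 𝓘(ℝ, E) 1 M] : Prop :=
  ∀ (p : L) (Y Z : ∀ x : M, TangentSpace 𝓘(ℝ, E) x),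
    SmoothFieldAt 𝓘(ℝ, E) Y (S.incl p) → SmoothFieldAt 𝓘(ℝ, E) Z (S.incl p) →
    S.TangentNear Y p → S.TangentNear Z p →
    S.proj p (nijenhuis J Y Z (S.incl p)) = 0 ∧
    ∀ v, S.proj p (fieldDeriv (nijenhuis J Y Z) (S.incl p) v) = 0

/-- `L` is totally geodesic: `∇_v Y ∈ TL` for `v ∈ TL` and `Y` tangent to `L` along `L`. -/
def IsTotallyGeodesic [IsManifold 𝓘(ℝ, E) 1 M]
    (cov : (∀ x : M, TangentSpace 𝓘(ℝ, E) x) →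
      (∀ x : M, TangentSpace 𝓘(ℝ, E) x →L[ℝ] TangentSpace 𝓘(ℝ, E) x)) : Prop :=
  ∀ (p : L) (Y : ∀ x : M, TangentSpace 𝓘(ℝ, E) x), SmoothFieldAt 𝓘(ℝ, E) Y (S.incl p) →
    S.TangentNear Y p → ∀ v ∈ S.tangent p, cov Y (S.incl p) v ∈ S.tangent p

/-- A smooth `J`-invariant subbundle `F ⊂ TM|_L` with `TL ⊕ F = TM|_L`, given by the
identification `σ : N_LM ≃ F ⊂ TM|_L` inverse to the projection `χ`. -/
structure IsInvariantComplement [IsManifold 𝓘(ℝ, E) 1 M]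
    (σ : ∀ p : L, S.Normal p →L[ℝ] TangentSpace 𝓘(ℝ, E) (S.incl p)) : Prop where
  proj_apply : ∀ (p : L) (n : S.Normal p), S.proj p (σ p n) = n
  invariant : ∀ (p : L) (n : S.Normal p), ∃ m : S.Normal p, J (S.incl p) (σ p n) = σ p m
  smooth : ContMDiff (𝓘(ℝ, E₁).prod 𝓘(ℝ, F)) 𝓘(ℝ, E).tangent ∞
    (fun a : TotalSpace F S.Normal => (⟨S.incl a.proj, σ a.proj a.2⟩ : TangentBundle 𝓘(ℝ, E) M))

/-- The zero section `ρ : L → N_LM`. -/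
def zeroSec (p : L) : TotalSpace F S.Normal := ⟨p, 0⟩

/-- The dilatation `R^t : v ↦ t v` along the fibres. -/
def dilatation (t : ℝ) (a : TotalSpace F S.Normal) : TotalSpace F S.Normal :=
  ⟨a.proj, t • a.2⟩

/-- The map `φ : N_LM ≃ F → M`, the restriction of the exponential map of `∇`. -/
def normalExp [IsManifold 𝓘(ℝ, E) 1 M]
    (cov : (∀ x : M, TangentSpace 𝓘(ℝ, E) x) →
      (∀ x : M, TangentSpace 𝓘(ℝ, E) x →L[ℝ] TangentSpace 𝓘(ℝ, E) x)) (U : Set M)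
    (σ : ∀ p : L, S.Normal p →L[ℝ] TangentSpace 𝓘(ℝ, E) (S.incl p))
    (a : TotalSpace F S.Normal) : M :=
  expMap cov U (S.incl a.proj) (σ a.proj a.2)

/-- `J_t = (R^t)_*⁻¹ ∘ (φ_*⁻¹ ∘ J ∘ φ_*) ∘ (R^t)_*`. -/
def dilated (φ : TotalSpace F S.Normal → M) (t : ℝ) (a : TotalSpace F S.Normal) :
    TangentSpace (𝓘(ℝ, E₁).prod 𝓘(ℝ, F)) a →L[ℝ] TangentSpace (𝓘(ℝ, E₁).prod 𝓘(ℝ, F)) a :=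
  pullbackEnd (I := 𝓘(ℝ, E₁).prod 𝓘(ℝ, F)) (I' := 𝓘(ℝ, E₁).prod 𝓘(ℝ, F)) (S.dilatation t)
    (pullbackEnd (I := 𝓘(ℝ, E₁).prod 𝓘(ℝ, F)) (I' := 𝓘(ℝ, E)) φ J) a

end EmbeddedSubmanifold

end

/-!
The proof works in slice coordinates `E₁ × F` of `M`, in which `L` is `E₁ × 0`, and in the induced
bundle coordinates `E₁ × F` of the normal bundle.

*The limit.* In these coordinates the normal exponential map is a local diffeomorphism `Φ` that
fixes the points `(u, 0)` and whose differential there is of the form `(x, n) ↦ (x + α n, n)`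
(`exists_normalExp_coord`). Let `𝒥` be the matrix of `J`; along `E₁ × 0` it preserves `E₁ × 0`. The
matrix `G` of the pull-back of `J` by the normal exponential map is conjugate to `𝒥` by `Φ` and has
the same property. Conjugating `G` by the dilatation `n ↦ t n` leaves the diagonal blocks alone,
multiplies the block `F → E₁` by `t` and divides the block `E₁ → F` by `t`; as the latter vanishes
at `t = 0`, the dilated structures converge to the `linearization` of `G`, whose blocks are the
diagonal blocks of `G` at `(u, 0)` and the normal derivative of the block `E₁ → F`
(`tendsto_dilated_linearization`). Differentiating the relation between `G` and `𝒥` in a normal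
direction shows that `G` and `𝒥` have the same linearization, as the mixed second derivatives of the
`F`-component of `Φ` vanish by symmetry (`linearization_conj`). The limit therefore depends on `J`
only, and not on the complement or the connection; being a limit it is independent of the
coordinates as well, and it defines the structure `normalStructure` on the normal bundle. This step
needs of the exponential map that it is smooth near the zero vectors with known differential there
(`exists_local_exp`), which rests on the smooth dependence of solutions of ordinary differential
equations on the initial values (`exists_smooth_flow`, from the inverse function theorem in a space
of continuous curves), and that geodesics are unique (`IsExp.unique`).

*Its properties.* The square of the linearization is `-1`, by differentiation of `𝒥 ∘ 𝒥 = -1`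
(`linearization_sq`), and the statements on the projection and the zero section can be read off the
blocks. The Nijenhuis tensor of the linearization is computed in `localNijenhuis_linearization`: on
horizontal vectors its `E₁`-component is the Nijenhuis tensor of `J` on `L`, and its `F`-component
at `(u, n)` is the derivative in the direction `n` of the normal part of the Nijenhuis tensor of
`J`; on a horizontal and a vertical vector it is the normal part of the Nijenhuis tensor of `J`. The
three conditions for integrability say that these terms vanish
(`EmbeddedSubmanifold.IsLinearizationOf.isIntegrable_iff`).

*Existence of the choices.* Complements of `TL` are glued by a partition of unity on `L` and made
invariant by passing to the complex linear part (`exists_isInvariantComplement`). In coordinates,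
`minimalCoefficients` gives a minimal connection explicitly in terms of `𝒥` and its first
derivatives. The condition of being minimal is affine, so the connections of the slice charts can be
glued on the union of the charts (`exists_isMinimalConnectionOn_iUnion`). Along `L` the field `𝒥`
and its derivatives in the directions of `L` preserve `E₁ × 0`, so `L` is totally geodesic
(`minimalConnection_mem_tangent`). The limit for these choices determines the structure, whence its
uniqueness.
-/

set_option linter.unusedSectionVars false
set_option synthInstance.maxHeartbeats 100000

noncomputable section

section Shortcuts

/-! The instances on spaces of continuous linear maps, as shortcuts for the instance search: for
iterated spaces of linear maps the general search is slow. -/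

variable {A B : Type*} [NormedAddCommGroup A] [NormedSpace ℝ A] [NormedAddCommGroup B]
  [NormedSpace ℝ B]

instance : SeminormedAddCommGroup (A →L[ℝ] B) := ContinuousLinearMap.toSeminormedAddCommGroup

instance : NormedAddCommGroup (A →L[ℝ] B) := ContinuousLinearMap.toNormedAddCommGroup

instance : NormedSpace ℝ (A →L[ℝ] B) := ContinuousLinearMap.toNormedSpace

end Shortcuts

/-! ### Smooth dependence of solutions of ordinary differential equations -/

section Superposition

universe u

variable {K : Type*} [TopologicalSpace K] [CompactSpace K] {V F : Type u}
  [NormedAddCommGroup V] [NormedSpace ℝ V] [NormedAddCommGroup F] [NormedSpace ℝ F]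

/-- The superposition operator `γ ↦ f ∘ γ` on spaces of continuous maps. -/
def superposition (f : V → F) (hf : Continuous f) (γ : C(K, V)) : C(K, F) := ⟨f ∘ γ, by fun_prop⟩

/-- Pointwise application of a continuous family of linear maps. -/
def pointwiseApply : C(K, V →L[ℝ] F) →L[ℝ] C(K, V) →L[ℝ] C(K, F) :=
  LinearMap.mkContinuous₂
    { toFun := fun A =>
        { toFun := fun h => ⟨fun t => A t (h t), by fun_prop⟩
          map_add' := fun h k => by ext t; simp
          map_smul' := fun c h => by ext t; simp }
      map_add' := fun A B => by ext h t; simp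
      map_smul' := fun c A => by ext h t; simp } 1 fun A h => by
    rw [one_mul, ContinuousMap.norm_le _ (by positivity)]
    intro t
    exact ((A t).le_opNorm _).trans
      (mul_le_mul (A.norm_coe_le_norm t) (h.norm_coe_le_norm t) (norm_nonneg _) (norm_nonneg _))

lemma continuous_superposition (f : V → F) (hf : Continuous f) :
    Continuous (superposition (K := K) f hf) :=
  ContinuousMap.continuous_postcomp ⟨f, hf⟩

/-- The derivative of `γ ↦ f ∘ γ` at `γ` is pointwise application of `fderiv f ∘ γ`; the error is
controlled by the mean value inequality, since `fderiv f ∘ γ` depends continuously on `γ` in the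
supremum norm. -/
lemma hasFDerivAt_superposition (f : V → F) (hf : ContDiff ℝ 1 f) (γ : C(K, V)) :
    HasFDerivAt (superposition (K := K) f hf.continuous)
      (pointwiseApply (superposition (fderiv ℝ f) (hf.continuous_fderiv (by simp)) γ)) γ := by
  rw [hasFDerivAt_iff_isLittleO_nhds_zero, Asymptotics.isLittleO_iff]
  intro ε hε
  have hc := (continuous_superposition (K := K) (fderiv ℝ f)
    (hf.continuous_fderiv (by simp))).continuousAt (x := γ)
  obtain ⟨δ, hδ, hδ'⟩ := Metric.continuousAt_iff.1 hc ε hε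
  filter_upwards [Metric.ball_mem_nhds (0 : C(K, V)) hδ] with h hh
  rw [ContinuousMap.norm_le _ (by positivity)]
  intro t
  -- the mean value inequality on the segment from `γ t` to `γ t + h t`
  have hseg : ∀ z ∈ segment ℝ (γ t) (γ t + h t), ‖fderiv ℝ f z - fderiv ℝ f (γ t)‖ ≤ ε := by
    rintro z hz
    rw [segment_eq_image'] at hz
    obtain ⟨s, hs, rfl⟩ := hz
    have h1 : dist (γ + s • h) γ < δ := by
      rw [dist_eq_norm, add_sub_cancel_left, norm_smul, Real.norm_of_nonneg hs.1]
      rw [mem_ball_zero_iff] at hh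
      nlinarith [norm_nonneg h, hs.2]
    have h2 := (ContinuousMap.dist_apply_le_dist t).trans_lt (hδ' h1)
    rw [dist_eq_norm] at h2
    simpa [superposition] using h2.le
  have := (convex_segment (𝕜 := ℝ) (γ t) (γ t + h t)).norm_image_sub_le_of_norm_hasFDerivWithin_le'
    (f := f) (f' := fderiv ℝ f) (φ := fderiv ℝ f (γ t)) (C := ε)
    (fun z _ => (hf.differentiable (by simp) z).hasFDerivAt.hasFDerivWithinAt) hseg
    (left_mem_segment ℝ _ _) (right_mem_segment ℝ _ _)
  rw [add_sub_cancel_left] at this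
  exact this.trans (mul_le_mul_of_nonneg_left (h.norm_coe_le_norm t) hε.le)

/-- By induction on `n`: the derivative is built from the superposition operator of `fderiv f`. Its
codomain is another space than that of `f`, which is therefore quantified in the induction; this
is why `V` and `F` live in the same universe. -/
lemma contDiff_superposition_nat (n : ℕ) : ∀ {F : Type u} [NormedAddCommGroup F]
    [NormedSpace ℝ F] (f : V → F) (hf : ContDiff ℝ ∞ f),
    ContDiff ℝ n (superposition (K := K) f hf.continuous) := by
  induction n with
  | zero => intro F _ _ f hf; exact contDiff_zero.2 (continuous_superposition f _)
  | succ n ih =>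
    intro F _ _ f hf
    have hf' : ContDiff ℝ ∞ (fderiv ℝ f) := hf.fderiv_right (by simp)
    rw [show ((n + 1 : ℕ) : WithTop ℕ∞) = n + 1 by simp, contDiff_succ_iff_hasFDerivAt]
    exact ⟨fun γ => pointwiseApply (superposition (fderiv ℝ f) hf'.continuous γ),
      (pointwiseApply (K := K) (V := V) (F := F)).contDiff.comp (ih _ hf'),
      fun γ => hasFDerivAt_superposition f (hf.of_le (by simp)) γ⟩

lemma contDiff_superposition (f : V → F) (hf : ContDiff ℝ ∞ f) :
    ContDiff ℝ ∞ (superposition (K := K) f hf.continuous) :=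
  contDiff_infty.2 fun n => contDiff_superposition_nat n f hf

end Superposition

section Flow

universe u

variable {V : Type u} [NormedAddCommGroup V] [NormedSpace ℝ V] [CompleteSpace V]

/-- The primitive `t ↦ ∫₀ᵗ y` of a continuous function on `[-1, 2]`, as a function on `ℝ`. -/
def primitiveFun (y : C(Icc (-1 : ℝ) 2, V)) (t : ℝ) : V :=
  ∫ s in (0 : ℝ)..t, y (projIcc (-1) 2 (by norm_num) s)

lemma continuous_projIcc_comp (y : C(Icc (-1 : ℝ) 2, V)) :
    Continuous fun s => y (projIcc (-1) 2 (by norm_num) s) :=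
  y.continuous.comp continuous_projIcc

lemma hasDerivAt_primitiveFun (y : C(Icc (-1 : ℝ) 2, V)) (t : ℝ) :
    HasDerivAt (primitiveFun y) (y (projIcc (-1) 2 (by norm_num) t)) t :=
  (continuous_projIcc_comp y).integral_hasStrictDerivAt 0 t |>.hasDerivAt

/-- The primitive vanishing at `0`, as an operator on `C([-1, 2], V)`. -/
def primitiveCLM : C(Icc (-1 : ℝ) 2, V) →L[ℝ] C(Icc (-1 : ℝ) 2, V) :=
  LinearMap.mkContinuous
    { toFun := fun y => ⟨fun t => primitiveFun y t, by
        have : Continuous (primitiveFun y) :=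
          continuous_iff_continuousAt.2 fun t => (hasDerivAt_primitiveFun y t).continuousAt
        fun_prop⟩
      map_add' := fun y z => by
        ext t
        exact intervalIntegral.integral_add ((continuous_projIcc_comp y).intervalIntegrable _ _)
          ((continuous_projIcc_comp z).intervalIntegrable _ _)
      map_smul' := fun c y => by
        ext t
        exact intervalIntegral.integral_smul c _ } 2 fun y => by
    rw [ContinuousMap.norm_le _ (by positivity)]
    intro t
    refine (intervalIntegral.norm_integral_le_of_norm_le_const (C := ‖y‖)
      fun s _ => y.norm_coe_le_norm _).trans ?_
    have : |(t : ℝ) - 0| ≤ 2 := by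
      rw [abs_le]; constructor <;> linarith [t.2.1, t.2.2]
    rw [mul_comm]; gcongr

/-- The constant functions, as a continuous linear map. -/
def constCLM : V →L[ℝ] C(Icc (-1 : ℝ) 2, V) :=
  LinearMap.mkContinuous
    { toFun := fun v => ContinuousMap.const _ v
      map_add' := fun _ _ => rfl
      map_smul' := fun _ _ => rfl } 1 fun v => by
    rw [ContinuousMap.norm_le _ (by positivity)]
    intro t
    rw [one_mul]
    rfl

/-- The defect of the integral equation `y = z + ε ∫₀ f(y)`, together with its parameters. -/
def flowDefect (f : V → V) (hf : Continuous f) (p : ℝ × V × C(Icc (-1 : ℝ) 2, V)) :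
    ℝ × V × C(Icc (-1 : ℝ) 2, V) :=
  (p.1, p.2.1, p.2.2 - constCLM p.2.1 - p.1 • primitiveCLM (superposition f hf p.2.2))

lemma contDiff_flowDefect (f : V → V) (hf : ContDiff ℝ ∞ f) :
    ContDiff ℝ ∞ (flowDefect f hf.continuous) := by
  have h := contDiff_superposition (K := Icc (-1 : ℝ) 2) f hf
  unfold flowDefect
  have h2 : ContDiff ℝ ∞ fun p : ℝ × V × C(Icc (-1 : ℝ) 2, V) =>
      primitiveCLM (superposition f hf.continuous p.2.2) :=
    primitiveCLM.contDiff.comp (h.comp (contDiff_snd.comp contDiff_snd))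
  have h3 : ContDiff ℝ ∞ fun p : ℝ × V × C(Icc (-1 : ℝ) 2, V) =>
      (constCLM p.2.1 : C(Icc (-1 : ℝ) 2, V)) :=
    (constCLM (V := V)).contDiff.comp (contDiff_fst.comp contDiff_snd)
  fun_prop

/-- At `ε = 0` the linearization of the integral equation is triangular. -/
lemma hasFDerivAt_flowDefect (f : V → V) (hf : ContDiff ℝ ∞ f) (z : V) :
    ∃ e : (ℝ × V × C(Icc (-1 : ℝ) 2, V)) ≃L[ℝ] (ℝ × V × C(Icc (-1 : ℝ) 2, V)),
      HasFDerivAt (flowDefect f hf.continuous)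
        (e : (ℝ × V × C(Icc (-1 : ℝ) 2, V)) →L[ℝ] (ℝ × V × C(Icc (-1 : ℝ) 2, V)))
        (0, z, constCLM z) := by
  set X := ℝ × V × C(Icc (-1 : ℝ) 2, V)
  set P : X → C(Icc (-1 : ℝ) 2, V) := fun p => primitiveCLM (superposition f hf.continuous p.2.2)
  set k := P (0, z, constCLM z) with hk
  let fst' : X →L[ℝ] ℝ := ContinuousLinearMap.fst ℝ _ _
  let snd' : X →L[ℝ] V := (ContinuousLinearMap.fst ℝ _ _).comp (ContinuousLinearMap.snd ℝ _ _)
  let trd' : X →L[ℝ] C(Icc (-1 : ℝ) 2, V) :=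
    (ContinuousLinearMap.snd ℝ _ _).comp (ContinuousLinearMap.snd ℝ _ _)
  let c : X →L[ℝ] C(Icc (-1 : ℝ) 2, V) := constCLM.comp snd' + fst'.smulRight k
  let A : X →L[ℝ] X := fst'.prod (snd'.prod (trd' - c))
  let B : X →L[ℝ] X := fst'.prod (snd'.prod (trd' + c))
  refine ⟨ContinuousLinearEquiv.equivOfInverse A B (fun p => ?_) (fun p => ?_), ?_⟩
  · refine Prod.ext rfl (Prod.ext rfl ?_)
    change p.2.2 - (constCLM p.2.1 + p.1 • k) + (constCLM p.2.1 + p.1 • k) = p.2.2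
    abel
  · refine Prod.ext rfl (Prod.ext rfl ?_)
    change p.2.2 + (constCLM p.2.1 + p.1 • k) - (constCLM p.2.1 + p.1 • k) = p.2.2
    abel
  · have hP : ContDiff ℝ ∞ P := primitiveCLM.contDiff.comp
      ((contDiff_superposition f hf).comp (contDiff_snd.comp contDiff_snd))
    have h1 : HasFDerivAt (fun p : X => p.1 • P p)
        ((0 : ℝ) • fderiv ℝ P (0, z, constCLM z) + fst'.smulRight (P (0, z, constCLM z)))
        (0, z, constCLM z) :=
      (fst'.hasFDerivAt (x := (0, z, constCLM z))).smul
        (hP.differentiable (by simp) _).hasFDerivAt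
    have h2 := (fst'.hasFDerivAt (x := (0, z, constCLM z))).prodMk
      ((snd'.hasFDerivAt (x := (0, z, constCLM z))).prodMk
      (((trd'.hasFDerivAt (x := (0, z, constCLM z))).sub
        ((constCLM.comp snd').hasFDerivAt (x := (0, z, constCLM z)))).sub h1))
    have h3 : fst'.prod (snd'.prod (trd' - constCLM.comp snd' -
        ((0 : ℝ) • fderiv ℝ P (0, z, constCLM z) + fst'.smulRight (P (0, z, constCLM z))))) =
        A := by
      rw [zero_smul, zero_add, sub_sub]
    rw [h3] at h2
    exact h2

/-- Local flows depend smoothly on the initial value. After slowing the equation down by a factor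
`ε`, solutions starting near `z₀` exist on `[-1, 2]` and stay in a given neighbourhood of `z₀`;
this is the implicit function theorem at `ε = 0`, where all solutions are constant. -/
theorem exists_smooth_flow (f : V → V) (hf : ContDiff ℝ ∞ f) (z₀ : V) {Ω : Set V}
    (hΩ : Ω ∈ 𝓝 z₀) :
    ∃ ε : ℝ, 0 < ε ∧ ∃ N : Set V, IsOpen N ∧ z₀ ∈ N ∧ ∃ Y : V → ℝ → V,
      (∀ z ∈ N, Y z 0 = z) ∧ (∀ z ∈ N, ∀ t ∈ Ioo (-1 : ℝ) 2, Y z t ∈ Ω) ∧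
      (∀ z ∈ N, ∀ t ∈ Ioo (-1 : ℝ) 2, HasDerivAt (Y z) (ε • f (Y z t)) t) ∧
      ContDiffOn ℝ ∞ (fun z => Y z 1) N := by
  obtain ⟨e, he⟩ := hasFDerivAt_flowDefect f hf z₀
  have hH := contDiff_flowDefect f hf
  set H := flowDefect f hf.continuous with hHdef
  set P := hH.contDiffAt.toOpenPartialHomeomorph H he (by simp) with hP
  have hPH : ∀ p, P p = H p := fun p => rfl
  set p₀ : ℝ × V × C(Icc (-1 : ℝ) 2, V) := (0, z₀, constCLM z₀) with hp₀
  have hp₀s : p₀ ∈ P.source := hH.contDiffAt.mem_toOpenPartialHomeomorph_source he (by simp)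
  have hHp₀ : H p₀ = (0, z₀, 0) := by simp [hHdef, flowDefect, hp₀]
  -- the admissible points: invertible linearization, and values in `Ω`
  obtain ⟨r, hr, hrΩ⟩ := Metric.mem_nhds_iff.1 hΩ
  let G : Set (ℝ × V × C(Icc (-1 : ℝ) 2, V)) := (fderiv ℝ H) ⁻¹' (range ((↑) :
    ((ℝ × V × C(Icc (-1 : ℝ) 2, V)) ≃L[ℝ] (ℝ × V × C(Icc (-1 : ℝ) 2, V))) →
    ((ℝ × V × C(Icc (-1 : ℝ) 2, V)) →L[ℝ] (ℝ × V × C(Icc (-1 : ℝ) 2, V))))) ∩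
    {p | dist p.2.2 (constCLM z₀) < r}
  have hG : IsOpen G := by
    refine IsOpen.inter ?_ ?_
    · exact (ContinuousLinearEquiv.isOpen (𝕜 := ℝ)).preimage
        ((hH.fderiv_right (m := ∞) (by simp)).continuous)
    · exact isOpen_lt (by fun_prop) continuous_const
  have hGp₀ : p₀ ∈ G := ⟨⟨e, he.fderiv.symm⟩, by simpa [hp₀] using hr⟩
  let T := P.symm.source ∩ P.symm ⁻¹' G
  have hT : IsOpen T := P.symm.isOpen_inter_preimage hG
  have hTp₀ : ((0 : ℝ), z₀, (0 : C(Icc (-1 : ℝ) 2, V))) ∈ T := by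
    rw [← hHp₀, ← hPH]
    refine ⟨P.map_source hp₀s, ?_⟩
    rw [mem_preimage, P.left_inv hp₀s]; exact hGp₀
  let j : ℝ × V → ℝ × V × C(Icc (-1 : ℝ) 2, V) := fun q => (q.1, q.2, 0)
  have hj : ContDiff ℝ ∞ j := by fun_prop
  have hjT : j ⁻¹' T ∈ 𝓝 ((0 : ℝ), z₀) := hj.continuous.continuousAt (hT.mem_nhds hTp₀)
  rw [nhds_prod_eq] at hjT
  obtain ⟨A, hA, B, hB, hAB⟩ := Filter.mem_prod_iff.1 hjT
  obtain ⟨ε, hεA, hε⟩ : ∃ ε ∈ A, 0 < ε := by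
    have : A ∈ 𝓝[>] (0 : ℝ) := mem_nhdsWithin_of_mem_nhds hA
    exact (Filter.nonempty_of_mem (inter_mem this self_mem_nhdsWithin)).imp fun x hx => ⟨hx.1, hx.2⟩
  let N := interior B
  have hNT : ∀ z ∈ N, (ε, z, (0 : C(Icc (-1 : ℝ) 2, V))) ∈ T :=
    fun z hz => hAB (mk_mem_prod hεA (interior_subset hz))
  let y : V → C(Icc (-1 : ℝ) 2, V) := fun z => (P.symm (ε, z, 0)).2.2
  -- the integral equation
  have hy : ∀ z ∈ N, ∀ t : Icc (-1 : ℝ) 2,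
      y z t = z + ε • primitiveFun (superposition f hf.continuous (y z)) t := by
    intro z hz t
    have h1 : H (P.symm (ε, z, 0)) = (ε, z, 0) := P.right_inv (hNT z hz).1
    have e1 : (P.symm (ε, z, 0)).1 = ε := congrArg Prod.fst h1
    have e2 : (P.symm (ε, z, 0)).2.1 = z := congrArg (fun q => q.2.1) h1
    have e3 : y z - constCLM (P.symm (ε, z, 0)).2.1 - (P.symm (ε, z, 0)).1 •
      primitiveCLM (superposition f hf.continuous (y z)) = 0 := congrArg (fun q => q.2.2) h1
    rw [e1, e2, sub_sub, sub_eq_zero] at e3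
    exact DFunLike.congr_fun e3 t
  have hIoo : ∀ t ∈ Ioo (-1 : ℝ) 2, t ∈ Icc (-1 : ℝ) 2 := fun t ht => Ioo_subset_Icc_self ht
  refine ⟨ε, hε, N, isOpen_interior, mem_interior_iff_mem_nhds.2 hB,
    fun z t => z + ε • primitiveFun (superposition f hf.continuous (y z)) t, ?_, ?_, ?_, ?_⟩
  · intro z _
    simp [primitiveFun]
  · intro z hz t ht
    have h1 := hy z hz ⟨t, hIoo t ht⟩
    change z + ε • primitiveFun (superposition f hf.continuous (y z)) t ∈ Ω
    rw [← h1]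
    apply hrΩ
    exact (ContinuousMap.dist_apply_le_dist (g := constCLM z₀) _).trans_lt (hNT z hz).2.2
  · intro z hz t ht
    have h1 := ((hasDerivAt_primitiveFun (superposition f hf.continuous (y z)) t).const_smul
      ε).const_add z
    rw [projIcc_of_mem _ (hIoo t ht)] at h1
    have h2 : superposition f hf.continuous (y z) ⟨t, hIoo t ht⟩ = f (y z ⟨t, hIoo t ht⟩) := rfl
    rw [h2, hy z hz ⟨t, hIoo t ht⟩] at h1
    exact h1
  · have h1 : ContDiffOn ℝ ∞ y N := by
      intro z hz
      obtain ⟨e', he'⟩ := (hNT z hz).2.1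
      have hs : ContDiffAt ℝ ∞ P.symm (ε, z, 0) := by
        refine P.contDiffAt_symm (hNT z hz).1 (f₀' := e') ?_ hH.contDiffAt
        rw [he']
        exact (hH.differentiable (by simp) _).hasFDerivAt
      have : ContDiffAt ℝ ∞ (fun z => P.symm (ε, z, 0)) z :=
        hs.comp z (f := fun z : V => (ε, z, (0 : C(Icc (-1 : ℝ) 2, V)))) (by fun_prop)
      exact (this.snd.snd).contDiffWithinAt
    have h1t : (1 : ℝ) ∈ Icc (-1 : ℝ) 2 := by norm_num
    have h2 : ContDiffOn ℝ ∞ (fun z => y z ⟨1, h1t⟩) N :=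
      (ContinuousMap.evalCLM (M := V) ℝ (⟨1, h1t⟩ : Icc (-1 : ℝ) 2)).contDiff.comp_contDiffOn h1
    exact h2.congr fun z hz => (hy z hz ⟨1, h1t⟩).symm

end Flow

/-! ### The geodesic equation in a vector space -/

section CoordGeodesic

variable {W : Type*} [NormedAddCommGroup W] [NormedSpace ℝ W]

/-- The geodesic spray `(w, v) ↦ (v, -Γ_w(v, v))`. -/
def spray (Γ : W → W →L[ℝ] W →L[ℝ] W) (p : W × W) : W × W := (p.2, -Γ p.1 p.2 p.2)

lemma contDiffAt_spray {n : WithTop ℕ∞} {Γ : W → W →L[ℝ] W →L[ℝ] W} {p : W × W}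
    (hΓ : ContDiffAt ℝ n Γ p.1) : ContDiffAt ℝ n (spray Γ) p := by
  have h1 : ContDiffAt ℝ n (fun p : W × W => Γ p.1) p := hΓ.comp p contDiffAt_fst
  have h2 : ContDiffAt ℝ n (fun p : W × W => Γ p.1 p.2 p.2) p :=
    (h1.clm_apply contDiffAt_snd).clm_apply contDiffAt_snd
  exact contDiffAt_snd.prodMk h2.neg

/-- Uniqueness of solutions of `c'' = -Γ_c(c', c')`. -/
lemma coordGeodesic_unique {Γ : W → W →L[ℝ] W →L[ℝ] W} {c₁ c₂ v₁ v₂ : ℝ → W} {t₀ : ℝ}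
    (hΓ : ContDiffAt ℝ 1 Γ (c₁ t₀))
    (h₁ : ∀ᶠ t in 𝓝 t₀, HasDerivAt c₁ (v₁ t) t ∧ HasDerivAt v₁ (-Γ (c₁ t) (v₁ t) (v₁ t)) t)
    (h₂ : ∀ᶠ t in 𝓝 t₀, HasDerivAt c₂ (v₂ t) t ∧ HasDerivAt v₂ (-Γ (c₂ t) (v₂ t) (v₂ t)) t)
    (hc : c₁ t₀ = c₂ t₀) (hv : v₁ t₀ = v₂ t₀) : c₁ =ᶠ[𝓝 t₀] c₂ := by
  obtain ⟨K, s, hs, hK⟩ :=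
    (contDiffAt_spray (p := (c₁ t₀, v₁ t₀)) hΓ).exists_lipschitzOnWith
  have key : ∀ {c v : ℝ → W}, (∀ᶠ t in 𝓝 t₀, HasDerivAt c (v t) t ∧
      HasDerivAt v (-Γ (c t) (v t) (v t)) t) → c₁ t₀ = c t₀ → v₁ t₀ = v t₀ →
      ∀ᶠ t in 𝓝 t₀, HasDerivAt (fun t => (c t, v t)) (spray Γ (c t, v t)) t ∧ (c t, v t) ∈ s := by
    intro c v h e1 e2
    have hcont : ContinuousAt (fun t => (c t, v t)) t₀ :=
      (h.self_of_nhds.1.continuousAt).prodMk h.self_of_nhds.2.continuousAt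
    have : s ∈ 𝓝 (c t₀, v t₀) := by rwa [← e1, ← e2]
    filter_upwards [h, hcont this] with t ht hts
    exact ⟨ht.1.prodMk ht.2, hts⟩
  have := ODE_solution_unique_of_eventually (v := fun _ => spray Γ) (s := fun _ => s) (K := K)
    (Eventually.of_forall fun _ => hK) (key h₁ rfl rfl) (key h₂ hc hv) (Prod.ext hc hv)
  exact this.mono fun t ht => congrArg Prod.fst ht

/-- Solutions of `c'' = -Γ_c(c', c')` with small initial velocity exist on `(-1, 2)`, and their
values at time `1` depend smoothly on the initial data. -/
theorem exists_smooth_coordGeodesic [FiniteDimensional ℝ W] {Γ : W → W →L[ℝ] W →L[ℝ] W}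
    {Ω : Set W} (hΩ : IsOpen Ω) (hΓ : ContDiffOn ℝ ∞ Γ Ω) {w₀ : W} (hw₀ : w₀ ∈ Ω) :
    ∃ N : Set (W × W), IsOpen N ∧ (w₀, 0) ∈ N ∧ ∃ c v : W × W → ℝ → W,
      (∀ p ∈ N, c p 0 = p.1 ∧ v p 0 = p.2) ∧
      (∀ p ∈ N, ∀ t ∈ Ioo (-1 : ℝ) 2, c p t ∈ Ω ∧ HasDerivAt (c p) (v p t) t ∧
        HasDerivAt (v p) (-Γ (c p t) (v p t) (v p t)) t) ∧
      ContDiffOn ℝ ∞ (fun p => c p 1) N := by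
  have : CompleteSpace W := FiniteDimensional.complete ℝ W
  obtain ⟨r, hr, hrΩ⟩ := Metric.isOpen_iff.1 hΩ w₀ hw₀
  -- cut off the Christoffel symbols outside of `Ω`
  let χ : ContDiffBump w₀ := ⟨r / 4, r / 2, by positivity, by linarith⟩
  have hχΩ : tsupport χ ⊆ Ω := by
    rw [χ.tsupport_eq]
    exact (Metric.closedBall_subset_ball (by change r / 2 < r; linarith)).trans hrΩ
  have hG : ContDiff ℝ ∞ fun w => χ w • Γ w := by
    rw [contDiff_iff_contDiffAt]
    intro w
    by_cases hw : w ∈ tsupport χ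
    · exact χ.contDiffAt.smul (hΓ.contDiffAt (hΩ.mem_nhds (hχΩ hw)))
    · refine (contDiffAt_const (c := 0)).congr_of_eventuallyEq ?_
      filter_upwards [(isClosed_tsupport χ).isOpen_compl.mem_nhds hw] with x hx
      rw [image_eq_zero_of_notMem_tsupport hx]
      exact zero_smul ℝ (Γ x)
  have hf : ContDiff ℝ ∞ (spray fun w => χ w • Γ w) :=
    contDiff_iff_contDiffAt.2 fun p => contDiffAt_spray hG.contDiffAt
  have hΩ' : Metric.ball w₀ (r / 4) ×ˢ (univ : Set W) ∈ 𝓝 (w₀, (0 : W)) :=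
    prod_mem_nhds (Metric.ball_mem_nhds _ (by positivity)) univ_mem
  obtain ⟨ε, hε, N, hN, hN0, Y, hY0, hYΩ, hY', hYs⟩ := exists_smooth_flow _ hf _ hΩ'
  -- undo the slowing down
  let q : W × W → W × W := fun p => (p.1, ε⁻¹ • p.2)
  have hq : ContDiff ℝ ∞ q := by fun_prop
  refine ⟨q ⁻¹' N, hN.preimage hq.continuous, by simpa [q] using hN0, fun p t => (Y (q p) t).1,
    fun p t => ε • (Y (q p) t).2, ?_, ?_, ?_⟩
  · intro p hp
    refine ⟨(congrArg Prod.fst (hY0 _ hp) : (Y (q p) 0).1 = (q p).1), ?_⟩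
    change ε • (Y (q p) 0).2 = p.2
    rw [hY0 _ hp]
    exact smul_inv_smul₀ hε.ne' _
  · intro p hp t ht
    have h1 := hY' _ hp t ht
    have hb := (hYΩ _ hp t ht).1
    have hχ1 : χ (Y (q p) t).1 = 1 := χ.one_of_mem_closedBall (Metric.ball_subset_closedBall hb)
    refine ⟨hrΩ (Metric.ball_subset_ball (by linarith) hb), h1.fst, ?_⟩
    have h2 : HasDerivAt (fun t => ε • (Y (q p) t).2)
      (ε • (ε • spray (fun w => χ w • Γ w) (Y (q p) t)).2) t :=
      ((ContinuousLinearMap.snd ℝ W W).hasFDerivAt.comp_hasDerivAt t h1).const_smul ε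
    have h3 : ε • (ε • spray (fun w => χ w • Γ w) (Y (q p) t)).2 =
        -Γ (Y (q p) t).1 (ε • (Y (q p) t).2) (ε • (Y (q p) t).2) := by
      simp [spray, hχ1]
    rw [h3] at h2
    exact h2
  · exact contDiff_fst.comp_contDiffOn (hYs.comp hq.contDiffOn fun p hp => hp)

end CoordGeodesic

/-! ### Linearization of fields of endomorphisms along a linear subspace -/

section Linearization

variable {A B : Type*} [NormedAddCommGroup A] [NormedSpace ℝ A] [NormedAddCommGroup B]
  [NormedSpace ℝ B]

/-- The projection of `A × B` onto the first factor, as an endomorphism. -/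
def projFst : A × B →L[ℝ] A × B :=
  (ContinuousLinearMap.inl ℝ A B).comp (ContinuousLinearMap.fst ℝ A B)

/-- The projection of `A × B` onto the second factor, as an endomorphism. -/
def projSnd : A × B →L[ℝ] A × B :=
  (ContinuousLinearMap.inr ℝ A B).comp (ContinuousLinearMap.snd ℝ A B)

lemma projFst_apply (v : A × B) : projFst v = (v.1, 0) := rfl

lemma projSnd_apply (v : A × B) : projSnd v = (0, v.2) := rfl

/-- The map `T ↦ P T Q`. -/
def sandwich {X : Type*} [NormedAddCommGroup X] [NormedSpace ℝ X] (P Q : X →L[ℝ] X) :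
    (X →L[ℝ] X) →L[ℝ] (X →L[ℝ] X) :=
  (ContinuousLinearMap.compL ℝ X X X P).comp ((ContinuousLinearMap.compL ℝ X X X).flip Q)

lemma sandwich_apply {X : Type*} [NormedAddCommGroup X] [NormedSpace ℝ X] (P Q T : X →L[ℝ] X)
    (v : X) : sandwich P Q T v = P (T (Q v)) := rfl

/-- The linearization along `A × 0` of a field of endomorphisms of `A × B` that preserves `A × 0`:
the blocks `A → A` and `B → B` are frozen along `A × 0`, and the block `A → B`, which vanishes
along `A × 0`, is replaced by its derivative in the directions of `B`. -/
def linearization (𝒥 : A × B → A × B →L[ℝ] A × B) (w : A × B) : A × B →L[ℝ] A × B :=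
  sandwich projFst projFst (𝒥 (w.1, 0)) +
    sandwich projSnd projFst (fderiv ℝ 𝒥 (w.1, 0) (0, w.2)) +
    sandwich projSnd projSnd (𝒥 (w.1, 0))

lemma linearization_apply (𝒥 : A × B → A × B →L[ℝ] A × B) (w v : A × B) :
    linearization 𝒥 w v = ((𝒥 (w.1, 0) (v.1, 0)).1,
      (fderiv ℝ 𝒥 (w.1, 0) (0, w.2) (v.1, 0)).2 + (𝒥 (w.1, 0) (0, v.2)).2) := by
  change projFst (𝒥 (w.1, 0) (projFst v)) +
    projSnd (fderiv ℝ 𝒥 (w.1, 0) (0, w.2) (projFst v)) +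
    projSnd (𝒥 (w.1, 0) (projSnd v)) = _
  simp [projFst_apply, projSnd_apply]

/-- The dilatation `(u, n) ↦ (u, t n)`. -/
def scaleSnd (t : ℝ) : A × B →L[ℝ] A × B := projFst + t • projSnd

lemma scaleSnd_apply (t : ℝ) (v : A × B) : scaleSnd t v = (v.1, t • v.2) := by
  simp [scaleSnd, projFst_apply, projSnd_apply]

lemma apply_split (T : A × B →L[ℝ] A × B) (v : A × B) : T v = T (v.1, 0) + T (0, v.2) := by
  rw [← map_add]; simp

/-- The dilated fields of endomorphisms converge to the linearization. -/
lemma tendsto_dilated_linearization {G : A × B → A × B →L[ℝ] A × B} {w : A × B}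
    (hG : ContDiffAt ℝ 1 G (w.1, 0)) (h0 : ∀ x : A, (G (w.1, 0) (x, 0)).2 = 0) :
    Tendsto (fun t : ℝ => (scaleSnd t⁻¹).comp ((G (scaleSnd t w)).comp (scaleSnd t)))
      (𝓝[≠] 0) (𝓝 (linearization G w)) := by
  -- the block decomposition: the block `A → B` is divided by `t`, the block `B → A` is multiplied
  -- by `t`, and the diagonal blocks are unchanged
  have hdec : ∀ᶠ t : ℝ in 𝓝[≠] 0,
      sandwich projFst projFst (G (scaleSnd t w)) + t • sandwich projFst projSnd (G (scaleSnd t w))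
        + t⁻¹ • sandwich projSnd projFst (G (scaleSnd t w)) +
        sandwich projSnd projSnd (G (scaleSnd t w)) =
      (scaleSnd t⁻¹).comp ((G (scaleSnd t w)).comp (scaleSnd t)) := by
    filter_upwards [self_mem_nhdsWithin] with t ht
    have ht : t ≠ 0 := ht
    refine ContinuousLinearMap.ext fun v => ?_
    change projFst (G (scaleSnd t w) (projFst v)) + t • projFst (G (scaleSnd t w) (projSnd v))
        + t⁻¹ • projSnd (G (scaleSnd t w) (projFst v)) + projSnd (G (scaleSnd t w) (projSnd v)) =
      scaleSnd t⁻¹ (G (scaleSnd t w) (scaleSnd t v))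
    have h1 : scaleSnd t v = projFst v + t • projSnd v := rfl
    rw [h1, map_add, map_smul]
    refine Prod.ext ?_ ?_
    · simp [projFst_apply, projSnd_apply, scaleSnd_apply]
    · simp [projFst_apply, projSnd_apply, scaleSnd_apply, smul_smul, inv_mul_cancel₀ ht]
  refine Tendsto.congr' hdec ?_
  -- the curve `t ↦ G (w.1, t w.2)` at `t = 0`
  have hline : HasDerivAt (fun t : ℝ => (scaleSnd t w : A × B)) (0, w.2) 0 := by
    have h1 : HasDerivAt (fun t : ℝ => (w.1, t • w.2)) ((0 : A), (1 : ℝ) • w.2) 0 :=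
      (hasDerivAt_const (0 : ℝ) w.1).prodMk ((hasDerivAt_id (0 : ℝ)).smul_const w.2)
    rw [one_smul] at h1
    exact h1.congr_of_eventuallyEq (Eventually.of_forall fun t => scaleSnd_apply t w)
  have hw0 : scaleSnd 0 w = (w.1, 0) := by rw [scaleSnd_apply, zero_smul]
  have hd : HasDerivAt (fun t : ℝ => G (scaleSnd t w)) (fderiv ℝ G (w.1, 0) (0, w.2)) 0 := by
    have h1 : HasFDerivAt G (fderiv ℝ G (w.1, 0)) (scaleSnd 0 w) := by
      rw [hw0]; exact (hG.differentiableAt (by simp)).hasFDerivAt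
    exact h1.comp_hasDerivAt (0 : ℝ) hline
  have hc : Tendsto (fun t : ℝ => G (scaleSnd t w)) (𝓝[≠] 0) (𝓝 (G (w.1, 0))) := by
    have := hd.continuousAt.tendsto
    rw [hw0] at this
    exact this.mono_left nhdsWithin_le_nhds
  have hs : ∀ P Q : A × B →L[ℝ] A × B, Tendsto (fun t : ℝ => sandwich P Q (G (scaleSnd t w)))
      (𝓝[≠] 0) (𝓝 (sandwich P Q (G (w.1, 0)))) := fun P Q =>
    ((sandwich P Q).continuous.tendsto _).comp hc
  have h12 : Tendsto (fun t : ℝ => t • sandwich projFst projSnd (G (scaleSnd t w)))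
      (𝓝[≠] 0) (𝓝 0) := by
    have := (tendsto_id.mono_left nhdsWithin_le_nhds : Tendsto id (𝓝[≠] (0 : ℝ)) (𝓝 0)).smul
      (hs projFst projSnd)
    rwa [zero_smul] at this
  -- the block `A → B` vanishes at `t = 0`, so that dividing it by `t` gives a difference quotient
  have h21 : Tendsto (fun t : ℝ => t⁻¹ • sandwich projSnd projFst (G (scaleSnd t w)))
      (𝓝[≠] 0) (𝓝 (sandwich projSnd projFst (fderiv ℝ G (w.1, 0) (0, w.2)))) := by
    have h1 : HasDerivAt (fun t : ℝ => sandwich projSnd projFst (G (scaleSnd t w)))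
        (sandwich projSnd projFst (fderiv ℝ G (w.1, 0) (0, w.2))) 0 :=
      ((sandwich (projSnd (A := A) (B := B)) projFst).hasFDerivAt
        (x := G (scaleSnd 0 w))).comp_hasDerivAt (0 : ℝ) hd
    have h2 : sandwich projSnd projFst (G (w.1, 0)) = 0 := by
      refine ContinuousLinearMap.ext fun v => ?_
      rw [sandwich_apply, projSnd_apply, projFst_apply, h0]
      rfl
    have h3 := hasDerivAt_iff_tendsto_slope_zero.1 h1
    simpa [hw0, h2] using h3
  have := (((hs projFst projFst).add h12).add h21).add (hs projSnd projSnd)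
  rw [add_zero] at this
  exact this

/-- If `𝒥` preserves `A × 0` along `A × 0`, so do its derivatives along `A × 0`. -/
lemma fderiv_block_eq_zero {𝒥 : A × B → A × B →L[ℝ] A × B} {u : A}
    (h𝒥 : DifferentiableAt ℝ 𝒥 (u, 0))
    (h0 : ∀ᶠ u' in 𝓝 u, ∀ x : A, (𝒥 (u', 0) (x, 0)).2 = 0) (y x : A) :
    (fderiv ℝ 𝒥 (u, 0) (y, 0) (x, 0)).2 = 0 := by
  let ℓ : (A × B →L[ℝ] A × B) →L[ℝ] B :=
    (ContinuousLinearMap.snd ℝ A B).comp (ContinuousLinearMap.apply ℝ (A × B) ((x, 0) : A × B))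
  have h1 : HasFDerivAt (fun u' : A => ℓ (𝒥 (u', 0)))
      (ℓ.comp ((fderiv ℝ 𝒥 (u, 0)).comp (ContinuousLinearMap.inl ℝ A B))) u :=
    ℓ.hasFDerivAt.comp u (h𝒥.hasFDerivAt.comp u (ContinuousLinearMap.inl ℝ A B).hasFDerivAt)
  have h2 : (fun u' : A => ℓ (𝒥 (u', 0))) =ᶠ[𝓝 u] fun _ => 0 := h0.mono fun u' h => h x
  have h3 := h1.unique ((hasFDerivAt_const (0 : B) u).congr_of_eventuallyEq h2)
  exact DFunLike.congr_fun h3 y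

/-- The linearization does not change under a diffeomorphism that is the identity on `A × 0` and
induces the identity on the normal spaces of `A × 0`. This is why the limit of the dilated
structures depends neither on the complement nor on the connection. -/
lemma linearization_conj {Φ : A × B → A × B} {𝒥 G : A × B → A × B →L[ℝ] A × B} {w : A × B}
    (hΦ : ContDiffAt ℝ ∞ Φ (w.1, 0)) (h𝒥 : DifferentiableAt ℝ 𝒥 (w.1, 0))
    (hG : DifferentiableAt ℝ G (w.1, 0))
    (hΦ0 : ∀ᶠ u in 𝓝 w.1, Φ (u, 0) = (u, 0))
    (hΦn : ∀ᶠ u in 𝓝 w.1, ∀ n : B, (fderiv ℝ Φ (u, 0) (0, n)).2 = n)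
    (h0 : ∀ᶠ u in 𝓝 w.1, ∀ x : A, (𝒥 (u, 0) (x, 0)).2 = 0)
    (hconj : ∀ᶠ z in 𝓝 (w.1, (0 : B)),
      (fderiv ℝ Φ z).comp (G z) = (𝒥 (Φ z)).comp (fderiv ℝ Φ z))
    (hinj : Function.Injective (fderiv ℝ Φ (w.1, 0))) :
    (∀ x : A, (G (w.1, 0) (x, 0)).2 = 0) ∧ linearization G w = linearization 𝒥 w := by
  obtain ⟨u, n⟩ := w
  set p : A × B := (u, 0) with hp
  change ContDiffAt ℝ ∞ Φ p at hΦ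
  have hA : ContDiffAt ℝ ∞ (fderiv ℝ Φ) p := hΦ.fderiv_right (by simp)
  have hA' := (hA.differentiableAt (by simp)).hasFDerivAt
  set D := fderiv ℝ Φ p with hD
  set D2 := fderiv ℝ (fderiv ℝ Φ) p with hD2
  have hpΦ : Φ p = p := hΦ0.self_of_nhds
  have hinl := (ContinuousLinearMap.inl ℝ A B).hasFDerivAt (x := u)
  -- the first derivative of `Φ`
  have hDx : ∀ y : A, D (y, 0) = (y, 0) := by
    have h1 : HasFDerivAt (fun u : A => Φ (u, 0)) (D.comp (ContinuousLinearMap.inl ℝ A B)) u :=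
      ((hΦ.differentiableAt (by simp)).hasFDerivAt (x := p)).comp u hinl
    have h2 := h1.unique (hinl.congr_of_eventuallyEq hΦ0)
    exact fun y => DFunLike.congr_fun h2 y
  have hD_snd : ∀ v : A × B, (D v).2 = v.2 := fun v => by
    rw [apply_split D v, hDx]
    have : (D (0, v.2)).2 = v.2 := hΦn.self_of_nhds v.2
    simp [this]
  -- the mixed second derivatives of the second component of `Φ`
  have hsymm : IsSymmSndFDerivAt ℝ Φ p := hΦ.isSymmSndFDerivAt
    (by rw [minSmoothness_of_isRCLikeNormedField]; exact WithTop.coe_le_coe.2 le_top)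
  have hD2n : ∀ (m : B) (y : A), (D2 (0, m) (y, 0)).2 = 0 := by
    intro m y
    rw [hsymm.eq]
    let ℓ : (A × B →L[ℝ] A × B) →L[ℝ] B :=
      (ContinuousLinearMap.snd ℝ A B).comp (ContinuousLinearMap.apply ℝ (A × B) ((0, m) : A × B))
    have h1 : HasFDerivAt (fun u' : A => ℓ (fderiv ℝ Φ (u', 0)))
        (ℓ.comp (D2.comp (ContinuousLinearMap.inl ℝ A B))) u :=
      ℓ.hasFDerivAt.comp u (hA'.comp u hinl)
    have h2 : (fun u' : A => ℓ (fderiv ℝ Φ (u', 0))) =ᶠ[𝓝 u] fun _ => m :=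
      hΦn.mono fun u' h => h m
    exact DFunLike.congr_fun (h1.unique ((hasFDerivAt_const m u).congr_of_eventuallyEq h2)) y
  have h00 : ∀ x : A, (𝒥 p (x, 0)).2 = 0 := h0.self_of_nhds
  have hc0 : D.comp (G p) = (𝒥 p).comp D := by
    have := hconj.self_of_nhds
    rwa [hpΦ] at this
  -- the first column of `G` and the block `B → B` at the point `p`
  have hGx : ∀ x : A, G p (x, 0) = ((𝒥 p (x, 0)).1, 0) := by
    intro x
    apply hinj
    rw [hDx]
    have := DFunLike.congr_fun hc0 (x, 0)
    refine this.trans ?_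
    change 𝒥 p (D (x, 0)) = _
    rw [hDx]
    exact Prod.ext rfl (h00 x)
  have hGn : ∀ m : B, (G p (0, m)).2 = (𝒥 p (0, m)).2 := by
    intro m
    have h1 := DFunLike.congr_fun hc0 (0, m)
    have h2 : D (G p (0, m)) = 𝒥 p (D (0, m)) := h1
    rw [← hD_snd, h2, apply_split (𝒥 p)]
    have : (D (0, m)).2 = m := hD_snd _
    simp [this, h00]
  refine ⟨fun x => by rw [hGx], ?_⟩
  refine ContinuousLinearMap.ext fun v => ?_
  rw [linearization_apply, linearization_apply]
  refine Prod.ext ?_ ?_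
  · change (G p (v.1, 0)).1 = (𝒥 p (v.1, 0)).1
    rw [hGx]
  · change (fderiv ℝ G p (0, n) (v.1, 0)).2 + (G p (0, v.2)).2 =
      (fderiv ℝ 𝒥 p (0, n) (v.1, 0)).2 + (𝒥 p (0, v.2)).2
    rw [hGn]
    congr 1
    -- the derivative of `DΦ ∘ G = (𝒥 ∘ Φ) ∘ DΦ` in the direction `(0, n)`, evaluated at `(v.1, 0)`;
    -- in its `B`-component the second derivatives of `Φ` drop out
    have hJ' : HasFDerivAt 𝒥 (fderiv ℝ 𝒥 p) (Φ p) := by rw [hpΦ]; exact h𝒥.hasFDerivAt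
    have e1 := hA'.clm_comp hG.hasFDerivAt
    have e2 := (hJ'.comp p (hΦ.differentiableAt (by simp)).hasFDerivAt).clm_comp hA'
    have e3 := e1.unique (e2.congr_of_eventuallyEq hconj)
    have e4 := DFunLike.congr_fun (DFunLike.congr_fun e3 (0, n)) (v.1, 0)
    have e5 : D (fderiv ℝ G p (0, n) (v.1, 0)) + D2 (0, n) (G p (v.1, 0)) =
        𝒥 (Φ p) (D2 (0, n) (v.1, 0)) + fderiv ℝ 𝒥 p (D (0, n)) (D (v.1, 0)) := e4
    have e6 := congrArg Prod.snd e5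
    rw [Prod.snd_add, Prod.snd_add, hD_snd, hGx, hD2n, hpΦ, hDx, add_zero,
      apply_split (𝒥 p), hD2n] at e6
    rw [e6]
    -- `D (0, n)` differs from `(0, n)` by a vector of `A × 0`, along which the block `A → B` of `𝒥`
    -- has derivative zero
    have e7 : D (0, n) = ((D (0, n)).1, 0) + (0, n) := by
      refine Prod.ext (by simp) ?_
      rw [hD_snd]; simp
    have e8 : ((0 : A), (0 : B)) = 0 := rfl
    rw [e7, map_add, _root_.add_apply, Prod.snd_add, Prod.snd_add,
      fderiv_block_eq_zero h𝒥 h0, h00, e8, map_zero]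
    simp

end Linearization

/-! ### Tensor fields in local parametrizations -/

section Param

variable {V H X V' H' X' : Type*}
  [NormedAddCommGroup V] [NormedSpace ℝ V] [TopologicalSpace H]
  {I : ModelWithCorners ℝ V H} [TopologicalSpace X] [ChartedSpace H X]
  [NormedAddCommGroup V'] [NormedSpace ℝ V'] [TopologicalSpace H']
  {I' : ModelWithCorners ℝ V' H'} [TopologicalSpace X'] [ChartedSpace H' X']

namespace PartialDiffeomorph

variable (θ : PartialDiffeomorph I' I X' X ∞)

lemma left_inv_apply {x : X'} (hx : x ∈ θ.source) : θ.symm (θ x) = x :=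
  θ.toPartialEquiv.left_inv hx

lemma right_inv_apply {y : X} (hy : y ∈ θ.target) : θ (θ.symm y) = y :=
  θ.toPartialEquiv.right_inv hy

lemma map_source_apply {x : X'} (hx : x ∈ θ.source) : θ x ∈ θ.target :=
  θ.toPartialEquiv.map_source hx

lemma map_target_apply {y : X} (hy : y ∈ θ.target) : θ.symm y ∈ θ.source :=
  θ.toPartialEquiv.map_target hy

lemma contMDiffAt_apply {x : X'} (hx : x ∈ θ.source) : ContMDiffAt I' I ∞ θ x :=
  (θ.contMDiffOn x hx).contMDiffAt (θ.open_source.mem_nhds hx)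

lemma contMDiffAt_symm_apply {y : X} (hy : y ∈ θ.target) : ContMDiffAt I I' ∞ θ.symm y :=
  θ.symm.contMDiffAt_apply hy

lemma mfderiv_symm_comp {x : X'} (hx : x ∈ θ.source) :
    ((mfderiv I I' θ.symm (θ x)).comp (mfderiv I' I θ x) : V' →L[ℝ] V') =
      ContinuousLinearMap.id ℝ V' := by
  have h := mfderiv_comp x ((θ.contMDiffAt_symm_apply (θ.map_source_apply hx)).mdifferentiableAt
    (by simp)) ((θ.contMDiffAt_apply hx).mdifferentiableAt (by simp))
  have h2 : θ.symm ∘ θ =ᶠ[𝓝 x] id := by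
    filter_upwards [θ.open_source.mem_nhds hx] with z hz using θ.left_inv_apply hz
  rw [h2.mfderiv_eq, mfderiv_id] at h
  exact h.symm

lemma mfderiv_comp_symm {x : X'} (hx : x ∈ θ.source) :
    ((mfderiv I' I θ x).comp (mfderiv I I' θ.symm (θ x)) : V →L[ℝ] V) =
      ContinuousLinearMap.id ℝ V := by
  have h1 : (mfderiv I' I θ (θ.symm (θ x)) : V' →L[ℝ] V) = mfderiv I' I θ x := by
    rw [θ.left_inv_apply hx]
  rw [← h1]
  exact θ.symm.mfderiv_symm_comp (θ.map_source_apply hx)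

/-- The differential of a partial diffeomorphism at a point of its domain. -/
def tangentEquiv {x : X'} (hx : x ∈ θ.source) : TangentSpace I' x ≃L[ℝ] TangentSpace I (θ x) :=
  ContinuousLinearEquiv.equivOfInverse' (mfderiv I' I θ x)
    (mfderiv I I' θ.symm (θ x) : V →L[ℝ] V') (θ.mfderiv_comp_symm hx) (θ.mfderiv_symm_comp hx)

lemma coe_tangentEquiv {x : X'} (hx : x ∈ θ.source) :
    (θ.tangentEquiv hx : TangentSpace I' x →L[ℝ] TangentSpace I (θ x)) = mfderiv I' I θ x := rfl

lemma isInvertible_mfderiv {x : X'} (hx : x ∈ θ.source) : (mfderiv I' I θ x).IsInvertible :=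
  ⟨θ.tangentEquiv hx, rfl⟩

lemma inverse_mfderiv {x : X'} (hx : x ∈ θ.source) :
    (mfderiv I' I θ x).inverse = (mfderiv I I' θ.symm (θ x) : V →L[ℝ] V') := by
  rw [← θ.coe_tangentEquiv hx, ContinuousLinearMap.inverse_equiv]
  rfl

lemma inverse_mfderiv_apply {x : X'} (hx : x ∈ θ.source) (v : TangentSpace I' x) :
    (mfderiv I' I θ x).inverse (mfderiv I' I θ x v) = v :=
  (θ.isInvertible_mfderiv hx).inverse_apply_self v

lemma mfderiv_inverse_apply {x : X'} (hx : x ∈ θ.source) (v : TangentSpace I (θ x)) :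
    mfderiv I' I θ x ((mfderiv I' I θ x).inverse v) = v :=
  (θ.isInvertible_mfderiv hx).self_apply_inverse v

end PartialDiffeomorph

end Param

/-! ### Vector fields and fields of endomorphisms in coordinates -/

section LocalNijenhuis

variable {W : Type*} [NormedAddCommGroup W] [NormedSpace ℝ W]

/-- The Nijenhuis tensor at `w` of a field `𝒥` of endomorphisms of a vector space, as an
expression in the first derivative of `𝒥`. -/
def localNijenhuis (𝒥 : W → W →L[ℝ] W) (w x y : W) : W :=
  fderiv ℝ 𝒥 w (𝒥 w x) y - fderiv ℝ 𝒥 w (𝒥 w y) x - 𝒥 w (fderiv ℝ 𝒥 w x y)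
    + 𝒥 w (fderiv ℝ 𝒥 w y x)

lemma fderiv_clm_apply_apply {𝒥 : W → W →L[ℝ] W} {Y : W → W} {w : W}
    (h𝒥 : DifferentiableAt ℝ 𝒥 w) (hY : DifferentiableAt ℝ Y w) (v : W) :
    fderiv ℝ (fun z => 𝒥 z (Y z)) w v = fderiv ℝ 𝒥 w v (Y w) + 𝒥 w (fderiv ℝ Y w v) := by
  have h := h𝒥.hasFDerivAt.clm_apply hY.hasFDerivAt
  rw [h.fderiv]
  change 𝒥 w (fderiv ℝ Y w v) + fderiv ℝ 𝒥 w v (Y w) = _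
  rw [add_comm]

/-- The Nijenhuis expression of two vector fields depends only on their values at the point. -/
lemma lieBracket_nijenhuis {𝒥 : W → W →L[ℝ] W} {Y Z : W → W} {w : W}
    (h𝒥 : DifferentiableAt ℝ 𝒥 w) (hY : DifferentiableAt ℝ Y w) (hZ : DifferentiableAt ℝ Z w)
    (hsq : ∀ v, 𝒥 w (𝒥 w v) = -v) :
    VectorField.lieBracket ℝ (fun z => 𝒥 z (Y z)) (fun z => 𝒥 z (Z z)) w
      - 𝒥 w (VectorField.lieBracket ℝ (fun z => 𝒥 z (Y z)) Z w)
      - 𝒥 w (VectorField.lieBracket ℝ Y (fun z => 𝒥 z (Z z)) w)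
      - VectorField.lieBracket ℝ Y Z w = localNijenhuis 𝒥 w (Y w) (Z w) := by
  simp only [VectorField.lieBracket, fderiv_clm_apply_apply h𝒥 hY, fderiv_clm_apply_apply h𝒥 hZ,
    map_sub, map_add, hsq, localNijenhuis]
  abel

end LocalNijenhuis

section ClmApply

variable {A B : Type*} [NormedAddCommGroup A] [NormedSpace ℝ A] [FiniteDimensional ℝ A]
  [NormedAddCommGroup B] [NormedSpace ℝ B]

/-- On a finite-dimensional space, smoothness of a family of linear maps can be tested on
vectors. -/
lemma contMDiffAt_of_clm_apply {V H X : Type*} [NormedAddCommGroup V] [NormedSpace ℝ V]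
    [TopologicalSpace H] {I : ModelWithCorners ℝ V H} [TopologicalSpace X] [ChartedSpace H X]
    {n : WithTop ℕ∞} {f : X → A →L[ℝ] B} {x : X}
    (h : ∀ a, ContMDiffAt I 𝓘(ℝ, B) n (fun y => f y a) x) :
    ContMDiffAt I 𝓘(ℝ, A →L[ℝ] B) n f x := by
  let d := Module.finrank ℝ A
  have hd : d = Module.finrank ℝ (Fin d → ℝ) := (Module.finrank_fin_fun ℝ).symm
  let e₁ : A ≃L[ℝ] (Fin d → ℝ) := ContinuousLinearEquiv.ofFinrankEq hd
  let e₂ : (A →L[ℝ] B) ≃L[ℝ] (Fin d → B) :=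
    (e₁.arrowCongr (1 : B ≃L[ℝ] B)).trans (ContinuousLinearEquiv.piRing (Fin d))
  have h1 : ContMDiffAt I 𝓘(ℝ, Fin d → B) n (fun y => e₂ (f y)) x :=
    contMDiffAt_pi_space.2 fun i => h _
  have h2 := (e₂.symm.contDiff.contMDiff (n := n)).contMDiffAt.comp x h1
  refine h2.congr_of_eventuallyEq (Eventually.of_forall fun y => ?_)
  exact (e₂.symm_apply_apply (f y)).symm

lemma contDiffAt_of_clm_apply {D : Type*} [NormedAddCommGroup D] [NormedSpace ℝ D]
    {n : WithTop ℕ∞} {f : D → A →L[ℝ] B} {x : D}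
    (h : ∀ a, ContDiffAt ℝ n (fun y => f y a) x) : ContDiffAt ℝ n f x :=
  contMDiffAt_iff_contDiffAt.1 (contMDiffAt_of_clm_apply fun a => (h a).contMDiffAt)

end ClmApply

section LocalTensor

variable {W V H X : Type*} [NormedAddCommGroup W] [NormedSpace ℝ W]
  [NormedAddCommGroup V] [NormedSpace ℝ V] [TopologicalSpace H]
  {I : ModelWithCorners ℝ V H} [TopologicalSpace X] [ChartedSpace H X]

namespace PartialDiffeomorph

variable (θ : PartialDiffeomorph 𝓘(ℝ, W) I W X ∞)

/-- The differential of a local parametrization `θ`, on the model vector space. -/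
def push (w : W) : W →L[ℝ] TangentSpace I (θ w) := mfderiv 𝓘(ℝ, W) I θ w

/-- The inverse of the differential of a local parametrization `θ`. -/
def pull (w : W) : TangentSpace I (θ w) →L[ℝ] W := (mfderiv 𝓘(ℝ, W) I θ w).inverse

/-- The components of a vector field in a local parametrization `θ`. -/
def localField (Y : ∀ x : X, TangentSpace I x) : W → W :=
  VectorField.mpullback 𝓘(ℝ, W) I θ Y

/-- The vector field with given components in a local parametrization. -/
def ofLocalField (Z : W → W) : ∀ x : X, TangentSpace I x :=
  VectorField.mpullback I 𝓘(ℝ, W) θ.symm Z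

/-- The components of a field of endomorphisms in a local parametrization. -/
def localEnd (J : ∀ x : X, TangentSpace I x →L[ℝ] TangentSpace I x) : W → W →L[ℝ] W :=
  pullbackEnd (I := 𝓘(ℝ, W)) (I' := I) θ J

variable {θ} {Y Z : ∀ x : X, TangentSpace I x}
  {J : ∀ x : X, TangentSpace I x →L[ℝ] TangentSpace I x} {w : W}

lemma push_pull (hw : w ∈ θ.source) (v : TangentSpace I (θ w)) : θ.push w (θ.pull w v) = v :=
  θ.mfderiv_inverse_apply hw v

lemma pull_push (hw : w ∈ θ.source) (v : W) : θ.pull w (θ.push w v) = v :=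
  θ.inverse_mfderiv_apply hw v

lemma push_injective (hw : w ∈ θ.source) : Function.Injective (θ.push w) :=
  (θ.tangentEquiv hw).injective

lemma localField_apply : θ.localField Y w = θ.pull w (Y (θ w)) := rfl

lemma push_localField (hw : w ∈ θ.source) :
    θ.push w (θ.localField Y w) = Y (θ w) :=
  θ.mfderiv_inverse_apply hw _

lemma push_localEnd (hw : w ∈ θ.source) (v : W) :
    θ.push w (θ.localEnd J w v) = J (θ w) (θ.push w v) :=
  θ.mfderiv_inverse_apply hw _

lemma localField_eq_iff (hw : w ∈ θ.source) (v : W) :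
    θ.localField Y w = v ↔ Y (θ w) = θ.push w v := by
  rw [← θ.push_localField (Y := Y) hw]
  exact (push_injective hw).eq_iff.symm

lemma localField_end (hw : w ∈ θ.source) :
    θ.localField (fun x => J x (Y x)) w = θ.localEnd J w (θ.localField Y w) := by
  rw [localField_eq_iff hw, push_localEnd hw, push_localField hw]

lemma localEnd_sq (hw : w ∈ θ.source) (hsq : ∀ v, J (θ w) (J (θ w) v) = -v) (v : W) :
    θ.localEnd J w (θ.localEnd J w v) = -v := by
  apply push_injective hw
  rw [push_localEnd hw, push_localEnd hw, hsq, map_neg]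

lemma ofLocalField_apply (hw : w ∈ θ.source) (Z : W → W) :
    θ.ofLocalField Z (θ w) = θ.push w (Z w) := by
  have h := θ.symm.inverse_mfderiv (θ.map_source_apply hw)
  change (mfderiv I 𝓘(ℝ, W) θ.symm (θ w)).inverse (Z (θ.symm (θ w))) = _
  have h2 : (mfderiv I 𝓘(ℝ, W) θ.symm (θ w)).inverse (Z (θ.symm (θ w))) =
    (mfderiv 𝓘(ℝ, W) I θ (θ.symm (θ w)) : W →L[ℝ] V) (Z (θ.symm (θ w))) :=
    DFunLike.congr_fun h _
  rw [h2, θ.left_inv_apply hw]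
  rfl

lemma localField_ofLocalField (hw : w ∈ θ.source) (Z : W → W) :
    θ.localField (θ.ofLocalField Z) w = Z w := by
  rw [localField_eq_iff hw, ofLocalField_apply hw]

lemma ofLocalField_localField {x : X} (hx : x ∈ θ.target) :
    θ.ofLocalField (θ.localField Y) x = Y x := by
  have h := ofLocalField_apply (θ.map_target_apply hx) (θ.localField Y)
  rw [push_localField (θ.map_target_apply hx)] at h
  rwa [θ.right_inv_apply hx] at h

section Smooth

variable [FiniteDimensional ℝ V] [FiniteDimensional ℝ W] [IsManifold I ∞ X]

lemma contDiffAt_localField [IsManifold I 1 X] (hw : w ∈ θ.source) (hY : SmoothFieldAt I Y (θ w)) :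
    ContDiffAt ℝ ∞ (θ.localField Y) w := by
  refine contMDiffAt_vectorSpace_iff_contDiffAt (V := θ.localField Y).1 ?_
  exact ContMDiffAt.mpullback_vectorField_preimage hY (θ.contMDiffAt_apply hw)
    (θ.isInvertible_mfderiv hw) le_rfl

lemma smoothFieldAt_ofLocalField [IsManifold I 1 X] (hw : w ∈ θ.source) {Z : W → W}
    (hZ : ContDiffAt ℝ ∞ Z w) :
    SmoothFieldAt I (θ.ofLocalField Z) (θ w) := by
  have h1 : ContMDiffAt 𝓘(ℝ, W) 𝓘(ℝ, W).tangent ∞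
      (fun z => (⟨z, Z z⟩ : TangentBundle 𝓘(ℝ, W) W)) (θ.symm (θ w)) := by
    rw [θ.left_inv_apply hw]
    exact contMDiffAt_vectorSpace_iff_contDiffAt.2 hZ
  exact ContMDiffAt.mpullback_vectorField_preimage h1
    (θ.contMDiffAt_symm_apply (θ.map_source_apply hw))
    (θ.symm.isInvertible_mfderiv (θ.map_source_apply hw)) le_rfl

lemma smoothFieldAt_iff [IsManifold I 1 X] (hw : w ∈ θ.source) :
    SmoothFieldAt I Y (θ w) ↔ ContDiffAt ℝ ∞ (θ.localField Y) w := by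
  refine ⟨contDiffAt_localField hw, fun h => ?_⟩
  refine ContMDiffAt.congr_of_eventuallyEq (smoothFieldAt_ofLocalField hw h) ?_
  filter_upwards [θ.open_target.mem_nhds (θ.map_source_apply hw)] with x hx
  rw [ofLocalField_localField hx]

lemma differentiableAt_localField [IsManifold I 1 X] (hw : w ∈ θ.source)
    (hY : MDifferentiableAt I I.tangent (fun y => (⟨y, Y y⟩ : TangentBundle I X)) (θ w)) :
    DifferentiableAt ℝ (θ.localField Y) w := by
  have : IsManifold I 2 X := IsManifold.of_le (n := ∞) (WithTop.coe_le_coe.2 le_top)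
  have h := MDifferentiableAt.mpullback_vectorField (n := ∞) hY (θ.contMDiffAt_apply hw)
    (θ.isInvertible_mfderiv hw) (WithTop.coe_le_coe.2 le_top)
  have h2 := (mdifferentiableAt_totalSpace _ _).1 h
  refine mdifferentiableAt_iff_differentiableAt.1 (h2.2.congr_of_eventuallyEq ?_)
  exact Eventually.of_forall fun z => by simp; rfl

lemma smooth_end_apply [IsManifold I 1 X] {x : X} (hJ : ContMDiffAt I (I.prod 𝓘(ℝ, V →L[ℝ] V)) ∞
    (fun x => (⟨x, J x⟩ : TotalSpace (V →L[ℝ] V)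
      (fun x : X => TangentSpace I x →L[ℝ] TangentSpace I x))) x)
    (hY : SmoothFieldAt I Y x) : SmoothFieldAt I (fun x => J x (Y x)) x :=
  ContMDiffAt.clm_bundle_apply hJ hY

lemma contDiffAt_localEnd [IsManifold I 1 X] (hw : w ∈ θ.source)
    (hJ : ContMDiffAt I (I.prod 𝓘(ℝ, V →L[ℝ] V)) ∞
    (fun x => (⟨x, J x⟩ : TotalSpace (V →L[ℝ] V)
      (fun x : X => TangentSpace I x →L[ℝ] TangentSpace I x))) (θ w)) :
    ContDiffAt ℝ ∞ (θ.localEnd J) w := by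
  refine contDiffAt_of_clm_apply ?_
  intro v
  have h := contDiffAt_localField hw
    (smooth_end_apply hJ (smoothFieldAt_ofLocalField hw (contDiffAt_const (c := v))))
  refine h.congr_of_eventuallyEq ?_
  filter_upwards [θ.open_source.mem_nhds hw] with z hz
  rw [localField_end hz, localField_ofLocalField hz]

/-- A field of endomorphisms is smooth if it maps smooth vector fields to smooth ones. -/
lemma _root_.contMDiffAt_end_of_apply [IsManifold I 1 X] {x : X}
    (h : ∀ Y : (∀ x : X, TangentSpace I x), SmoothFieldAt I Y x →
      SmoothFieldAt I (fun x => J x (Y x)) x) :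
    ContMDiffAt I (I.prod 𝓘(ℝ, V →L[ℝ] V)) ∞
    (fun x => (⟨x, J x⟩ : TotalSpace (V →L[ℝ] V)
      (fun x : X => TangentSpace I x →L[ℝ] TangentSpace I x))) x := by
  rw [contMDiffAt_hom_bundle]
  refine ⟨contMDiffAt_id, contMDiffAt_of_clm_apply fun v => ?_⟩
  set t := trivializationAt V (TangentSpace I) x with ht
  have hx : x ∈ t.baseSet := FiberBundle.mem_baseSet_trivializationAt' x
  have hY : SmoothFieldAt I (FiberBundle.extend V (t.symm x v)) x :=
    FiberBundle.contMDiffAt_extend I V _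
  have h1 := contMDiffAt_totalSpace.1 (h _ hY)
  refine h1.2.congr_of_eventuallyEq ?_
  filter_upwards [t.open_baseSet.mem_nhds hx] with y hy
  change ContinuousLinearMap.inCoordinates V (TangentSpace I) V (TangentSpace I) x y x y (J y) v =
    (t ⟨y, J y (FiberBundle.extend V (t.symm x v) y)⟩).2
  rw [ContinuousLinearMap.inCoordinates_eq hy hy]
  have h3 : FiberBundle.extend V (t.symm x v) y = t.symm y v := by
    rw [FiberBundle.extend, t.apply_mk_symm hx]
  rw [h3]
  change (t.continuousLinearEquivAt ℝ y hy) (J y ((t.continuousLinearEquivAt ℝ y hy).symm v)) = _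
  rw [t.coe_continuousLinearEquivAt_eq, t.symm_continuousLinearEquivAt_eq]
  rw [t.symmL_apply hy]
  exact t.continuousLinearMapAt_apply_of_mem (R := ℝ) hy (J y (t.symm y v))

/-- Lie brackets of vector fields can be computed in a parametrization. -/
lemma localField_mlieBracket [IsManifold I 1 X] (hw : w ∈ θ.source)
    (hY : MDifferentiableAt I I.tangent (fun y => (⟨y, Y y⟩ : TangentBundle I X)) (θ w))
    (hZ : MDifferentiableAt I I.tangent (fun y => (⟨y, Z y⟩ : TangentBundle I X)) (θ w)) :
    θ.localField (VectorField.mlieBracket I Y Z) w =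
      VectorField.lieBracket ℝ (θ.localField Y) (θ.localField Z) w := by
  have : IsManifold I (minSmoothness ℝ 2) X := IsManifold.of_le (n := ∞)
    (by rw [minSmoothness_of_isRCLikeNormedField]; exact WithTop.coe_le_coe.2 le_top)
  have h := VectorField.mpullback_mlieBracket (n := ∞) hY hZ (θ.contMDiffAt_apply hw)
    (by rw [minSmoothness_of_isRCLikeNormedField]; exact WithTop.coe_le_coe.2 le_top)
  refine h.trans ?_
  rw [← VectorField.mlieBracketWithin_univ,
    VectorField.mlieBracketWithin_eq_lieBracketWithin]
  exact congrFun VectorField.lieBracketWithin_univ w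

/-- The Nijenhuis tensor can be computed in a parametrization. -/
lemma localField_nijenhuis [IsManifold I 1 X] (hw : w ∈ θ.source) (hJ : IsAlmostComplex I J)
    (hY : MDifferentiableAt I I.tangent (fun y => (⟨y, Y y⟩ : TangentBundle I X)) (θ w))
    (hZ : MDifferentiableAt I I.tangent (fun y => (⟨y, Z y⟩ : TangentBundle I X)) (θ w)) :
    θ.localField (nijenhuis J Y Z) w =
      localNijenhuis (θ.localEnd J) w (θ.localField Y w) (θ.localField Z w) := by
  have hb : ∀ {A B : ∀ x : X, TangentSpace I x},
      MDifferentiableAt I I.tangent (fun y => (⟨y, A y⟩ : TangentBundle I X)) (θ w) →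
      MDifferentiableAt I I.tangent (fun y => (⟨y, B y⟩ : TangentBundle I X)) (θ w) →
      (mfderiv 𝓘(ℝ, W) I θ w).inverse (VectorField.mlieBracket I A B (θ w)) =
        VectorField.lieBracket ℝ (θ.localField A) (θ.localField B) w := by
    intro A B hA hB
    have h := localField_mlieBracket hw hA hB
    exact h
  have hJY : MDifferentiableAt I I.tangent (fun y => (⟨y, J y (Y y)⟩ : TangentBundle I X)) (θ w) :=
    MDifferentiableAt.clm_bundle_apply ((hJ.smooth (θ w)).mdifferentiableAt (by simp)) hY
  have hJZ : MDifferentiableAt I I.tangent (fun y => (⟨y, J y (Z y)⟩ : TangentBundle I X)) (θ w) :=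
    MDifferentiableAt.clm_bundle_apply ((hJ.smooth (θ w)).mdifferentiableAt (by simp)) hZ
  have hend : ∀ v, (mfderiv 𝓘(ℝ, W) I θ w).inverse (J (θ w) v) =
      θ.localEnd J w ((mfderiv 𝓘(ℝ, W) I θ w).inverse v) := by
    intro v
    change θ.pull w (J (θ w) v) = θ.localEnd J w (θ.pull w v)
    apply push_injective hw
    rw [push_pull hw, push_localEnd hw, push_pull hw]
  have hc : ∀ A : (∀ x : X, TangentSpace I x), θ.localField (fun x => J x (A x)) =ᶠ[𝓝 w]
      fun z => θ.localEnd J z (θ.localField A z) := fun A => by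
    filter_upwards [θ.open_source.mem_nhds hw] with z hz using localField_end hz
  rw [← lieBracket_nijenhuis ((contDiffAt_localEnd hw (hJ.smooth (θ w))).differentiableAt (by simp))
    (differentiableAt_localField hw hY) (differentiableAt_localField hw hZ)
    (localEnd_sq hw (hJ.sq _))]
  change (mfderiv 𝓘(ℝ, W) I θ w).inverse (nijenhuis J Y Z (θ w)) = _
  rw [nijenhuis, map_sub, map_sub, map_sub, hend, hend, hb hJY hJZ, hb hJY hZ, hb hY hJZ, hb hY hZ,
    Filter.EventuallyEq.lieBracket_vectorField_eq (hc Y) (hc Z),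
    Filter.EventuallyEq.lieBracket_vectorField_eq (hc Y) .rfl,
    Filter.EventuallyEq.lieBracket_vectorField_eq .rfl (hc Z)]
  rfl

end Smooth

end PartialDiffeomorph

end LocalTensor

/-! ### The Nijenhuis tensor of the linearization -/

section NijenhuisLinearization

variable {A B : Type*} [NormedAddCommGroup A] [NormedSpace ℝ A] [NormedAddCommGroup B]
  [NormedSpace ℝ B] {𝒥 : A × B → A × B →L[ℝ] A × B} {w : A × B}

/-- The derivative of the linearization in the direction `v`, applied to `z`. Only the first and
second derivatives of `𝒥` at the base point `(w.1, 0)` enter. -/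
lemma hasFDerivAt_linearization (h𝒥 : ContDiffAt ℝ ∞ 𝒥 (w.1, 0)) :
    ∃ D : A × B →L[ℝ] A × B →L[ℝ] A × B, HasFDerivAt (linearization 𝒥) D w ∧
      ∀ v z : A × B, D v z = ((fderiv ℝ 𝒥 (w.1, 0) (v.1, 0) (z.1, 0)).1,
        (fderiv ℝ (fderiv ℝ 𝒥) (w.1, 0) (v.1, 0) (0, w.2) (z.1, 0)).2 +
        (fderiv ℝ 𝒥 (w.1, 0) (0, v.2) (z.1, 0)).2 +
        (fderiv ℝ 𝒥 (w.1, 0) (v.1, 0) (0, z.2)).2) := by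
  have h1 : HasFDerivAt (fun z : A × B => 𝒥 (projFst z))
      ((fderiv ℝ 𝒥 (w.1, 0)).comp projFst) w :=
    HasFDerivAt.comp (f := (projFst : A × B →L[ℝ] A × B)) w
      (h𝒥.differentiableAt (by simp)).hasFDerivAt (ContinuousLinearMap.hasFDerivAt _)
  have h2 : HasFDerivAt (fun z : A × B => fderiv ℝ 𝒥 (projFst z))
      ((fderiv ℝ (fderiv ℝ 𝒥) (w.1, 0)).comp projFst) w :=
    HasFDerivAt.comp (f := (projFst : A × B →L[ℝ] A × B)) w
      ((h𝒥.fderiv_right (m := ∞) (by simp)).differentiableAt (by simp)).hasFDerivAt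
      (ContinuousLinearMap.hasFDerivAt _)
  have h3 := h2.clm_apply ((projSnd : A × B →L[ℝ] A × B).hasFDerivAt (x := w))
  have hs : ∀ (P Q : A × B →L[ℝ] A × B) {f : A × B → A × B →L[ℝ] A × B}
      {f' : A × B →L[ℝ] A × B →L[ℝ] A × B}, HasFDerivAt f f' w →
      HasFDerivAt (fun z => sandwich P Q (f z)) ((sandwich P Q).comp f') w :=
    fun P Q f f' hf => HasFDerivAt.comp w (sandwich P Q).hasFDerivAt hf
  refine ⟨_, ((hs projFst projFst h1).add (hs projSnd projFst h3)).add (hs projSnd projSnd h1),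
    fun v z => ?_⟩
  change projFst (fderiv ℝ 𝒥 (w.1, 0) (projFst v) (projFst z)) +
    projSnd ((fderiv ℝ 𝒥 (w.1, 0) (projSnd v) +
      fderiv ℝ (fderiv ℝ 𝒥) (w.1, 0) (projFst v) (projSnd w)) (projFst z)) +
    projSnd (fderiv ℝ 𝒥 (w.1, 0) (projFst v) (projSnd z)) = _
  simp only [projFst_apply, projSnd_apply, Prod.mk_add_mk, add_zero, zero_add, _root_.add_apply,
    Prod.snd_add]
  rw [add_comm (fderiv ℝ 𝒥 (w.1, 0) (0, v.2) (z.1, 0)).2]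

lemma contDiffAt_linearization (h𝒥 : ContDiffAt ℝ ∞ 𝒥 (w.1, 0)) :
    ContDiffAt ℝ ∞ (linearization 𝒥) w := by
  have hp : ContDiffAt ℝ ∞ (fun z : A × B => (projFst z : A × B)) w :=
    (projFst : A × B →L[ℝ] A × B).contDiff.contDiffAt
  have h1 : ContDiffAt ℝ ∞ (fun z : A × B => 𝒥 (projFst z)) w := ContDiffAt.comp w h𝒥 hp
  have h2 : ContDiffAt ℝ ∞ (fun z : A × B => fderiv ℝ 𝒥 (projFst z)) w :=
    ContDiffAt.comp w (h𝒥.fderiv_right (m := ∞) (by simp)) hp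
  have h3 := h2.clm_apply (projSnd : A × B →L[ℝ] A × B).contDiff.contDiffAt
  have hs : ∀ (P Q : A × B →L[ℝ] A × B) {f : A × B → A × B →L[ℝ] A × B}, ContDiffAt ℝ ∞ f w →
      ContDiffAt ℝ ∞ (fun z => sandwich P Q (f z)) w :=
    fun P Q f hf => (sandwich P Q).contDiff.contDiffAt.comp w hf
  exact ((hs projFst projFst h1).add (hs projSnd projFst h3)).add (hs projSnd projSnd h1)

/-- The linearization of a field of complex structures is a field of complex structures: the
`A → B` block of its square is the derivative of `𝒥 ∘ 𝒥` in the normal direction `(0, w.2)`. -/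
lemma linearization_sq (h𝒥 : DifferentiableAt ℝ 𝒥 (w.1, 0))
    (h0 : ∀ x : A, (𝒥 (w.1, 0) (x, 0)).2 = 0)
    (hsq : ∀ᶠ z in 𝓝 (w.1, (0 : B)), ∀ v, 𝒥 z (𝒥 z v) = -v) (v : A × B) :
    linearization 𝒥 w (linearization 𝒥 w v) = -v := by
  have hx : ∀ x : A, 𝒥 (w.1, 0) (x, 0) = ((𝒥 (w.1, 0) (x, 0)).1, 0) :=
    fun x => Prod.ext rfl (h0 x)
  have hT : ∀ z : A × B, (𝒥 (w.1, 0) (0, z.2)).2 = (𝒥 (w.1, 0) z).2 := fun z => by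
    rw [apply_split (𝒥 (w.1, 0)) z, Prod.snd_add, h0, zero_add]
  -- the derivative of `𝒥 ∘ 𝒥 = -1` in the direction of the second factor
  have hd : ∀ z : A × B, fderiv ℝ 𝒥 (w.1, 0) (0, w.2) (𝒥 (w.1, 0) z) +
      𝒥 (w.1, 0) (fderiv ℝ 𝒥 (w.1, 0) (0, w.2) z) = 0 := by
    intro z
    have e1 := h𝒥.hasFDerivAt.clm_comp h𝒥.hasFDerivAt
    have e2 : (fun z => (𝒥 z).comp (𝒥 z)) =ᶠ[𝓝 (w.1, (0 : B))]
        fun _ => -ContinuousLinearMap.id ℝ (A × B) := by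
      filter_upwards [hsq] with y hy using ContinuousLinearMap.ext hy
    have e3 := e1.unique ((hasFDerivAt_const _ _).congr_of_eventuallyEq e2)
    have e4 := DFunLike.congr_fun (DFunLike.congr_fun e3 (0, w.2)) z
    rw [add_comm]
    exact e4
  have hsq0 := hsq.self_of_nhds
  rw [linearization_apply, linearization_apply]
  refine Prod.ext ?_ ?_
  · change (𝒥 (w.1, 0) ((𝒥 (w.1, 0) (v.1, 0)).1, 0)).1 = _
    rw [← hx, hsq0]
    rfl
  · change (fderiv ℝ 𝒥 (w.1, 0) (0, w.2) ((𝒥 (w.1, 0) (v.1, 0)).1, 0)).2 +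
      (𝒥 (w.1, 0) (0, (fderiv ℝ 𝒥 (w.1, 0) (0, w.2) (v.1, 0)).2 + (𝒥 (w.1, 0) (0, v.2)).2)).2 = _
    have e : ∀ a b : B, ((0 : A), a + b) = (0, a) + (0, b) := fun a b => by simp
    rw [← hx, e, map_add, Prod.snd_add, hT, hT, hsq0, ← add_assoc, ← Prod.snd_add, hd]
    simp

/-- In the linearization the block `A → A` of the Nijenhuis tensor is that of `𝒥` along `A × 0`;
the blocks with values in `B` are the mixed blocks of the Nijenhuis tensor of `𝒥` along `A × 0`
and the normal derivative of the normal part of its restriction to `A`. -/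
lemma localNijenhuis_linearization (h𝒥 : ContDiffAt ℝ ∞ 𝒥 (w.1, 0))
    (h0 : ∀ᶠ u in 𝓝 w.1, ∀ x : A, (𝒥 (u, 0) (x, 0)).2 = 0) (X X' : A × B) :
    localNijenhuis (linearization 𝒥) w X X' =
      ((localNijenhuis 𝒥 (w.1, 0) (X.1, 0) (X'.1, 0)).1,
        (fderiv ℝ (fun z => localNijenhuis 𝒥 z (X.1, 0) (X'.1, 0)) (w.1, 0) (0, w.2)).2 +
        (localNijenhuis 𝒥 (w.1, 0) (0, X.2) (X'.1, 0)).2 +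
        (localNijenhuis 𝒥 (w.1, 0) (X.1, 0) (0, X'.2)).2) := by
  obtain ⟨D', hD', hDa⟩ := hasFDerivAt_linearization (w := w) h𝒥
  have hdiff := h𝒥.differentiableAt (n := ∞) (by simp)
  have hA := (h𝒥.fderiv_right (m := ∞) (by simp)).differentiableAt (n := ∞) (by simp)
  have hb := fun y x => fderiv_block_eq_zero hdiff h0 y x
  have hsymm : IsSymmSndFDerivAt ℝ 𝒥 (w.1, 0) := h𝒥.isSymmSndFDerivAt
    (by rw [minSmoothness_of_isRCLikeNormedField]; exact WithTop.coe_le_coe.2 le_top)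
  have h00 : ∀ x : A, (𝒥 (w.1, 0) (x, 0)).2 = 0 := h0.self_of_nhds
  -- the derivative of the Nijenhuis tensor
  have hN : ∀ (Y Y' : A × B) (ν : A × B), fderiv ℝ (fun z => localNijenhuis 𝒥 z Y Y') (w.1, 0) ν =
      fderiv ℝ (fderiv ℝ 𝒥) (w.1, 0) ν (𝒥 (w.1, 0) Y) Y'
      + fderiv ℝ 𝒥 (w.1, 0) (fderiv ℝ 𝒥 (w.1, 0) ν Y) Y'
      - (fderiv ℝ (fderiv ℝ 𝒥) (w.1, 0) ν (𝒥 (w.1, 0) Y') Y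
      + fderiv ℝ 𝒥 (w.1, 0) (fderiv ℝ 𝒥 (w.1, 0) ν Y') Y)
      - (fderiv ℝ 𝒥 (w.1, 0) ν (fderiv ℝ 𝒥 (w.1, 0) Y Y')
      + 𝒥 (w.1, 0) (fderiv ℝ (fderiv ℝ 𝒥) (w.1, 0) ν Y Y'))
      + (fderiv ℝ 𝒥 (w.1, 0) ν (fderiv ℝ 𝒥 (w.1, 0) Y' Y)
      + 𝒥 (w.1, 0) (fderiv ℝ (fderiv ℝ 𝒥) (w.1, 0) ν Y' Y)) := by
    intro Y Y' ν
    have hc : ∀ y : A × B, HasFDerivAt (fun _ : A × B => y)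
        (0 : A × B →L[ℝ] A × B) (w.1, (0 : B)) :=
      fun y => hasFDerivAt_const _ _
    have e1 := fun Y Y' => (hA.hasFDerivAt.clm_apply (hdiff.hasFDerivAt.clm_apply (hc Y))).clm_apply
      (hc Y')
    have e2 := fun Y Y' => hdiff.hasFDerivAt.clm_apply
      ((hA.hasFDerivAt.clm_apply (hc Y)).clm_apply (hc Y'))
    have e3 := (((e1 Y Y').sub (e1 Y' Y)).sub (e2 Y Y')).add (e2 Y' Y)
    have e4 := e3.fderiv
    refine (DFunLike.congr_fun e4 ν).trans ?_
    simp
    abel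
  have hT : ∀ (T : A × B →L[ℝ] A × B), (∀ x, (T (x, 0)).2 = 0) → ∀ z, (T z).2 = (T (0, z.2)).2 :=
    fun T h z => by rw [apply_split T z, Prod.snd_add, h, zero_add]
  obtain ⟨a, hJx⟩ : ∃ a : A → A, ∀ x : A, 𝒥 (w.1, 0) (x, 0) = (a x, 0) :=
    ⟨fun x => (𝒥 (w.1, 0) (x, 0)).1, fun x => Prod.ext rfl (h00 x)⟩
  obtain ⟨b, hDx⟩ : ∃ b : A → A → A, ∀ y x : A, fderiv ℝ 𝒥 (w.1, 0) (y, 0) (x, 0) = (b y x, 0) :=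
    ⟨fun y x => (fderiv ℝ 𝒥 (w.1, 0) (y, 0) (x, 0)).1, fun y x => Prod.ext rfl (hb y x)⟩
  -- the normal part of `D𝒥(v)(x, 0)` depends only on the normal part of `v`
  have hDv : ∀ (v : A × B) (x : A), (fderiv ℝ 𝒥 (w.1, 0) v (x, 0)).2 =
      (fderiv ℝ 𝒥 (w.1, 0) (0, v.2) (x, 0)).2 := by
    intro v x
    have e : v = (v.1, 0) + (0, v.2) := by simp
    conv_lhs => rw [e, map_add, _root_.add_apply, Prod.snd_add, hb, zero_add]
  have hJT := hT _ h00
  obtain ⟨x, y⟩ := X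
  obtain ⟨x', y'⟩ := X'
  rw [localNijenhuis, hD'.fderiv]
  simp only [hDa, linearization_apply]
  refine Prod.ext ?_ ?_
  · simp only [localNijenhuis, Prod.fst_add, Prod.fst_sub, hJx, hDx]
  · rw [hN, hsymm.eq (0, w.2) (𝒥 (w.1, 0) (x, 0)), hsymm.eq (0, w.2) (𝒥 (w.1, 0) (x', 0)),
      hsymm.eq (0, w.2) (x, 0), hsymm.eq (0, w.2) (x', 0)]
    have e : ∀ a b : B, ((0 : A), a + b) = (0, a) + (0, b) := fun a b => by simp
    simp only [localNijenhuis, Prod.snd_add, Prod.snd_sub]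
    rw [hDv (fderiv ℝ 𝒥 (w.1, 0) (0, w.2) (x, 0)), hDv (fderiv ℝ 𝒥 (w.1, 0) (0, w.2) (x', 0)),
      hDv (𝒥 (w.1, 0) (0, y)), hDv (𝒥 (w.1, 0) (0, y')),
      hJT (fderiv ℝ (fderiv ℝ 𝒥) (w.1, 0) (x', 0) (0, w.2) (x, 0)),
      hJT (fderiv ℝ (fderiv ℝ 𝒥) (w.1, 0) (x, 0) (0, w.2) (x', 0)),
      hJT (fderiv ℝ 𝒥 (w.1, 0) (0, y) (x', 0)), hJT (fderiv ℝ 𝒥 (w.1, 0) (x', 0) (0, y)),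
      hJT (fderiv ℝ 𝒥 (w.1, 0) (0, y') (x, 0)), hJT (fderiv ℝ 𝒥 (w.1, 0) (x, 0) (0, y'))]
    simp only [e, map_add, _root_.add_apply, Prod.snd_add, hJx, hDx]
    abel

end NijenhuisLinearization

/-! ### Linear connections in coordinates -/

section Connection

variable {W E M : Type*} [NormedAddCommGroup W] [NormedSpace ℝ W] [FiniteDimensional ℝ W]
  [NormedAddCommGroup E] [NormedSpace ℝ E] [FiniteDimensional ℝ E]
  [TopologicalSpace M] [ChartedSpace E M] [IsManifold 𝓘(ℝ, E) ∞ M] [IsManifold 𝓘(ℝ, E) 1 M]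

namespace PartialDiffeomorph

variable (θ : PartialDiffeomorph 𝓘(ℝ, W) 𝓘(ℝ, E) W M ∞)

/-- The connection on the image of a local parametrization with given coefficients: `Γ w y v` is
the correction to the derivative of a field with value `y` at `w` in the direction `v`. -/
def coordConnection (Γ : W → W →L[ℝ] W →L[ℝ] W) (Y : ∀ x : M, TangentSpace 𝓘(ℝ, E) x) (x : M) :
    TangentSpace 𝓘(ℝ, E) x →L[ℝ] TangentSpace 𝓘(ℝ, E) x :=
  (mfderiv 𝓘(ℝ, E) 𝓘(ℝ, W) θ.symm x).inverse.comp
    ((fderiv ℝ (θ.localField Y) (θ.symm x) + Γ (θ.symm x) (θ.localField Y (θ.symm x)) :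
      W →L[ℝ] W).comp (mfderiv 𝓘(ℝ, E) 𝓘(ℝ, W) θ.symm x))

/-- The connection `cov` has the coefficients `Γ` on the set `s` in the parametrization `θ`. -/
def HasCoefficients (cov : (∀ x : M, TangentSpace 𝓘(ℝ, E) x) →
      (∀ x : M, TangentSpace 𝓘(ℝ, E) x →L[ℝ] TangentSpace 𝓘(ℝ, E) x))
    (Γ : W → W →L[ℝ] W →L[ℝ] W) (s : Set W) : Prop :=
  ∀ w ∈ s, ∀ Y : (∀ x : M, TangentSpace 𝓘(ℝ, E) x), SmoothFieldAt 𝓘(ℝ, E) Y (θ w) → ∀ v : W,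
    cov Y (θ w) (θ.push w v) =
      θ.push w (fderiv ℝ (θ.localField Y) w v + Γ w (θ.localField Y w) v)

variable {θ} {w : W} {Γ : W → W →L[ℝ] W →L[ℝ] W}

lemma coordConnection_apply (hw : w ∈ θ.source) (Y : ∀ x : M, TangentSpace 𝓘(ℝ, E) x) (v : W) :
    θ.coordConnection Γ Y (θ w) (θ.push w v) =
      θ.push w (fderiv ℝ (θ.localField Y) w v + Γ w (θ.localField Y w) v) := by
  have h := θ.ofLocalField_apply hw
    (fun z => fderiv ℝ (θ.localField Y) z v + Γ z (θ.localField Y z) v)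
  rw [← h]
  have h2 : mfderiv 𝓘(ℝ, E) 𝓘(ℝ, W) θ.symm (θ w) (θ.push w v) = v :=
    DFunLike.congr_fun (θ.mfderiv_symm_comp hw) v
  change (mfderiv 𝓘(ℝ, E) 𝓘(ℝ, W) θ.symm (θ w)).inverse
    ((fderiv ℝ (θ.localField Y) (θ.symm (θ w)) + Γ (θ.symm (θ w))
      (θ.localField Y (θ.symm (θ w))) : W →L[ℝ] W)
      (mfderiv 𝓘(ℝ, E) 𝓘(ℝ, W) θ.symm (θ w) (θ.push w v))) = _
  rw [h2]
  rfl

lemma clm_ext_mfderiv (hw : w ∈ θ.source)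
    {T T' : TangentSpace 𝓘(ℝ, E) (θ w) →L[ℝ] TangentSpace 𝓘(ℝ, E) (θ w)}
    (h : ∀ v : W, T (θ.push w v) = T' (θ.push w v)) :
    T = T' := by
  refine ContinuousLinearMap.ext fun v => ?_
  rw [← push_pull hw v]
  exact h _

lemma localField_add (Y Z : ∀ x : M, TangentSpace 𝓘(ℝ, E) x) :
    θ.localField (Y + Z) = θ.localField Y + θ.localField Z :=
  VectorField.mpullback_add

lemma localField_smul (g : M → ℝ) (Y : ∀ x : M, TangentSpace 𝓘(ℝ, E) x) :
    θ.localField (g • Y) = (g ∘ θ) • θ.localField Y :=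
  VectorField.mpullback_smul

lemma isCovariantDerivativeOn_coordConnection :
    IsCovariantDerivativeOn E (θ.coordConnection Γ) θ.target where
  add {Y Z x} hY hZ hx := by
    obtain ⟨w, hw, rfl⟩ : ∃ w ∈ θ.source, θ w = x :=
      ⟨θ.symm x, θ.map_target_apply hx, θ.right_inv_apply hx⟩
    refine clm_ext_mfderiv hw fun v => ?_
    rw [_root_.add_apply, coordConnection_apply hw, coordConnection_apply hw,
      coordConnection_apply hw, localField_add, fderiv_add (differentiableAt_localField hw hY)
        (differentiableAt_localField hw hZ), ← map_add]
    congr 1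
    simp only [Pi.add_apply, map_add, _root_.add_apply]
    abel
  leibniz {Y g x} hY hg hx := by
    obtain ⟨w, hw, rfl⟩ : ∃ w ∈ θ.source, θ w = x :=
      ⟨θ.symm x, θ.map_target_apply hx, θ.right_inv_apply hx⟩
    refine clm_ext_mfderiv hw fun v => ?_
    obtain ⟨g', hg', hg'v⟩ : ∃ g' : W →L[ℝ] ℝ, HasFDerivAt (g ∘ θ) g' w ∧
        ∀ v, g' v = mfderiv 𝓘(ℝ, E) 𝓘(ℝ, ℝ) g (θ w) (θ.push w v) :=
      ⟨_, hasMFDerivAt_iff_hasFDerivAt.1 (hg.hasMFDerivAt.comp w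
        ((θ.contMDiffAt_apply hw).mdifferentiableAt (by simp)).hasMFDerivAt), fun v => rfl⟩
    have hd := (hg'.smul (differentiableAt_localField hw hY).hasFDerivAt).fderiv
    rw [coordConnection_apply hw, localField_smul, hd]
    change _ = g (θ w) • θ.coordConnection Γ Y (θ w) (θ.push w v) +
      (show ℝ from mfderiv 𝓘(ℝ, E) 𝓘(ℝ, ℝ) g (θ w) (θ.push w v)) • Y (θ w)
    rw [← hg'v, coordConnection_apply hw, ← push_localField (Y := Y) hw, ← map_smul, ← map_smul,
      ← map_add]
    congr 1
    simp only [Pi.smul_apply', map_smul, _root_.add_apply, _root_.smul_apply,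
      ContinuousLinearMap.smulRight_apply, Function.comp_apply, smul_add]
    abel

lemma contMDiffAt_coordConnection (hw : w ∈ θ.source) (hΓ : ContDiffAt ℝ ∞ Γ w)
    {Y : ∀ x : M, TangentSpace 𝓘(ℝ, E) x} (hY : SmoothFieldAt 𝓘(ℝ, E) Y (θ w)) :
    ContMDiffAt 𝓘(ℝ, E) (𝓘(ℝ, E).prod 𝓘(ℝ, E →L[ℝ] E)) ∞
    (fun x => (⟨x, θ.coordConnection Γ Y x⟩ : TotalSpace (E →L[ℝ] E)
      (fun x : M => TangentSpace 𝓘(ℝ, E) x →L[ℝ] TangentSpace 𝓘(ℝ, E) x))) (θ w) := by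
  refine contMDiffAt_end_of_apply fun Z hZ => ?_
  have hY' := contDiffAt_localField hw hY
  have hZ' := contDiffAt_localField hw hZ
  have h1 : ContDiffAt ℝ ∞ (fun z => fderiv ℝ (θ.localField Y) z (θ.localField Z z)
      + Γ z (θ.localField Y z) (θ.localField Z z)) w :=
    ((hY'.fderiv_right (m := ∞) (by simp)).clm_apply hZ').add ((hΓ.clm_apply hY').clm_apply hZ')
  refine ContMDiffAt.congr_of_eventuallyEq (smoothFieldAt_ofLocalField hw h1) ?_
  filter_upwards [θ.open_target.mem_nhds (θ.map_source_apply hw)] with x hx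
  obtain ⟨z, hz, rfl⟩ : ∃ z ∈ θ.source, θ z = x :=
      ⟨θ.symm x, θ.map_target_apply hx, θ.right_inv_apply hx⟩
  rw [ofLocalField_apply hz, ← coordConnection_apply hz, push_localField hz]

/-- A vector field that is smooth near a point agrees near it with a smooth vector field. -/
lemma _root_.exists_smooth_extension [T2Space M] {Z : ∀ x : M, TangentSpace 𝓘(ℝ, E) x} {x : M}
    {V : Set M} (hV : V ∈ 𝓝 x) (hZ : ∀ y ∈ V, SmoothFieldAt 𝓘(ℝ, E) Z y) :
    ∃ Z' : ∀ x : M, TangentSpace 𝓘(ℝ, E) x, (∀ y, SmoothFieldAt 𝓘(ℝ, E) Z' y) ∧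
      ∀ᶠ y in 𝓝 x, Z' y = Z y := by
  obtain ⟨V', hV'V, hV'o, hxV'⟩ := mem_nhds_iff.1 hV
  obtain ⟨f, hf, -⟩ := (SmoothBumpFunction.nhds_basis_support (I := 𝓘(ℝ, E))
    (hV'o.mem_nhds hxV')).mem_iff.1 (hV'o.mem_nhds hxV')
  refine ⟨(f : M → ℝ) • Z, ?_, ?_⟩
  · exact ContMDiffOn.smul_section_of_tsupport (V := fun x : M => TangentSpace 𝓘(ℝ, E) x)
      (n := ∞) f.contMDiff.contMDiffOn hV'o hf
      (fun y hy => (hZ y (hV'V hy)).contMDiffWithinAt)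
  · filter_upwards [f.eventuallyEq_one] with y hy
    simp [hy]

/-- The coefficients of a smooth connection in a local parametrization are smooth. -/
lemma exists_hasCoefficients [T2Space M] {U : Set M} (hU : IsOpen U)
    {cov : (∀ x : M, TangentSpace 𝓘(ℝ, E) x) →
      (∀ x : M, TangentSpace 𝓘(ℝ, E) x →L[ℝ] TangentSpace 𝓘(ℝ, E) x)}
    (hcov : IsCovariantDerivativeOn E cov U) (hs : ContMDiffCovariantDerivativeOn E ∞ cov U) :
    ∃ Γ : W → W →L[ℝ] W →L[ℝ] W, ContDiffOn ℝ ∞ Γ (θ.source ∩ θ ⁻¹' U) ∧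
      θ.HasCoefficients cov Γ (θ.source ∩ θ ⁻¹' U) := by
  -- `Γ` is the difference tensor of `cov` and the flat connection of the parametrization, read in
  -- coordinates; it is defined by pointwise algebra, so its smoothness is shown afterwards
  have h0 : IsCovariantDerivativeOn E (θ.coordConnection 0) (U ∩ θ.target) :=
    isCovariantDerivativeOn_coordConnection.mono inter_subset_right
  have h1 : IsCovariantDerivativeOn E cov (U ∩ θ.target) := hcov.mono inter_subset_left
  let A : ∀ x : M, E →L[ℝ] E →L[ℝ] E := fun x => IsCovariantDerivativeOn.difference h1 h0 x
  let Γ : W → W →L[ℝ] W →L[ℝ] W := fun w =>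
    (ContinuousLinearMap.compL ℝ W E W (θ.pull w)).comp
      (((ContinuousLinearMap.compL ℝ W E E).flip (θ.push w)).comp ((A (θ w)).comp (θ.push w)))
  have hΓ : θ.HasCoefficients cov Γ (θ.source ∩ θ ⁻¹' U) := by
    rintro w ⟨hw, hwU⟩ Y hY v
    have e1 := IsCovariantDerivativeOn.difference_apply h1 h0 (x := θ w)
      ⟨hwU, θ.map_source_apply hw⟩ (hY.mdifferentiableAt (by simp))
    have e2 : cov Y (θ w) (θ.push w v) - θ.coordConnection 0 Y (θ w) (θ.push w v) =
      IsCovariantDerivativeOn.difference h1 h0 (θ w) (Y (θ w)) (θ.push w v) :=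
    (DFunLike.congr_fun e1 (θ.push w v)).symm
    rw [sub_eq_iff_eq_add, coordConnection_apply hw] at e2
    have e3 : Γ w (θ.localField Y w) v =
      θ.pull w (IsCovariantDerivativeOn.difference h1 h0 (θ w) (θ.push w (θ.localField Y w))
        (θ.push w v)) := rfl
    rw [e3, push_localField hw, map_add, push_pull hw, e2, add_comm]
    simp
  refine ⟨Γ, fun w hw => ContDiffAt.contDiffWithinAt ?_, hΓ⟩
  -- smoothness is tested on fields with constant components, extended to all of `M` by a cut-off
  refine contDiffAt_of_clm_apply fun y => contDiffAt_of_clm_apply fun v => ?_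
  have hext := fun y : W => exists_smooth_extension (Z := θ.ofLocalField fun _ => y)
    (θ.open_target.mem_nhds (θ.map_source_apply hw.1)) (by
      intro x hx
      obtain ⟨z, hz, rfl⟩ : ∃ z ∈ θ.source, θ z = x :=
        ⟨θ.symm x, θ.map_target_apply hx, θ.right_inv_apply hx⟩
      exact smoothFieldAt_ofLocalField hz contDiffAt_const)
  obtain ⟨Y, hYs, hYe⟩ := hext y
  obtain ⟨Z, hZs, hZe⟩ := hext v
  have e1 : SmoothFieldAt 𝓘(ℝ, E) (fun x => cov Y x (Z x)) (θ w) :=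
    ContMDiffAt.clm_bundle_apply ((hs.contMDiff (σ := Y)
      (fun x _ => (hYs x).contMDiffWithinAt)).contMDiffAt (hU.mem_nhds hw.2)) (hZs _)
  refine (contDiffAt_localField hw.1 e1).congr_of_eventuallyEq ?_
  have hc := (θ.contMDiffAt_apply hw.1).continuousAt
  filter_upwards [hc.eventually hZe, (hc.eventually hYe).eventually_nhds,
    θ.open_source.mem_nhds hw.1, hc (hU.mem_nhds hw.2)] with z hz hy hzs hzU
  have e2 : θ.localField Y =ᶠ[𝓝 z] fun _ => y := by
    filter_upwards [hy, θ.open_source.mem_nhds hzs] with z' hz' hzs'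
    rw [localField_apply, hz', ← localField_apply, localField_ofLocalField hzs']
  rw [localField_apply, hz, ofLocalField_apply hzs, hΓ z ⟨hzs, hzU⟩ Y (hYs _), pull_push hzs,
    e2.fderiv_eq, e2.self_of_nhds]
  simp

end PartialDiffeomorph

end Connection

/-! ### The geodesic equation in coordinates -/

section Geodesic

variable {W E M : Type*} [NormedAddCommGroup W] [NormedSpace ℝ W] [FiniteDimensional ℝ W]
  [NormedAddCommGroup E] [NormedSpace ℝ E] [FiniteDimensional ℝ E]
  [TopologicalSpace M] [ChartedSpace E M] [IsManifold 𝓘(ℝ, E) ∞ M] [IsManifold 𝓘(ℝ, E) 1 M]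

/-- The field `coordField x v` has constant components in the preferred chart at `x`. -/
lemma mfderiv_extChartAt_coordField (x : M) (v : TangentSpace 𝓘(ℝ, E) x) {y : M}
    (hy : y ∈ (chartAt E x).source) :
    mfderiv 𝓘(ℝ, E) 𝓘(ℝ, E) (extChartAt 𝓘(ℝ, E) x) y (coordField x v y) = (v : E) := by
  set t := trivializationAt E (TangentSpace 𝓘(ℝ, E)) x with ht
  have hx : x ∈ t.baseSet := FiberBundle.mem_baseSet_trivializationAt' x
  have hy' : y ∈ t.baseSet := hy
  have e1 : ((t ⟨x, v⟩).2 : E) = v := by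
    rw [← t.continuousLinearMapAt_apply_of_mem ℝ hx v,
      TangentBundle.continuousLinearMapAt_trivializationAt_eq_core (mem_chart_source E x)]
    exact (tangentBundleCore 𝓘(ℝ, E) M).coordChange_self _ _ (mem_chart_source E x) _
  have e2 : coordField x v y = t.symmL ℝ y (v : E) := by
    refine Eq.trans ?_ (t.symmL_apply (R := ℝ) hy' (v : E)).symm
    exact congrArg (t.symm y) e1
  rw [e2, ← TangentBundle.continuousLinearMapAt_trivializationAt hy]
  exact t.continuousLinearMapAt_symmL hy' _

/-- The left-hand side of the geodesic equation at the time `t`, with the position `x` and the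
velocity `v` as separate arguments. -/
def geodesicDefect (cov : (∀ x : M, TangentSpace 𝓘(ℝ, E) x) →
      (∀ x : M, TangentSpace 𝓘(ℝ, E) x →L[ℝ] TangentSpace 𝓘(ℝ, E) x)) (γ : ℝ → M) (t : ℝ)
    (x : M) (v : TangentSpace 𝓘(ℝ, E) x) : TangentSpace 𝓘(ℝ, E) x :=
  let a : TangentSpace 𝓘(ℝ, E) x := show E from deriv (deriv (extChartAt 𝓘(ℝ, E) x ∘ γ)) t
  a + cov (coordField x v) x v

namespace PartialDiffeomorph

variable {θ : PartialDiffeomorph 𝓘(ℝ, W) 𝓘(ℝ, E) W M ∞} {w : W} {Γ : W → W →L[ℝ] W →L[ℝ] W}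

lemma push_comp_mfderiv (hw : w ∈ θ.source) {x : M} (hx : θ w ∈ (chartAt E x).source) (v : W) :
    fderiv ℝ (extChartAt 𝓘(ℝ, E) x ∘ θ) w v =
      mfderiv 𝓘(ℝ, E) 𝓘(ℝ, E) (extChartAt 𝓘(ℝ, E) x) (θ w) (θ.push w v) := by
  rw [← mfderiv_eq_fderiv, mfderiv_comp (I' := 𝓘(ℝ, E)) w (mdifferentiableAt_extChartAt hx)
    ((θ.contMDiffAt_apply hw).mdifferentiableAt (by simp))]
  rfl

lemma push_eq_fderiv (hw : w ∈ θ.source) (v : W) :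
    (θ.push w v : E) = fderiv ℝ (extChartAt 𝓘(ℝ, E) (θ w) ∘ θ) w v := by
  rw [push, MDifferentiableAt.mfderiv ((θ.contMDiffAt_apply hw).mdifferentiableAt (by simp))]
  simp [writtenInExtChartAt]
  rfl

lemma velocity_comp {c : ℝ → W} {t : ℝ} {v : W} (hc : HasDerivAt c v t) (hw : c t ∈ θ.source) :
    velocity (θ ∘ c) t = θ.push (c t) v := by
  rw [velocity, mfderiv_comp (I' := 𝓘(ℝ, W)) t
    ((θ.contMDiffAt_apply hw).mdifferentiableAt (by simp)) hc.differentiableAt.mdifferentiableAt,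
    mfderiv_eq_fderiv]
  change θ.push (c t) (fderiv ℝ c t 1) = _
  rw [hc.hasFDerivAt.fderiv]
  simp

/-- In the parametrization `θ` the geodesic equation reads `c'' + Γ_c(c', c') = 0`. -/
lemma geodesicDefect_comp {cov : (∀ x : M, TangentSpace 𝓘(ℝ, E) x) →
      (∀ x : M, TangentSpace 𝓘(ℝ, E) x →L[ℝ] TangentSpace 𝓘(ℝ, E) x)} {c v : ℝ → W} {t : ℝ}
    {a : W} (hcd : ∀ᶠ s in 𝓝 t, HasDerivAt c (v s) s) (hcd2 : HasDerivAt v a t)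
    (hw : c t ∈ θ.source) (hcov : θ.HasCoefficients cov Γ {c t}) :
    geodesicDefect cov (θ ∘ c) t (θ (c t)) (θ.push (c t) (v t)) =
      θ.push (c t) (a + Γ (c t) (v t) (v t)) := by
  set w := c t with hwt
  set x := θ w with hx
  set u := v t with hu
  set T : W → E := extChartAt 𝓘(ℝ, E) x ∘ θ with hT
  have hTw : ContDiffAt ℝ ∞ T w := by
    rw [← contMDiffAt_iff_contDiffAt]
    exact (contMDiffAt_extChartAt (x := x)).comp w (θ.contMDiffAt_apply hw)
  have hT' := (hTw.fderiv_right (m := ∞) (by simp)).differentiableAt (by simp)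
  set Y : W → W := θ.localField (coordField x (θ.push w u)) with hY
  have hYs : SmoothFieldAt 𝓘(ℝ, E) (coordField x (θ.push w u)) (θ w) :=
    FiberBundle.contMDiffAt_extend 𝓘(ℝ, E) E _
  have hYd : DifferentiableAt ℝ Y w := (contDiffAt_localField hw hYs).differentiableAt (by simp)
  have hsrc : ∀ᶠ z in 𝓝 w, z ∈ θ.source ∧ θ z ∈ (chartAt E x).source :=
    Filter.Eventually.and (θ.open_source.mem_nhds hw)
      ((θ.contMDiffAt_apply hw).continuousAt ((chartAt E x).open_source.mem_nhds
        (mem_chart_source E x)))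
  -- the field `coordField` is constant in the preferred chart
  have hTY : (fun z => fderiv ℝ T z (Y z)) =ᶠ[𝓝 w] fun _ => (θ.push w u : E) := by
    filter_upwards [hsrc] with z hz
    rw [hT, push_comp_mfderiv hz.1 hz.2, hY, push_localField hz.1]
    exact mfderiv_extChartAt_coordField x _ hz.2
  have hYw : Y w = u := by
    rw [hY, localField_apply]
    have : coordField x (θ.push w u) (θ w) = θ.push w u := FiberBundle.extend_apply_self _ _
    rw [this, pull_push hw]
  have hDY : fderiv ℝ T w (fderiv ℝ Y w u) = -fderiv ℝ (fderiv ℝ T) w u u := by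
    have e1 := (hT'.hasFDerivAt.clm_apply hYd.hasFDerivAt).unique
      ((hasFDerivAt_const _ _).congr_of_eventuallyEq hTY)
    have e2 : fderiv ℝ T w (fderiv ℝ Y w u) + fderiv ℝ (fderiv ℝ T) w u (Y w) = 0 :=
      DFunLike.congr_fun e1 u
    rw [hYw] at e2
    exact eq_neg_of_add_eq_zero_left e2
  -- the second derivative of `T ∘ c`
  have hTc : deriv (deriv (T ∘ c)) t = fderiv ℝ (fderiv ℝ T) w u u +
      fderiv ℝ T w a := by
    have e1 : deriv (T ∘ c) =ᶠ[𝓝 t] fun s => fderiv ℝ T (c s) (v s) := by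
      filter_upwards [hcd, hcd.self_of_nhds.continuousAt.eventually
        ((hTw.of_le (m := 1) (by simp)).eventually (by simp))] with s hs hTs
      exact ((hTs.differentiableAt (by simp)).hasFDerivAt.comp_hasDerivAt s hs).deriv
    rw [e1.deriv_eq]
    have e2 : HasDerivAt (fun s => fderiv ℝ T (c s)) (fderiv ℝ (fderiv ℝ T) w u) t :=
      HasFDerivAt.comp_hasDerivAt (f := c) t hT'.hasFDerivAt hcd.self_of_nhds
    exact (e2.clm_apply hcd2).deriv
  have e3 : (θ.push w (a + Γ w u u) : E) =
      fderiv ℝ T w (a + Γ w u u) := push_eq_fderiv hw _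
  have e4 : cov (coordField x (θ.push w u)) x (θ.push w u) =
      θ.push w (fderiv ℝ Y w u + Γ w (Y w) u) := hcov w rfl _ hYs u
  rw [geodesicDefect, e4, hYw]
  refine Eq.trans ?_ e3.symm
  have e5 : (θ.push w (fderiv ℝ Y w u + Γ w u u) : E) =
      fderiv ℝ T w (fderiv ℝ Y w u + Γ w u u) := push_eq_fderiv hw _
  have e6 : (deriv (deriv (T ∘ c)) t : E) + fderiv ℝ T w (fderiv ℝ Y w u + Γ w u u) =
    fderiv ℝ T w (a + Γ w u u) := by
    rw [hTc, map_add, map_add, hDY]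
    abel
  rw [← e5] at e6
  exact e6

end PartialDiffeomorph

end Geodesic

/-! ### Geodesics and the exponential map -/

section Exp

/-- Solutions of a smooth autonomous ordinary differential equation are smooth. -/
lemma contDiffOn_of_hasDerivAt {A : Type*} [NormedAddCommGroup A] [NormedSpace ℝ A]
    {f : A → A} {Ω : Set A} (hf : ContDiffOn ℝ ∞ f Ω) {z : ℝ → A} {s : Set ℝ} (hs : IsOpen s)
    (hz : ∀ t ∈ s, HasDerivAt z (f (z t)) t) (hΩ : MapsTo z s Ω) : ContDiffOn ℝ ∞ z s := by
  have h : ∀ n : ℕ, ContDiffOn ℝ n z s := by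
    intro n
    induction n with
    | zero => exact contDiffOn_zero.2 fun t ht => (hz t ht).continuousAt.continuousWithinAt
    | succ n ih =>
      have : ((n + 1 : ℕ) : WithTop ℕ∞) = (n : WithTop ℕ∞) + 1 := by push_cast; rfl
      rw [this, contDiffOn_succ_iff_deriv_of_isOpen hs]
      refine ⟨fun t ht => (hz t ht).differentiableAt.differentiableWithinAt, by simp, ?_⟩
      exact ((hf.of_le (by exact_mod_cast le_top)).comp ih hΩ).congr fun t ht => (hz t ht).deriv
  exact contDiffOn_infty.2 h

variable {W E M : Type*} [NormedAddCommGroup W] [NormedSpace ℝ W] [FiniteDimensional ℝ W]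
  [NormedAddCommGroup E] [NormedSpace ℝ E] [FiniteDimensional ℝ E]
  [TopologicalSpace M] [ChartedSpace E M] [IsManifold 𝓘(ℝ, E) ∞ M] [IsManifold 𝓘(ℝ, E) 1 M]
  {cov : (∀ x : M, TangentSpace 𝓘(ℝ, E) x) →
      (∀ x : M, TangentSpace 𝓘(ℝ, E) x →L[ℝ] TangentSpace 𝓘(ℝ, E) x)}
  {U : Set M} {θ : PartialDiffeomorph 𝓘(ℝ, W) 𝓘(ℝ, E) W M ∞} {Γ : W → W →L[ℝ] W →L[ℝ] W}

omit [FiniteDimensional ℝ E] [IsManifold 𝓘(ℝ, E) ∞ M] in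
lemma velocity_congr {γ γ' : ℝ → M} {t : ℝ} (h : γ =ᶠ[𝓝 t] γ') :
    (⟨γ t, velocity γ t⟩ : TangentBundle 𝓘(ℝ, E) M) = ⟨γ' t, velocity γ' t⟩ := by
  have h1 : (velocity γ t : E) = velocity γ' t := by
    have h3 : (mfderiv 𝓘(ℝ, ℝ) 𝓘(ℝ, E) γ t : ℝ →L[ℝ] E) = mfderiv 𝓘(ℝ, ℝ) 𝓘(ℝ, E) γ' t :=
      h.mfderiv_eq
    exact congrArg (fun T : ℝ →L[ℝ] E => T 1) h3
  have h2 : ∀ {x y : M} {a b : E}, x = y → a = b →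
      (⟨x, a⟩ : TangentBundle 𝓘(ℝ, E) M) = ⟨y, b⟩ := by
    rintro x y a b rfl rfl; rfl
  exact h2 h.self_of_nhds h1

lemma geodesicDefect_congr {γ γ' : ℝ → M} {t : ℝ} (h : γ =ᶠ[𝓝 t] γ') :
    geodesicDefect cov γ t (γ t) (velocity γ t) = 0 ↔
      geodesicDefect cov γ' t (γ' t) (velocity γ' t) = 0 := by
  have h1 : ∀ (x y : M) (a : TangentSpace 𝓘(ℝ, E) x) (b : TangentSpace 𝓘(ℝ, E) y),
      (⟨x, a⟩ : TangentBundle 𝓘(ℝ, E) M) = ⟨y, b⟩ →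
      (geodesicDefect cov γ t x a = 0 ↔ geodesicDefect cov γ' t y b = 0) := by
    intro x y a b hab
    cases hab
    have h2 : extChartAt 𝓘(ℝ, E) x ∘ γ =ᶠ[𝓝 t] extChartAt 𝓘(ℝ, E) x ∘ γ' := h.fun_comp _
    rw [geodesicDefect, geodesicDefect, h2.deriv.deriv_eq]
  exact h1 _ _ _ _ (velocity_congr h)

/-- A geodesic solves the geodesic equation in any parametrization. -/
lemma IsGeodesicOn.eventually_coord {γ : ℝ → M} {s : Set ℝ} (hγ : IsGeodesicOn cov U γ s)
    (hs : IsOpen s) (hΓ : θ.HasCoefficients cov Γ (θ.source ∩ θ ⁻¹' U)) {t : ℝ} (ht : t ∈ s)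
    (htθ : γ t ∈ θ.target) :
    ∀ᶠ r in 𝓝 t, θ (θ.symm (γ r)) = γ r ∧
      HasDerivAt (θ.symm ∘ γ) (deriv (θ.symm ∘ γ) r) r ∧
      HasDerivAt (deriv (θ.symm ∘ γ)) (-Γ (θ.symm (γ r)) (deriv (θ.symm ∘ γ) r)
        (deriv (θ.symm ∘ γ) r)) r := by
  set c := θ.symm ∘ γ with hc
  have hγc : ∀ r ∈ s, ContMDiffAt 𝓘(ℝ, ℝ) 𝓘(ℝ, E) ∞ γ r := fun r hr =>
    hγ.smooth.contMDiffAt (hs.mem_nhds hr)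
  have hcs : ∀ r ∈ s, γ r ∈ θ.target → ContDiffAt ℝ ∞ c r := fun r hr hrθ =>
    contMDiffAt_iff_contDiffAt.1 ((θ.contMDiffAt_symm_apply hrθ).comp r (hγc r hr))
  have hev : ∀ᶠ r in 𝓝 t, r ∈ s ∧ γ r ∈ θ.target :=
    Filter.Eventually.and (hs.mem_nhds ht)
      ((hγc t ht).continuousAt (θ.open_target.mem_nhds htθ))
  filter_upwards [hev.eventually_nhds] with r hr
  obtain ⟨hrs, hrθ⟩ := hr.self_of_nhds
  have hd1 : ∀ᶠ q in 𝓝 r, HasDerivAt c (deriv c q) q := by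
    filter_upwards [hr] with q hq
    exact ((hcs q hq.1 hq.2).differentiableAt (by simp)).hasDerivAt
  have hd2 : HasDerivAt (deriv c) (deriv (deriv c) r) r := by
    have h1 : ContDiffAt ℝ ∞ (fun q => fderiv ℝ c q 1) r :=
      ((hcs r hrs hrθ).fderiv_right (m := ∞) (by simp)).clm_apply contDiffAt_const
    exact (h1.differentiableAt (by simp)).hasDerivAt
  have hcsrc : c r ∈ θ.source := θ.map_target_apply hrθ
  have hθc : θ (c r) = γ r := θ.right_inv_apply hrθ
  have hgerm : γ =ᶠ[𝓝 r] θ ∘ c := by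
    filter_upwards [hr] with q hq using (θ.right_inv_apply hq.2).symm
  refine ⟨hθc, hd1.self_of_nhds, ?_⟩
  have e1 : geodesicDefect cov γ r (γ r) (velocity γ r) = 0 := hγ.equation r hrs
  rw [geodesicDefect_congr hgerm, PartialDiffeomorph.velocity_comp hd1.self_of_nhds hcsrc] at e1
  have e2 := PartialDiffeomorph.geodesicDefect_comp (Γ := Γ) (cov := cov) hd1 hd2 hcsrc (by
    rintro w rfl
    exact hΓ _ ⟨hcsrc, by rw [mem_preimage, hθc]; exact hγ.mapsTo hrs⟩)
  have e3 := e2.symm.trans e1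
  have e4 : deriv (deriv c) r + Γ (c r) (deriv c r) (deriv c r) = 0 :=
    PartialDiffeomorph.push_injective hcsrc (e3.trans (map_zero _).symm)
  rw [eq_neg_of_add_eq_zero_left e4] at hd2
  exact hd2

/-- Solutions of the geodesic equation in a parametrization are geodesics. -/
lemma isGeodesicOn_comp {c v : ℝ → W} {s : Set ℝ} (hs : IsOpen s)
    (hU : IsOpen (θ.source ∩ θ ⁻¹' U)) (hΓs : ContDiffOn ℝ ∞ Γ (θ.source ∩ θ ⁻¹' U))
    (hΓ : θ.HasCoefficients cov Γ (θ.source ∩ θ ⁻¹' U))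
    (h : ∀ t ∈ s, c t ∈ θ.source ∩ θ ⁻¹' U ∧ HasDerivAt c (v t) t ∧
        HasDerivAt v (-Γ (c t) (v t) (v t)) t) : IsGeodesicOn cov U (θ ∘ c) s where
  smooth := by
    have h1 : ContDiffOn ℝ ∞ (fun t => (c t, v t)) s :=
      contDiffOn_of_hasDerivAt (f := spray Γ) (Ω := (θ.source ∩ θ ⁻¹' U) ×ˢ univ)
        (fun p hp => (contDiffAt_spray (hΓs.contDiffAt (hU.mem_nhds hp.1))).contDiffWithinAt) hs
        (fun t ht => (h t ht).2.1.prodMk (h t ht).2.2) (fun t ht => ⟨(h t ht).1, mem_univ _⟩)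
    exact θ.contMDiffOn.comp (contMDiffOn_iff_contDiffOn.2 h1.fst) fun t ht => (h t ht).1.1
  mapsTo t ht := (h t ht).1.2
  equation t ht := by
    change geodesicDefect cov (θ ∘ c) t (θ (c t)) (velocity (θ ∘ c) t) = 0
    have hd : ∀ᶠ r in 𝓝 t, HasDerivAt c (v r) r := by
      filter_upwards [hs.mem_nhds ht] with r hr using (h r hr).2.1
    rw [PartialDiffeomorph.velocity_comp (h t ht).2.1 (h t ht).1.1,
      PartialDiffeomorph.geodesicDefect_comp (Γ := Γ) hd (h t ht).2.2 (h t ht).1.1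
        (by rintro w rfl; exact hΓ _ (h t ht).1), neg_add_cancel, map_zero]

end Exp

section ExpMap

variable {W E M : Type*} [NormedAddCommGroup W] [NormedSpace ℝ W] [FiniteDimensional ℝ W]
  [NormedAddCommGroup E] [NormedSpace ℝ E] [FiniteDimensional ℝ E]
  [TopologicalSpace M] [ChartedSpace E M] [IsManifold 𝓘(ℝ, E) ∞ M] [IsManifold 𝓘(ℝ, E) 1 M]
  {cov : (∀ x : M, TangentSpace 𝓘(ℝ, E) x) →
      (∀ x : M, TangentSpace 𝓘(ℝ, E) x →L[ℝ] TangentSpace 𝓘(ℝ, E) x)}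
  {U : Set M} {θ : PartialDiffeomorph 𝓘(ℝ, W) 𝓘(ℝ, E) W M ∞} {Γ : W → W →L[ℝ] W →L[ℝ] W}

lemma PartialDiffeomorph.isOpen_inter_preimage (hU : IsOpen U) : IsOpen (θ.source ∩ θ ⁻¹' U) :=
  θ.contMDiffOn.continuousOn.isOpen_inter_preimage θ.open_source hU

/-- The inverse of a chart, as a local parametrization. -/
def OpenPartialHomeomorph.param {e : OpenPartialHomeomorph M E}
    (he : e ∈ IsManifold.maximalAtlas 𝓘(ℝ, E) ∞ M) :
    PartialDiffeomorph 𝓘(ℝ, E) 𝓘(ℝ, E) E M ∞ where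
  toPartialEquiv := e.symm.toPartialEquiv
  open_source := e.open_target
  open_target := e.open_source
  contMDiffOn_toFun := contMDiffOn_symm_of_mem_maximalAtlas he
  contMDiffOn_invFun := contMDiffOn_of_mem_maximalAtlas he

/-- Geodesics with the same position and velocity at time `t` agree near `t`: in coordinates this is
uniqueness of solutions of ordinary differential equations. -/
lemma IsGeodesicOn.eventuallyEq {γ₁ γ₂ : ℝ → M} {s₁ s₂ : Set ℝ} {t : ℝ} (hU : IsOpen U)
    (hΓs : ContDiffOn ℝ ∞ Γ (θ.source ∩ θ ⁻¹' U))
    (hΓ : θ.HasCoefficients cov Γ (θ.source ∩ θ ⁻¹' U))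
    (h₁ : IsGeodesicOn cov U γ₁ s₁) (h₂ : IsGeodesicOn cov U γ₂ s₂) (hs₁ : IsOpen s₁)
    (hs₂ : IsOpen s₂) (ht₁ : t ∈ s₁) (ht₂ : t ∈ s₂) (htθ : γ₁ t ∈ θ.target)
    (hx : γ₁ t = γ₂ t) (hv : deriv (θ.symm ∘ γ₁) t = deriv (θ.symm ∘ γ₂) t) :
    γ₁ =ᶠ[𝓝 t] γ₂ := by
  have e₁ := h₁.eventually_coord hs₁ hΓ ht₁ htθ
  have e₂ := h₂.eventually_coord hs₂ hΓ ht₂ (hx ▸ htθ)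
  have hmem : θ.symm (γ₁ t) ∈ θ.source ∩ θ ⁻¹' U :=
    ⟨θ.map_target_apply htθ, by rw [mem_preimage, θ.right_inv_apply htθ]; exact h₁.mapsTo ht₁⟩
  have h3 : θ.symm ∘ γ₁ =ᶠ[𝓝 t] θ.symm ∘ γ₂ :=
    coordGeodesic_unique (Γ := Γ) (((hΓs.contDiffAt
      ((PartialDiffeomorph.isOpen_inter_preimage hU).mem_nhds hmem))).of_le (by simp))
      (e₁.mono fun r hr => hr.2) (e₂.mono fun r hr => hr.2) (congrArg θ.symm hx) hv
  filter_upwards [e₁, e₂, h3] with r hr₁ hr₂ hr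
  rw [← hr₁.1, ← hr₂.1]
  exact congrArg θ hr

variable [T2Space M]

/-- The end point of a geodesic is determined by its initial position and velocity. -/
lemma IsExp.unique (hU : IsOpen U) (hcov : IsCovariantDerivativeOn E cov U)
    (hsm : ContMDiffCovariantDerivativeOn E ∞ cov U) {x : M} {v : TangentSpace 𝓘(ℝ, E) x}
    {y y' : M} (h : IsExp cov U x v y) (h' : IsExp cov U x v y') : y = y' := by
  obtain ⟨γ₁, s₁, hs₁, hI₁, hγ₁, hv₁, rfl⟩ := h
  obtain ⟨γ₂, s₂, hs₂, hI₂, hγ₂, hv₂, rfl⟩ := h'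
  -- the set of times near which the geodesics agree is open, contains `0`, and is closed in
  -- `[0, 1]`, because positions and velocities depend continuously on time
  let A : Set ℝ := {t | γ₁ =ᶠ[𝓝 t] γ₂}
  have hA : IsOpen A := isOpen_iff_mem_nhds.2 fun t ht => ht.eventually_nhds
  have hc₁ : ∀ t ∈ s₁, ContMDiffAt 𝓘(ℝ, ℝ) 𝓘(ℝ, E) ∞ γ₁ t := fun t ht =>
    hγ₁.smooth.contMDiffAt (hs₁.mem_nhds ht)
  have hc₂ : ∀ t ∈ s₂, ContMDiffAt 𝓘(ℝ, ℝ) 𝓘(ℝ, E) ∞ γ₂ t := fun t ht =>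
    hγ₂.smooth.contMDiffAt (hs₂.mem_nhds ht)
  -- the velocities in a chart
  let θ : M → PartialDiffeomorph 𝓘(ℝ, E) 𝓘(ℝ, E) E M ∞ := fun z =>
    OpenPartialHomeomorph.param (IsManifold.chart_mem_maximalAtlas (I := 𝓘(ℝ, E)) (n := ∞) z)
  have hθ : ∀ z, z ∈ (θ z).target := fun z => mem_chart_source E z
  have key : ∀ t ∈ s₁, t ∈ s₂ → γ₁ t = γ₂ t →
      deriv ((θ (γ₁ t)).symm ∘ γ₁) t = deriv ((θ (γ₁ t)).symm ∘ γ₂) t → t ∈ A := by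
    intro t ht₁ ht₂ hx hv
    obtain ⟨Γ, hΓs, hΓ⟩ :=
      PartialDiffeomorph.exists_hasCoefficients (θ := θ (γ₁ t)) hU hcov hsm
    exact hγ₁.eventuallyEq hU hΓs hΓ hγ₂ hs₁ hs₂ ht₁ ht₂ (hθ _) hx hv
  have h0 : (0 : ℝ) ∈ A := by
    have e : (⟨γ₁ 0, velocity γ₁ 0⟩ : TangentBundle 𝓘(ℝ, E) M) = ⟨γ₂ 0, velocity γ₂ 0⟩ :=
      hv₁.trans hv₂.symm
    have hm₁ : (0 : ℝ) ∈ s₁ := hI₁ ⟨le_rfl, zero_le_one⟩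
    have hm₂ : (0 : ℝ) ∈ s₂ := hI₂ ⟨le_rfl, zero_le_one⟩
    have hx : γ₁ 0 = γ₂ 0 := congrArg TotalSpace.proj e
    refine key 0 hm₁ hm₂ hx ?_
    have hd : ∀ (γ : ℝ → M), ContMDiffAt 𝓘(ℝ, ℝ) 𝓘(ℝ, E) ∞ γ 0 → γ 0 ∈ (θ (γ₁ 0)).target →
        deriv ((θ (γ₁ 0)).symm ∘ γ) 0 =
          (mfderiv 𝓘(ℝ, E) 𝓘(ℝ, E) (θ (γ₁ 0)).symm (γ 0) (velocity γ 0) : E) := by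
      intro γ hγ hm
      have e1 := mfderiv_comp (0 : ℝ) (((θ (γ₁ 0)).contMDiffAt_symm_apply hm).mdifferentiableAt
        (by simp)) (hγ.mdifferentiableAt (by simp))
      rw [mfderiv_eq_fderiv] at e1
      rw [← fderiv_apply_one_eq_deriv]
      exact DFunLike.congr_fun e1 (1 : ℝ)
    rw [hd γ₁ (hc₁ 0 hm₁) (hθ _), hd γ₂ (hc₂ 0 hm₂) (hx ▸ hθ _)]
    -- the initial positions are equal only propositionally, so the velocities are compared in the
    -- tangent bundle
    have h5 : ∀ (x y : M) (a : TangentSpace 𝓘(ℝ, E) x) (b : TangentSpace 𝓘(ℝ, E) y),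
      (⟨x, a⟩ : TangentBundle 𝓘(ℝ, E) M) = ⟨y, b⟩ →
      (mfderiv 𝓘(ℝ, E) 𝓘(ℝ, E) (θ (γ₁ 0)).symm x a : E) =
        mfderiv 𝓘(ℝ, E) 𝓘(ℝ, E) (θ (γ₁ 0)).symm y b := by
      intro x y a b hab
      cases hab
      rfl
    exact h5 _ _ _ _ e
  -- at a limit of such times the positions and the velocities agree
  have hcl : closure A ∩ Icc 0 1 ⊆ A := by
    rintro t ⟨htA, htI⟩
    have hm₁ := hI₁ htI
    have hm₂ := hI₂ htI
    have : (𝓝[A] t).NeBot := mem_closure_iff_nhdsWithin_neBot.1 htA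
    have hx : γ₁ t = γ₂ t := by
      refine tendsto_nhds_unique (l := 𝓝[A] t)
        ((hc₁ t hm₁).continuousAt.tendsto.mono_left nhdsWithin_le_nhds)
        (((hc₂ t hm₂).continuousAt.tendsto.mono_left nhdsWithin_le_nhds).congr' ?_)
      filter_upwards [self_mem_nhdsWithin] with r hr using hr.self_of_nhds.symm
    refine key t hm₁ hm₂ hx ?_
    have hd : ∀ (γ : ℝ → M), ContMDiffAt 𝓘(ℝ, ℝ) 𝓘(ℝ, E) ∞ γ t → γ t ∈ (θ (γ₁ t)).target →
        ContinuousAt (deriv ((θ (γ₁ t)).symm ∘ γ)) t := by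
      intro γ hγ hm
      have e1 : ContDiffAt ℝ ∞ ((θ (γ₁ t)).symm ∘ γ) t := contMDiffAt_iff_contDiffAt.1
        (((θ (γ₁ t)).contMDiffAt_symm_apply hm).comp t hγ)
      have e2 : ContDiffAt ℝ ∞ (fun q => fderiv ℝ ((θ (γ₁ t)).symm ∘ γ) q 1) t :=
        (e1.fderiv_right (m := ∞) (by simp)).clm_apply contDiffAt_const
      exact e2.continuousAt
    refine tendsto_nhds_unique (l := 𝓝[A] t)
      ((hd γ₁ (hc₁ t hm₁) (hθ _)).tendsto.mono_left nhdsWithin_le_nhds)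
      (((hd γ₂ (hc₂ t hm₂) (hx ▸ hθ _)).tendsto.mono_left nhdsWithin_le_nhds).congr' ?_)
    filter_upwards [self_mem_nhdsWithin] with r hr
    exact ((Filter.EventuallyEq.fun_comp hr (θ (γ₁ t)).symm).deriv_eq).symm
  have hsub : Icc (0 : ℝ) 1 ⊆ A :=
    isPreconnected_Icc.subset_of_closure_inter_subset hA ⟨0, ⟨le_rfl, zero_le_one⟩, h0⟩ hcl
  exact (hsub ⟨zero_le_one, le_rfl⟩).self_of_nhds

lemma IsExp.expMap_eq (hU : IsOpen U) (hcov : IsCovariantDerivativeOn E cov U)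
    (hsm : ContMDiffCovariantDerivativeOn E ∞ cov U) {x : M} {v : TangentSpace 𝓘(ℝ, E) x}
    {y : M} (h : IsExp cov U x v y) : expMap cov U x v = y := by
  rw [expMap, dif_pos ⟨y, h⟩]
  exact IsExp.unique hU hcov hsm (Exists.choose_spec (⟨y, h⟩ : ∃ y, IsExp cov U x v y)) h

/-- In a parametrization the exponential map is smooth near the zero vectors, and its differential
at a zero vector is the identity in the directions of the fibre. -/
theorem exists_local_exp (hU : IsOpen U) (hcov : IsCovariantDerivativeOn E cov U)
    (hsm : ContMDiffCovariantDerivativeOn E ∞ cov U) {w₀ : W} (hw₀ : w₀ ∈ θ.source ∩ θ ⁻¹' U) :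
    ∃ (N : Set (W × W)) (e : W × W → W), IsOpen N ∧ (w₀, 0) ∈ N ∧ ContDiffOn ℝ ∞ e N ∧
      (∀ p ∈ N, p.1 ∈ θ.source ∧ e p ∈ θ.source ∧
        IsExp cov U (θ p.1) (θ.push p.1 p.2) (θ (e p))) ∧
      ∀ w, (w, (0 : W)) ∈ N → e (w, 0) = w ∧ ∀ v, fderiv ℝ e (w, 0) (0, v) = v := by
  obtain ⟨Γ, hΓs, hΓ⟩ := PartialDiffeomorph.exists_hasCoefficients (θ := θ) hU hcov hsm
  have hΩ := PartialDiffeomorph.isOpen_inter_preimage (θ := θ) hU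
  obtain ⟨N, hN, hN0, c, u, h0, hode, hsmooth⟩ := exists_smooth_coordGeodesic hΩ hΓs hw₀
  -- the geodesics with rescaled time
  have hexp : ∀ p ∈ N, ∀ τ ∈ Ioo (-1 : ℝ) 2,
      IsExp cov U (θ p.1) (θ.push p.1 (τ • p.2)) (θ (c p τ)) := by
    intro p hp τ hτ
    have h00 : (0 : ℝ) ∈ Ioo (-1 : ℝ) 2 := ⟨by norm_num, by norm_num⟩
    have hc0 := (h0 p hp).1
    let s : Set ℝ := (fun t => τ * t) ⁻¹' Ioo (-1) 2
    have hs : IsOpen s := isOpen_Ioo.preimage (by fun_prop)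
    have hI : Icc (0 : ℝ) 1 ⊆ s := by
      rintro t ⟨ht0, ht1⟩
      obtain ⟨hτ1, hτ2⟩ := hτ
      constructor
      · change -1 < τ * t
        nlinarith
      · change τ * t < 2
        nlinarith
    have hd : ∀ t ∈ s, c p (τ * t) ∈ θ.source ∩ θ ⁻¹' U ∧
        HasDerivAt (fun t => c p (τ * t)) (τ • u p (τ * t)) t ∧
        HasDerivAt (fun t => τ • u p (τ * t)) (-Γ (c p (τ * t)) (τ • u p (τ * t))
          (τ • u p (τ * t))) t := by
      intro t ht
      obtain ⟨e1, e2, e3⟩ := hode p hp (τ * t) ht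
      have hm : HasDerivAt (fun t : ℝ => τ * t) τ t := by
        simpa using (hasDerivAt_id t).const_mul τ
      refine ⟨e1, HasDerivAt.scomp t e2 hm, ?_⟩
      have e4 := (HasDerivAt.scomp t e3 hm).const_smul τ
      convert! e4 using 1
      simp [smul_smul]
    refine ⟨θ ∘ fun t => c p (τ * t), s, hs, hI, isGeodesicOn_comp hs hΩ hΓs hΓ hd, ?_, ?_⟩
    · have e1 := hd 0 (hI ⟨le_rfl, zero_le_one⟩)
      rw [PartialDiffeomorph.velocity_comp (c := fun t => c p (τ * t)) e1.2.1 e1.1.1]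
      have e2 : c p (τ * 0) = p.1 := by rw [mul_zero, hc0]
      have e3 : u p (τ * 0) = p.2 := by rw [mul_zero, (h0 p hp).2]
      change (⟨θ (c p (τ * 0)), θ.push (c p (τ * 0)) (τ • u p (τ * 0))⟩ :
        TangentBundle 𝓘(ℝ, E) M) = _
      rw [e2, e3]
    · change θ (c p (τ * 1)) = _
      rw [mul_one]
  have h1m : (1 : ℝ) ∈ Ioo (-1 : ℝ) 2 := ⟨by norm_num, by norm_num⟩
  have hsrc : ∀ p ∈ N, p.1 ∈ θ.source ∧ c p 1 ∈ θ.source := by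
    intro p hp
    refine ⟨?_, (hode p hp 1 h1m).1.1⟩
    rw [← (h0 p hp).1]
    exact (hode p hp 0 ⟨by norm_num, by norm_num⟩).1.1
  -- `exp(τ v) = γ_v(τ)`
  have hhom : ∀ p ∈ N, ∀ τ ∈ Ioo (-1 : ℝ) 2, (p.1, τ • p.2) ∈ N →
      c (p.1, τ • p.2) 1 = c p τ := by
    intro p hp τ hτ hq
    have e1 := hexp _ hq 1 h1m
    rw [one_smul] at e1
    have e2 := IsExp.unique hU hcov hsm e1 (hexp p hp τ hτ)
    exact θ.toPartialEquiv.injOn (hsrc _ hq).2 (hode p hp τ hτ).1.1 e2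
  have hcw : ∀ w, (w, (0 : W)) ∈ N → c (w, 0) 1 = w := by
    intro w hw
    have := hhom (w, 0) hw 0 ⟨by norm_num, by norm_num⟩ (by simpa using hw)
    simp only [smul_zero] at this
    rw [this, (h0 _ hw).1]
  refine ⟨N, fun p => c p 1, hN, hN0, hsmooth, fun p hp => ⟨(hsrc p hp).1, (hsrc p hp).2, ?_⟩,
    fun w hw => ⟨hcw w hw, fun v => ?_⟩⟩
  · have := hexp p hp 1 h1m
    rwa [one_smul] at this
  · have hev : ∀ᶠ τ : ℝ in 𝓝 0, (w, τ • v) ∈ N := by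
      have hcont : ContinuousAt (fun τ : ℝ => (w, τ • v)) 0 := by fun_prop
      exact hcont (by simpa using hN.mem_nhds hw)
    -- `(w, v)` need not lie in `N`: replace `v` by a small multiple and use linearity of the
    -- differential; along that ray the exponential map is a geodesic, with known initial velocity
    obtain ⟨τ₀, hτ₀N, hτ₀⟩ : ∃ τ₀ : ℝ, (w, τ₀ • v) ∈ N ∧ τ₀ ≠ 0 := by
      have := (hev.filter_mono nhdsWithin_le_nhds : ∀ᶠ τ : ℝ in 𝓝[≠] 0, (w, τ • v) ∈ N)
      obtain ⟨τ₀, h1, h2⟩ := (this.and self_mem_nhdsWithin).exists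
      exact ⟨τ₀, h1, h2⟩
    have hlin : HasDerivAt (fun τ : ℝ => (w, τ • (τ₀ • v))) ((0 : W), τ₀ • v) 0 := by
      have := (hasDerivAt_const (0 : ℝ) w).prodMk ((hasDerivAt_id (0 : ℝ)).smul_const (τ₀ • v))
      simpa using this
    have hde : HasFDerivAt (fun p => c p 1) (fderiv ℝ (fun p => c p 1) (w, 0))
        ((fun τ : ℝ => (w, τ • (τ₀ • v))) 0) := by
      have := ((hsmooth.contDiffAt (hN.mem_nhds hw)).differentiableAt (by simp)).hasFDerivAt
      simpa using this
    have e1 := hde.comp_hasDerivAt (0 : ℝ) hlin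
    have e2 : HasDerivAt (c (w, τ₀ • v)) (τ₀ • v) 0 := by
      have := (hode _ hτ₀N 0 ⟨by norm_num, by norm_num⟩).2.1
      rwa [(h0 _ hτ₀N).2] at this
    have e3 : (fun p => c p 1) ∘ (fun τ : ℝ => (w, τ • (τ₀ • v))) =ᶠ[𝓝 0] c (w, τ₀ • v) := by
      have h5 : ∀ᶠ τ : ℝ in 𝓝 0, (w, τ • (τ₀ • v)) ∈ N :=
        hlin.continuousAt (by simpa using hN.mem_nhds hw)
      filter_upwards [h5, Ioo_mem_nhds (show (-1 : ℝ) < 0 by norm_num)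
        (show (0 : ℝ) < 2 by norm_num)] with τ hτ hτI
      exact hhom _ hτ₀N τ hτI hτ
    have e4 := e1.unique (e2.congr_of_eventuallyEq e3)
    have e5 : ((0 : W), τ₀ • v) = τ₀ • ((0 : W), v) := by simp
    rw [e5, map_smul] at e4
    exact smul_right_injective W hτ₀ e4

end ExpMap

/-! ### Slice coordinates of `M` and bundle coordinates of the normal bundle -/

/-- The restriction of a partial diffeomorphism to an open set. -/
def PartialDiffeomorph.restrOpen {V H X V' H' X' : Type*}
    [NormedAddCommGroup V] [NormedSpace ℝ V] [TopologicalSpace H]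
    {I : ModelWithCorners ℝ V H} [TopologicalSpace X] [ChartedSpace H X]
    [NormedAddCommGroup V'] [NormedSpace ℝ V'] [TopologicalSpace H']
    {I' : ModelWithCorners ℝ V' H'} [TopologicalSpace X'] [ChartedSpace H' X']
    (θ : PartialDiffeomorph I' I X' X ∞) (s : Set X') (hs : IsOpen s) :
    PartialDiffeomorph I' I X' X ∞ where
  __ := θ.toOpenPartialHomeomorph.restrOpen s hs
  contMDiffOn_toFun := θ.contMDiffOn_toFun.mono inter_subset_left
  contMDiffOn_invFun := θ.contMDiffOn_invFun.mono inter_subset_left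

namespace EmbeddedSubmanifold

variable {E₁ F L E M : Type*}
    [NormedAddCommGroup E₁] [NormedSpace ℝ E₁] [NormedAddCommGroup F] [NormedSpace ℝ F]
    [NormedAddCommGroup E] [NormedSpace ℝ E]
    [TopologicalSpace L] [ChartedSpace E₁ L] [IsManifold 𝓘(ℝ, E₁) ∞ L]
    [TopologicalSpace M] [ChartedSpace E M] [IsManifold 𝓘(ℝ, E) ∞ M]
    (S : EmbeddedSubmanifold E₁ F L E M)

/-- The slice chart of `L` at `p₀`, as a local parametrization. -/
def baseParam (p₀ : L) : PartialDiffeomorph 𝓘(ℝ, E₁) 𝓘(ℝ, E₁) E₁ L ∞ :=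
  OpenPartialHomeomorph.param (S.domChart_mem p₀)

/-- The slice chart of `M` at `p₀`, as a local parametrization by `E₁ × F`. -/
def sliceParamAux (p₀ : L) : PartialDiffeomorph 𝓘(ℝ, E₁ × F) 𝓘(ℝ, E) (E₁ × F) M ∞ :=
  (S.sliceEquiv p₀).toDiffeomorph.toPartialDiffeomorph.trans
    (OpenPartialHomeomorph.param (S.codChart_mem p₀))

/-- An open subset of `M` that meets `L` in the domain of the slice chart of `L`. -/
def sliceNhd (p₀ : L) : Set M :=
  (S.isEmbedding.isInducing.isOpen_iff.1 (S.domChart p₀).open_source).choose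

lemma isOpen_sliceNhd (p₀ : L) : IsOpen (S.sliceNhd p₀) :=
  (S.isEmbedding.isInducing.isOpen_iff.1 (S.domChart p₀).open_source).choose_spec.1

lemma mem_sliceNhd {p₀ p : L} : S.incl p ∈ S.sliceNhd p₀ ↔ p ∈ (S.domChart p₀).source := by
  have h := (S.isEmbedding.isInducing.isOpen_iff.1 (S.domChart p₀).open_source).choose_spec.2
  rw [← h]
  rfl

/-- The slice chart of `M` at `p₀`, as a local parametrization by `E₁ × F`, restricted so that
its image meets `L` in the image of the slice `F = 0` only. -/
def sliceParam (p₀ : L) : PartialDiffeomorph 𝓘(ℝ, E₁ × F) 𝓘(ℝ, E) (E₁ × F) M ∞ :=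
  (S.sliceParamAux p₀).restrOpen (((S.sliceParamAux p₀).source ∩
      S.sliceParamAux p₀ ⁻¹' S.sliceNhd p₀) ∩ Prod.fst ⁻¹' (S.domChart p₀).target)
    (((S.sliceParamAux p₀).contMDiffOn.continuousOn.isOpen_inter_preimage
      (S.sliceParamAux p₀).open_source (S.isOpen_sliceNhd p₀)).inter
      ((S.domChart p₀).open_target.preimage continuous_fst))

/-- The local trivialization of the normal bundle at `p₀`, as a local parametrization. -/
def bundleParam (p₀ : L) : PartialDiffeomorph 𝓘(ℝ, E₁ × F) (𝓘(ℝ, E₁).prod 𝓘(ℝ, F)) (E₁ × F)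
    (TotalSpace F S.Normal) ∞ where
  toFun z := ⟨(S.domChart p₀).symm z.1,
    S.proj _ (S.normalLift p₀ ((S.domChart p₀).symm z.1) z.2)⟩
  invFun a := (S.domChart p₀ a.proj, S.normalCoordQ p₀ a.proj a.2)
  source := (S.domChart p₀).target ×ˢ univ
  target := π F S.Normal ⁻¹' (S.domChart p₀).source
  map_source' z hz := (S.domChart p₀).map_target hz.1
  map_target' a ha := ⟨(S.domChart p₀).map_source ha, mem_univ _⟩
  left_inv' z hz := by
    refine Prod.ext ((S.domChart p₀).right_inv hz.1) ?_
    exact S.normalCoordQ_lift p₀ ((S.domChart p₀).map_target hz.1) z.2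
  right_inv' a ha := by
    have h : (S.domChart p₀).symm (S.domChart p₀ a.proj) = a.proj := (S.domChart p₀).left_inv ha
    dsimp only
    rw [h]
    exact (S.pretriv p₀).left_inv' ha
  open_source := (S.domChart p₀).open_target.prod isOpen_univ
  open_target := (S.domChart p₀).open_source.preimage (FiberBundle.continuous_proj F S.Normal)
  contMDiffOn_toFun := by
    have h1 : ContMDiffOn 𝓘(ℝ, E₁ × F) (𝓘(ℝ, E₁).prod 𝓘(ℝ, F)) ∞
        (fun z : E₁ × F => ((S.domChart p₀).symm z.1, z.2)) ((S.domChart p₀).target ×ˢ univ) :=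
      ((contMDiffOn_symm_of_mem_maximalAtlas (S.domChart_mem p₀)).comp
        contDiff_fst.contMDiff.contMDiffOn (fun z hz => hz.1)).prodMk
        contDiff_snd.contMDiff.contMDiffOn
    exact (Trivialization.contMDiffOn_symm (n := ∞) (IB := 𝓘(ℝ, E₁))
      (trivializationAt F S.Normal p₀)).comp h1
      (fun z hz => ⟨(S.domChart p₀).map_target hz.1, mem_univ _⟩)
  contMDiffOn_invFun := by
    have h1 := Trivialization.contMDiffOn (n := ∞) (IB := 𝓘(ℝ, E₁))
      (trivializationAt F S.Normal p₀)
    rw [modelWithCornersSelf_prod, ← chartedSpaceSelf_prod]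
    refine ContMDiffOn.prodMk ?_ (contMDiff_snd.comp_contMDiffOn h1)
    exact (contMDiffOn_of_mem_maximalAtlas (S.domChart_mem p₀)).comp
      ((contMDiff_fst.comp_contMDiffOn h1)) (fun a ha => ha)

variable {p₀ p : L} {u : E₁}

lemma mem_sliceParam_source {z : E₁ × F} : z ∈ (S.sliceParam p₀).source ↔
    S.sliceEquiv p₀ z ∈ (S.codChart p₀).target ∧ S.sliceParam p₀ z ∈ S.sliceNhd p₀ ∧
      z.1 ∈ (S.domChart p₀).target := by
  have h : z ∈ (S.sliceParamAux p₀).source ↔ S.sliceEquiv p₀ z ∈ (S.codChart p₀).target :=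
    ⟨fun h => h.2, fun h => ⟨mem_univ _, h⟩⟩
  change z ∈ (S.sliceParamAux p₀).source ∩ (((S.sliceParamAux p₀).source ∩
      S.sliceParamAux p₀ ⁻¹' S.sliceNhd p₀) ∩ Prod.fst ⁻¹' (S.domChart p₀).target) ↔ _
  constructor
  · rintro ⟨h1, ⟨h2, h3⟩, h4⟩
    exact ⟨h.1 h1, h3, h4⟩
  · rintro ⟨h1, h3, h4⟩
    exact ⟨h.2 h1, ⟨h.2 h1, h3⟩, h4⟩

lemma sliceParam_symm_incl (hp : p ∈ (S.domChart p₀).source) :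
    (S.sliceParam p₀).symm (S.incl p) = (S.domChart p₀ p, 0) := by
  change (S.sliceEquiv p₀).symm (S.codChart p₀ (S.incl p)) = _
  rw [S.codChart_incl p₀ hp, ContinuousLinearEquiv.symm_apply_apply]

/-- In slice coordinates `L` is given by `u ↦ (u, 0)`. -/
lemma sliceParam_zero (hu : u ∈ (S.domChart p₀).target) :
    S.sliceParam p₀ (u, 0) = S.incl ((S.domChart p₀).symm u) := by
  have hp := (S.domChart p₀).map_target hu
  have h := S.codChart_incl p₀ hp
  rw [(S.domChart p₀).right_inv hu] at h
  change (S.codChart p₀).symm (S.sliceEquiv p₀ (u, 0)) = _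
  rw [← h, (S.codChart p₀).left_inv (S.mapsTo_source p₀ hp)]

lemma zero_mem_sliceParam_source (hu : u ∈ (S.domChart p₀).target) :
    (u, 0) ∈ (S.sliceParam p₀).source := by
  have hp := (S.domChart p₀).map_target hu
  refine S.mem_sliceParam_source.2 ⟨?_, ?_, hu⟩
  · have h := S.codChart_incl p₀ hp
    rw [(S.domChart p₀).right_inv hu] at h
    rw [← h]
    exact (S.codChart p₀).map_source (S.mapsTo_source p₀ hp)
  · rw [S.sliceParam_zero hu, S.mem_sliceNhd]
    exact hp

lemma incl_mem_sliceParam_target : S.incl p ∈ (S.sliceParam p₀).target ↔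
    p ∈ (S.domChart p₀).source := by
  constructor
  · intro h
    have h1 := (S.mem_sliceParam_source.1 ((S.sliceParam p₀).map_target_apply h)).2.1
    rw [(S.sliceParam p₀).right_inv_apply h] at h1
    exact S.mem_sliceNhd.1 h1
  · intro hp
    have hu := (S.domChart p₀).map_source hp
    have h := (S.sliceParam p₀).map_source_apply (S.zero_mem_sliceParam_source hu)
    rwa [S.sliceParam_zero hu, (S.domChart p₀).left_inv hp] at h

/-- The components of a tangent vector of `M` at a point of `L` in the slice chart at `p₀`. -/
def sliceCoord (p₀ p : L) : TangentSpace 𝓘(ℝ, E) (S.incl p) →L[ℝ] E₁ × F :=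
  (S.sliceEquiv p₀).symm.toContinuousLinearMap.comp (S.codDeriv p₀ (S.incl p))

lemma mfderiv_sliceParam_symm (hp : p ∈ (S.domChart p₀).source) :
    mfderiv 𝓘(ℝ, E) 𝓘(ℝ, E₁ × F) (S.sliceParam p₀).symm (S.incl p) = S.sliceCoord p₀ p := by
  have h1 := IsManifold.maximalAtlas_subset_of_le (I := 𝓘(ℝ, E)) (M := M)
    (show (1 : WithTop ℕ∞) ≤ ∞ by simp) (S.codChart_mem p₀)
  have hc := mdifferentiableAt_of_mem_maximalAtlas h1 (S.mapsTo_source p₀ hp)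
  have h := mfderiv_comp (I := 𝓘(ℝ, E)) (I' := 𝓘(ℝ, E)) (I'' := 𝓘(ℝ, E₁ × F)) (S.incl p)
    ((S.sliceEquiv p₀).symm.differentiableAt.mdifferentiableAt) hc
  rw [mfderiv_eq_fderiv, ContinuousLinearEquiv.fderiv] at h
  exact h

/-- A tangent vector of `M` at a point of `L` is recovered from its components. -/
lemma push_sliceCoord (hp : p ∈ (S.domChart p₀).source)
    (v : TangentSpace 𝓘(ℝ, E) (S.incl p)) :
    (⟨S.sliceParam p₀ (S.domChart p₀ p, 0),
      (S.sliceParam p₀).push (S.domChart p₀ p, 0) (S.sliceCoord p₀ p v)⟩ :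
        TangentBundle 𝓘(ℝ, E) M) = ⟨S.incl p, v⟩ := by
  have hw := S.zero_mem_sliceParam_source ((S.domChart p₀).map_source hp)
  have hx : S.sliceParam p₀ (S.domChart p₀ p, 0) = S.incl p := by
    rw [S.sliceParam_zero ((S.domChart p₀).map_source hp), (S.domChart p₀).left_inv hp]
  rw [← S.mfderiv_sliceParam_symm hp]
  generalize S.incl p = x at *
  subst hx
  have e := (S.sliceParam p₀).inverse_mfderiv hw
  have e1 := (S.sliceParam p₀).push_pull hw v
  refine congrArg (TotalSpace.mk _) ?_
  refine Eq.trans ?_ e1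
  rw [PartialDiffeomorph.pull, e]

/-- Along `L` the components of a vector field in the slice parametrization are given by
`sliceCoord`. -/
lemma localField_sliceParam (hp : p ∈ (S.domChart p₀).source)
    (Y : ∀ x : M, TangentSpace 𝓘(ℝ, E) x) :
    (S.sliceParam p₀).localField Y (S.domChart p₀ p, 0) = S.sliceCoord p₀ p (Y (S.incl p)) := by
  have hw := S.zero_mem_sliceParam_source ((S.domChart p₀).map_source hp)
  have hx : S.sliceParam p₀ (S.domChart p₀ p, 0) = S.incl p := by
    rw [S.sliceParam_zero ((S.domChart p₀).map_source hp), (S.domChart p₀).left_inv hp]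
  rw [← S.mfderiv_sliceParam_symm hp]
  generalize S.incl p = x at *
  subst hx
  have e := (S.sliceParam p₀).inverse_mfderiv hw
  rw [PartialDiffeomorph.localField_apply, PartialDiffeomorph.pull, e]

lemma sliceCoord_injective (hp : p ∈ (S.domChart p₀).source) :
    Function.Injective (S.sliceCoord p₀ p) :=
  (S.sliceEquiv p₀).symm.injective.comp (S.codDeriv_bijective p₀ (S.mapsTo_source p₀ hp)).1

lemma sliceCoord_snd (v : TangentSpace 𝓘(ℝ, E) (S.incl p)) :
    (S.sliceCoord p₀ p v).2 = S.normalCoord p₀ p v := rfl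

lemma mem_tangent_iff (hp : p ∈ (S.domChart p₀).source)
    (v : TangentSpace 𝓘(ℝ, E) (S.incl p)) : v ∈ S.tangent p ↔ (S.sliceCoord p₀ p v).2 = 0 := by
  rw [sliceCoord_snd, S.normalCoord_ker p₀ hp]

lemma sliceCoord_dincl (hp : p ∈ (S.domChart p₀).source) (w : TangentSpace 𝓘(ℝ, E₁) p) :
    S.sliceCoord p₀ p (S.dincl p w) = (S.domDeriv p₀ p w, 0) := by
  change (S.sliceEquiv p₀).symm (S.codDeriv p₀ (S.incl p) (S.dincl p w)) = _
  rw [S.codDeriv_dincl p₀ hp, ContinuousLinearEquiv.symm_apply_apply]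

lemma sliceCoord_normalLift (hp : p ∈ (S.domChart p₀).source) (f : F) :
    S.sliceCoord p₀ p (S.normalLift p₀ p f) = (0, f) := by
  change (S.sliceEquiv p₀).symm (S.codDeriv p₀ (S.incl p)
    (S.ofCoord p₀ (S.incl p) (S.sliceEquiv p₀ (0, f)))) = _
  rw [S.codDeriv_ofCoord p₀ (S.mapsTo_source p₀ hp), ContinuousLinearEquiv.symm_apply_apply]

lemma proj_eq_zero_iff {v : TangentSpace 𝓘(ℝ, E) (S.incl p)} :
    S.proj p v = 0 ↔ v ∈ S.tangent p :=
  Submodule.Quotient.mk_eq_zero _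

/-- The components of a vector field on `L` in the slice chart of `L` are given by `domDeriv`. -/
lemma localField_baseParam (hp : p ∈ (S.domChart p₀).source)
    (Y : ∀ x : L, TangentSpace 𝓘(ℝ, E₁) x) :
    (S.baseParam p₀).localField Y (S.domChart p₀ p) = S.domDeriv p₀ p (Y p) := by
  have hw : S.domChart p₀ p ∈ (S.baseParam p₀).source := (S.domChart p₀).map_source hp
  have hx : S.baseParam p₀ (S.domChart p₀ p) = p := (S.domChart p₀).left_inv hp
  have e := (S.baseParam p₀).inverse_mfderiv hw
  rw [PartialDiffeomorph.localField_apply, PartialDiffeomorph.pull, e]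
  have key : ∀ q, q = p → (mfderiv 𝓘(ℝ, E₁) 𝓘(ℝ, E₁) (S.domChart p₀) q (Y q) : E₁) =
      S.domDeriv p₀ p (Y p) := by
    rintro _ rfl
    rfl
  exact key _ hx

section Holomorphic

variable {J : ∀ x : M, TangentSpace 𝓘(ℝ, E) x →L[ℝ] TangentSpace 𝓘(ℝ, E) x} {S}

/-- Along `L` the matrix of `J` in slice coordinates is block upper triangular. -/
lemma IsPHSubmanifold.localEnd_snd (hL : S.IsPHSubmanifold J)
    (hu : u ∈ (S.domChart p₀).target) (x : E₁) :
    ((S.sliceParam p₀).localEnd J (u, 0) (x, 0)).2 = 0 := by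
  have hw := S.zero_mem_sliceParam_source hu
  obtain ⟨p, hp, rfl⟩ : ∃ p ∈ (S.domChart p₀).source, S.domChart p₀ p = u :=
    ⟨_, (S.domChart p₀).map_target hu, (S.domChart p₀).right_inv hu⟩
  let Y := (S.sliceParam p₀).ofLocalField fun _ => (x, 0)
  have h1 : (S.sliceParam p₀).localField Y (S.domChart p₀ p, 0) = (x, 0) :=
    PartialDiffeomorph.localField_ofLocalField hw _
  have h2 := PartialDiffeomorph.localField_end hw (J := J) (Y := Y)
  rw [h1, S.localField_sliceParam hp] at h2
  rw [← h2, ← S.mem_tangent_iff hp]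
  apply hL
  rw [S.mem_tangent_iff hp, ← S.localField_sliceParam hp, h1]

/-- Along `L` the diagonal block `E₁ → E₁` of the matrix of `J` in slice coordinates is the matrix
of `J` restricted to `L`. -/
lemma IsPHSubmanifold.localEnd_restrict [FiniteDimensional ℝ E₁] (hL : S.IsPHSubmanifold J)
    (hu : u ∈ (S.domChart p₀).target) (x : E₁) :
    (S.baseParam p₀).localEnd (S.restrict J) u x =
      ((S.sliceParam p₀).localEnd J (u, 0) (x, 0)).1 := by
  have hw := S.zero_mem_sliceParam_source hu
  have hu' : u ∈ (S.baseParam p₀).source := hu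
  obtain ⟨p, hp, rfl⟩ : ∃ p ∈ (S.domChart p₀).source, S.domChart p₀ p = u :=
    ⟨_, (S.domChart p₀).map_target hu, (S.domChart p₀).right_inv hu⟩
  let X := (S.baseParam p₀).ofLocalField fun _ => x
  have h0 : (S.baseParam p₀).localField X (S.domChart p₀ p) = x :=
    PartialDiffeomorph.localField_ofLocalField hu' _
  let Y := (S.sliceParam p₀).ofLocalField fun _ => (x, 0)
  have h1 : (S.sliceParam p₀).localField Y (S.domChart p₀ p, 0) = (x, 0) :=
    PartialDiffeomorph.localField_ofLocalField hw _
  have h2 := PartialDiffeomorph.localField_end hw (J := J) (Y := Y)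
  have h3 := PartialDiffeomorph.localField_end hu' (J := S.restrict J) (Y := X)
  rw [h0, S.localField_baseParam hp] at h3
  rw [h1, S.localField_sliceParam hp] at h2
  have h4 : Y (S.incl p) = S.dincl p (X p) := by
    apply S.sliceCoord_injective hp
    rw [S.sliceCoord_dincl hp, ← S.localField_sliceParam hp, ← S.localField_baseParam hp, h0, h1]
  rw [← h2, ← h3, h4, ← S.dincl_restrict J hL, S.sliceCoord_dincl hp]

end Holomorphic

end EmbeddedSubmanifold

/-! ### The normal exponential map in coordinates -/

/-- The inverse function theorem, for a smooth map on an open set. -/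
lemma exists_partialDiffeomorph {W : Type*} [NormedAddCommGroup W] [NormedSpace ℝ W]
    [FiniteDimensional ℝ W] {Φ : W → W} {N : Set W} (hN : IsOpen N) (hΦ : ContDiffOn ℝ ∞ Φ N)
    (hinj : ∀ z ∈ N, Function.Injective (fderiv ℝ Φ z)) {z : W} (hz : z ∈ N) :
    ∃ θ : PartialDiffeomorph 𝓘(ℝ, W) 𝓘(ℝ, W) W W ∞, z ∈ θ.source ∧ θ.source ⊆ N ∧
      ∀ y, θ y = Φ y := by
  have hat : ∀ y ∈ N, ContDiffAt ℝ ∞ Φ y := fun y hy => hΦ.contDiffAt (hN.mem_nhds hy)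
  have hinv : ∀ y ∈ N, ∃ f' : W ≃L[ℝ] W, HasFDerivAt Φ (f' : W →L[ℝ] W) y := by
    intro y hy
    refine ⟨(LinearEquiv.ofInjectiveEndo (fderiv ℝ Φ y).toLinearMap
      (hinj y hy)).toContinuousLinearEquiv, ?_⟩
    convert! ((hat y hy).differentiableAt (by simp)).hasFDerivAt using 1
  obtain ⟨f', hf'⟩ := hinv z hz
  have h0 : (∞ : WithTop ℕ∞) ≠ 0 := by simp
  let e := ((hat z hz).toOpenPartialHomeomorph Φ hf' h0).restrOpen N hN
  have hsub : e.source ⊆ N := fun y hy => hy.2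
  refine ⟨⟨e.toPartialEquiv, e.open_source, e.open_target, ?_, ?_⟩, ?_, hsub, fun y => rfl⟩
  · exact contMDiffOn_iff_contDiffOn.2 (hΦ.mono hsub)
  · refine contMDiffOn_iff_contDiffOn.2 fun y hy => ?_
    have hy' : e.symm y ∈ N := hsub (e.map_target hy)
    obtain ⟨g', hg'⟩ := hinv _ hy'
    exact (e.contDiffAt_symm hy hg' (hat _ hy')).contDiffWithinAt
  · exact ⟨(hat z hz).mem_toOpenPartialHomeomorph_source hf' h0, hz⟩

namespace EmbeddedSubmanifold

variable {E₁ F L E M : Type*}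
    [NormedAddCommGroup E₁] [NormedSpace ℝ E₁] [NormedAddCommGroup F] [NormedSpace ℝ F]
    [NormedAddCommGroup E] [NormedSpace ℝ E]
    [TopologicalSpace L] [ChartedSpace E₁ L] [IsManifold 𝓘(ℝ, E₁) ∞ L]
    [TopologicalSpace M] [ChartedSpace E M] [IsManifold 𝓘(ℝ, E) ∞ M]
    {S : EmbeddedSubmanifold E₁ F L E M}
    {J : ∀ x : M, TangentSpace 𝓘(ℝ, E) x →L[ℝ] TangentSpace 𝓘(ℝ, E) x}
    {σ : ∀ p : L, S.Normal p →L[ℝ] TangentSpace 𝓘(ℝ, E) (S.incl p)}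

variable (S) in
/-- The identification of the normal bundle with a complement of `TL`, in coordinates. -/
def complementCoord (σ : ∀ p : L, S.Normal p →L[ℝ] TangentSpace 𝓘(ℝ, E) (S.incl p))
    (p₀ : L) (z : E₁ × F) : E₁ × F :=
  S.sliceCoord p₀ (S.bundleParam p₀ z).proj (σ _ (S.bundleParam p₀ z).2)

variable {p₀ : L} {VX HX X : Type*} [NormedAddCommGroup VX] [NormedSpace ℝ VX]
  [TopologicalSpace HX] {IX : ModelWithCorners ℝ VX HX} [TopologicalSpace X] [ChartedSpace HX X]

/-- The components in slice coordinates of a smooth family of tangent vectors of `M` at points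
of `L` are smooth. -/
lemma contMDiffAt_sliceCoord {b : X → L} {v : ∀ x, TangentSpace 𝓘(ℝ, E) (S.incl (b x))} {x₀ : X}
    (hv : ContMDiffAt IX 𝓘(ℝ, E).tangent ∞
      (fun x => (⟨S.incl (b x), v x⟩ : TangentBundle 𝓘(ℝ, E) M)) x₀)
    (hb : ContinuousAt b x₀) (hx₀ : b x₀ ∈ (S.domChart p₀).source) :
    ContMDiffAt IX 𝓘(ℝ, E₁ × F) ∞ (fun x => S.sliceCoord p₀ (b x) (v x)) x₀ := by
  have h2 := (S.sliceParam p₀).symm.contMDiffOn.contMDiffOn_tangentMapWithin (m := ∞) (by simp)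
    (S.sliceParam p₀).symm.open_source.uniqueMDiffOn
  have hmem : ∀ x, b x ∈ (S.domChart p₀).source → S.incl (b x) ∈ (S.sliceParam p₀).symm.source :=
    fun x hx => S.incl_mem_sliceParam_target.2 hx
  have h3 := (h2.contMDiffAt ((((S.sliceParam p₀).symm.open_source.preimage
    (FiberBundle.continuous_proj E (TangentSpace 𝓘(ℝ, E)))).mem_nhds (hmem x₀ hx₀)))).comp x₀ hv
  have h4 := (contMDiff_snd_tangentBundle_modelSpace (E₁ × F) 𝓘(ℝ, E₁ × F)
    (n := ∞)).contMDiffAt.comp x₀ h3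
  refine h4.congr_of_eventuallyEq ?_
  filter_upwards [hb ((S.domChart p₀).open_source.mem_nhds hx₀)] with x hx
  have e1 := mfderivWithin_of_isOpen (I := 𝓘(ℝ, E)) (I' := 𝓘(ℝ, E₁ × F))
    (f := (S.sliceParam p₀).symm) (S.sliceParam p₀).symm.open_source (hmem x hx)
  have e2 := S.mfderiv_sliceParam_symm (p₀ := p₀) (p := b x) hx
  change S.sliceCoord p₀ (b x) (v x) =
    mfderivWithin 𝓘(ℝ, E) 𝓘(ℝ, E₁ × F) (S.sliceParam p₀).symm (S.sliceParam p₀).symm.source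
      (S.incl (b x)) (v x)
  rw [e1, e2]
  rfl

/-- A family of tangent vectors of `M` at points of `L` with smooth components is smooth. -/
lemma contMDiffAt_of_sliceCoord {b : X → L} {v : ∀ x, TangentSpace 𝓘(ℝ, E) (S.incl (b x))}
    {x₀ : X} (hb : ContMDiffAt IX 𝓘(ℝ, E₁) ∞ b x₀) (hx₀ : b x₀ ∈ (S.domChart p₀).source)
    (hv : ContMDiffAt IX 𝓘(ℝ, E₁ × F) ∞ (fun x => S.sliceCoord p₀ (b x) (v x)) x₀) :
    ContMDiffAt IX 𝓘(ℝ, E).tangent ∞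
      (fun x => (⟨S.incl (b x), v x⟩ : TangentBundle 𝓘(ℝ, E) M)) x₀ := by
  have hw := fun x (hx : b x ∈ (S.domChart p₀).source) =>
    S.zero_mem_sliceParam_source ((S.domChart p₀).map_source hx)
  have h2 := (S.sliceParam p₀).contMDiffOn.contMDiffOn_tangentMapWithin (m := ∞) (by simp)
    (S.sliceParam p₀).open_source.uniqueMDiffOn
  have h1 : ContMDiffAt IX 𝓘(ℝ, E₁ × F).tangent ∞ (fun x =>
      (⟨(S.domChart p₀ (b x), 0), S.sliceCoord p₀ (b x) (v x)⟩ :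
        TangentBundle 𝓘(ℝ, E₁ × F) (E₁ × F))) x₀ := by
    refine contMDiffAt_totalSpace.2 ⟨?_, ?_⟩
    · have h3 := (contMDiffAt_of_mem_maximalAtlas (S.domChart_mem p₀) hx₀).comp x₀ hb
      have h4 : ContDiff ℝ ∞ fun u : E₁ => (u, (0 : F)) := by fun_prop
      exact h4.contMDiff.contMDiffAt.comp x₀ h3
    · refine hv.congr_of_eventuallyEq (Eventually.of_forall fun x => ?_)
      simp
  have h3 := (h2.contMDiffAt ((((S.sliceParam p₀).open_source.preimage
    (FiberBundle.continuous_proj (E₁ × F) (TangentSpace 𝓘(ℝ, E₁ × F)))).mem_nhds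
      (hw x₀ hx₀)))).comp x₀ h1
  refine h3.congr_of_eventuallyEq ?_
  filter_upwards [hb.continuousAt ((S.domChart p₀).open_source.mem_nhds hx₀)] with x hx
  have e1 := mfderivWithin_of_isOpen (I := 𝓘(ℝ, E₁ × F)) (I' := 𝓘(ℝ, E))
    (f := S.sliceParam p₀) (S.sliceParam p₀).open_source (hw x hx)
  refine (S.push_sliceCoord hx (v x)).symm.trans ?_
  change _ = (⟨_, mfderivWithin 𝓘(ℝ, E₁ × F) 𝓘(ℝ, E) (S.sliceParam p₀) (S.sliceParam p₀).source
      (S.domChart p₀ (b x), 0) (S.sliceCoord p₀ (b x) (v x))⟩ : TangentBundle 𝓘(ℝ, E) M)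
  rw [e1]
  rfl

lemma contDiffAt_complementCoord
    (hσ : ContMDiff (𝓘(ℝ, E₁).prod 𝓘(ℝ, F)) 𝓘(ℝ, E).tangent ∞
      (fun a : TotalSpace F S.Normal => (⟨S.incl a.proj, σ a.proj a.2⟩ : TangentBundle 𝓘(ℝ, E) M)))
    {z : E₁ × F} (hz : z.1 ∈ (S.domChart p₀).target) :
    ContDiffAt ℝ ∞ (S.complementCoord σ p₀) z := by
  have hz' : z ∈ (S.bundleParam p₀).source := ⟨hz, mem_univ _⟩
  have hs := (S.bundleParam p₀).contMDiffAt_apply hz'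
  exact contMDiffAt_iff_contDiffAt.1 (contMDiffAt_sliceCoord (b := fun z =>
    (S.bundleParam p₀ z).proj) ((hσ.contMDiffAt (x := S.bundleParam p₀ z)).comp z hs)
    ((FiberBundle.continuous_proj F S.Normal).continuousAt.comp hs.continuousAt)
    ((S.domChart p₀).map_target hz))

lemma complementCoord_snd (hσ : ∀ (p : L) (n : S.Normal p), S.proj p (σ p n) = n)
    {z : E₁ × F} (hz : z.1 ∈ (S.domChart p₀).target) : (S.complementCoord σ p₀ z).2 = z.2 := by
  have hp : (S.bundleParam p₀ z).proj ∈ (S.domChart p₀).source := (S.domChart p₀).map_target hz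
  change S.normalCoord p₀ _ _ = _
  rw [← S.normalCoordQ_proj p₀ hp, hσ]
  exact S.normalCoordQ_lift p₀ hp z.2

lemma complementCoord_zero (u : E₁) : S.complementCoord σ p₀ (u, 0) = 0 := by
  change S.sliceCoord p₀ _ (σ _ (S.proj _ (S.normalLift p₀ _ 0))) = 0
  rw [map_zero, map_zero, map_zero, map_zero]

/-- Equality of vectors at different points is expressed in the tangent bundle. -/
lemma isExp_congr {cov : (∀ x : M, TangentSpace 𝓘(ℝ, E) x) →
      (∀ x : M, TangentSpace 𝓘(ℝ, E) x →L[ℝ] TangentSpace 𝓘(ℝ, E) x)} {U : Set M}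
    {a b : TangentBundle 𝓘(ℝ, E) M} (h : a = b) {y : M} (hy : IsExp cov U a.proj a.2 y) :
    IsExp cov U b.proj b.2 y := h ▸ hy

variable [FiniteDimensional ℝ E₁] [FiniteDimensional ℝ F] [FiniteDimensional ℝ E] [T2Space M]

/-- Near the zero section the normal exponential map reads, in bundle coordinates of the normal
bundle and slice coordinates of `M`, as a local diffeomorphism `Φ` that fixes `(u, 0)` and whose
differential there has the form `(x, n) ↦ (x + α n, n)`. -/
lemma exists_normalExp_coord {cov : (∀ x : M, TangentSpace 𝓘(ℝ, E) x) →
      (∀ x : M, TangentSpace 𝓘(ℝ, E) x →L[ℝ] TangentSpace 𝓘(ℝ, E) x)} {U : Set M}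
    (hσ : S.IsInvariantComplement J σ) (hU : range S.incl ⊆ U)
    (hcov : IsMinimalConnectionOn J U cov) {u₀ : E₁} (hu₀ : u₀ ∈ (S.domChart p₀).target) :
    ∃ (N : Set (E₁ × F)) (Φ : E₁ × F → E₁ × F), IsOpen N ∧ (u₀, 0) ∈ N ∧ ContDiffOn ℝ ∞ Φ N ∧
      (∀ z ∈ N, z.1 ∈ (S.domChart p₀).target ∧ Φ z ∈ (S.sliceParam p₀).source ∧
        IsExp cov U (S.incl (S.bundleParam p₀ z).proj) (σ _ (S.bundleParam p₀ z).2)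
          (S.sliceParam p₀ (Φ z)) ∧ Function.Injective (fderiv ℝ Φ z)) ∧
      ∀ u, (u, 0) ∈ N → Φ (u, 0) = (u, 0) ∧ ∀ n, (fderiv ℝ Φ (u, 0) (0, n)).2 = n := by
  have hw₀ : (u₀, (0 : F)) ∈ (S.sliceParam p₀).source ∩ S.sliceParam p₀ ⁻¹' U :=
    ⟨S.zero_mem_sliceParam_source hu₀, by
      rw [mem_preimage, S.sliceParam_zero hu₀]; exact hU ⟨_, rfl⟩⟩
  obtain ⟨N₀, e, hN₀, h0, hes, he, he0⟩ := exists_local_exp hcov.isOpen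
    hcov.isCovariantDerivativeOn hcov.smooth hw₀
  -- `Φ` is the exponential map in slice coordinates, applied to the point `(u, 0)` of `L` and to
  -- the vector `c (u, n)` of the complement
  let c := S.complementCoord σ p₀
  let k : E₁ × F → (E₁ × F) × (E₁ × F) := fun z => ((z.1, 0), c z)
  let T : Set (E₁ × F) := Prod.fst ⁻¹' (S.domChart p₀).target
  have hT : IsOpen T := (S.domChart p₀).open_target.preimage continuous_fst
  have hc : ContDiffOn ℝ ∞ c T := fun z hz =>
    (contDiffAt_complementCoord hσ.smooth hz).contDiffWithinAt
  have hk : ContDiffOn ℝ ∞ k T := by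
    have : ContDiff ℝ ∞ fun z : E₁ × F => (z.1, (0 : F)) := by fun_prop
    exact this.contDiffOn.prodMk hc
  let N₁ : Set (E₁ × F) := T ∩ k ⁻¹' N₀
  have hN₁ : IsOpen N₁ := hk.continuousOn.isOpen_inter_preimage hT hN₀
  have hc0 : ∀ u, c (u, 0) = 0 := fun u => complementCoord_zero u
  have hm₁ : (u₀, (0 : F)) ∈ N₁ := ⟨hu₀, by
    change ((u₀, (0 : F)), c (u₀, 0)) ∈ N₀
    rwa [hc0]⟩
  let Φ : E₁ × F → E₁ × F := fun z => e (k z)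
  have hΦ : ContDiffOn ℝ ∞ Φ N₁ := hes.comp (hk.mono inter_subset_left) fun z hz => hz.2
  have hΦat : ∀ z ∈ N₁, ContDiffAt ℝ ∞ Φ z := fun z hz => hΦ.contDiffAt (hN₁.mem_nhds hz)
  have hbase : ∀ u, (u, (0 : F)) ∈ N₁ → Φ (u, 0) = (u, 0) ∧
      (∀ n, (fderiv ℝ Φ (u, 0) (0, n)).2 = n) ∧ Function.Injective (fderiv ℝ Φ (u, 0)) := by
    intro u hu
    have hu0 : ((u, (0 : F)), (0 : E₁ × F)) ∈ N₀ := by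
      have := hu.2
      change ((u, (0 : F)), c (u, 0)) ∈ N₀ at this
      rwa [hc0] at this
    have hk0 : k (u, 0) = ((u, 0), 0) := Prod.ext rfl (hc0 u)
    have hcd : HasFDerivAt c (fderiv ℝ c (u, 0)) (u, 0) :=
      ((contDiffAt_complementCoord hσ.smooth hu.1).differentiableAt (by simp)).hasFDerivAt
    have hed : HasFDerivAt e (fderiv ℝ e ((u, 0), 0)) (k (u, 0)) := by
      rw [hk0]
      exact ((hes.contDiffAt (hN₀.mem_nhds hu0)).differentiableAt (by simp)).hasFDerivAt
    have hkd : HasFDerivAt k (((ContinuousLinearMap.inl ℝ E₁ F).comp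
        (ContinuousLinearMap.fst ℝ E₁ F)).prod (fderiv ℝ c (u, 0))) (u, 0) :=
      HasFDerivAt.prodMk (((ContinuousLinearMap.inl ℝ E₁ F).comp
        (ContinuousLinearMap.fst ℝ E₁ F)).hasFDerivAt) hcd
    have hd := (hed.comp (u, (0 : F)) hkd).fderiv
    have hΦu : ∀ᶠ v in 𝓝 u, Φ (v, 0) = (v, 0) := by
      have hcont : ContinuousAt (fun v : E₁ => (v, (0 : F))) u := by fun_prop
      filter_upwards [hcont (hN₁.mem_nhds hu)] with v hv
      have hv2 := hv.2
      change e (k (v, 0)) = _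
      have hk0 : k (v, 0) = ((v, 0), 0) := Prod.ext rfl (hc0 v)
      change k (v, 0) ∈ N₀ at hv2
      rw [hk0] at hv2 ⊢
      exact (he0 _ hv2).1
    have hn : ∀ n, (fderiv ℝ Φ (u, 0) (0, n)).2 = n := by
      intro n
      have e1 : fderiv ℝ Φ (u, 0) (0, n) = fderiv ℝ c (u, 0) (0, n) := by
        rw [show Φ = e ∘ k from rfl, hd]
        change fderiv ℝ e ((u, 0), 0) (((0 : E₁), (0 : F)), fderiv ℝ c (u, 0) (0, n)) = _
        exact (he0 _ hu0).2 _
      rw [e1]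
      have e2 : HasFDerivAt (fun z => (c z).2) ((ContinuousLinearMap.snd ℝ E₁ F).comp
        (fderiv ℝ c (u, 0))) (u, 0) := (ContinuousLinearMap.snd ℝ E₁ F).hasFDerivAt.comp _ hcd
      have e3 : (fun z => (c z).2) =ᶠ[𝓝 (u, (0 : F))] Prod.snd := by
        filter_upwards [hT.mem_nhds hu.1] with z hz using complementCoord_snd hσ.proj_apply hz
      have e4 := (e2.congr_of_eventuallyEq e3.symm).unique hasFDerivAt_snd
      exact DFunLike.congr_fun e4 (0, n)
    have hx : ∀ x, fderiv ℝ Φ (u, 0) (x, 0) = (x, 0) := by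
      intro x
      have e1 : HasFDerivAt (fun v : E₁ => Φ (v, 0)) ((fderiv ℝ Φ (u, 0)).comp
          (ContinuousLinearMap.inl ℝ E₁ F)) u :=
        HasFDerivAt.comp u (f := fun v : E₁ => (v, (0 : F)))
          (((hΦat _ hu).differentiableAt (by simp)).hasFDerivAt)
          (ContinuousLinearMap.inl ℝ E₁ F).hasFDerivAt
      have e2 := (e1.congr_of_eventuallyEq (hΦu.mono fun v hv => hv.symm)).unique
        (ContinuousLinearMap.inl ℝ E₁ F).hasFDerivAt
      exact DFunLike.congr_fun e2 x
    refine ⟨hΦu.self_of_nhds, hn, ?_⟩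
    rw [injective_iff_map_eq_zero]
    rintro ⟨x, n⟩ hxn
    have hsplit : ((x, n) : E₁ × F) = (x, 0) + (0, n) := by simp
    rw [hsplit, map_add, hx] at hxn
    have hn0 : n = 0 := by
      have := congrArg Prod.snd hxn
      rw [Prod.snd_add, hn] at this
      simpa using this
    subst hn0
    have hz : ((0 : E₁), (0 : F)) = 0 := rfl
    rw [hz, map_zero, add_zero] at hxn
    exact hxn
  -- the differential is injective at `(u₀, 0)`, hence also nearby
  have hinjev : ∀ᶠ z in 𝓝 (u₀, (0 : F)), Function.Injective (fderiv ℝ Φ z) := by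
    have hcont : ContinuousAt (fderiv ℝ Φ) (u₀, 0) :=
      ((hΦat _ hm₁).fderiv_right (m := ∞) (by simp)).continuousAt
    exact hcont.eventually (ContinuousLinearMap.isOpen_injective.mem_nhds (hbase u₀ hm₁).2.2)
  obtain ⟨N₂, hN₂, hN₂o, hm₂⟩ := eventually_nhds_iff.1 hinjev
  refine ⟨N₁ ∩ N₂, Φ, hN₁.inter hN₂o, ⟨hm₁, hm₂⟩, hΦ.mono inter_subset_left, ?_, ?_⟩
  · rintro z ⟨hz₁, hz₂⟩
    obtain ⟨-, e2, e3⟩ := he _ hz₁.2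
    refine ⟨hz₁.1, e2, ?_, hN₂ z hz₂⟩
    have hp := (S.domChart p₀).map_target hz₁.1
    have e4 := S.push_sliceCoord hp (σ _ (S.bundleParam p₀ z).2)
    have e5 : S.domChart p₀ ((S.domChart p₀).symm z.1) = z.1 := (S.domChart p₀).right_inv hz₁.1
    rw [e5] at e4
    exact isExp_congr e4 e3
  · rintro u ⟨hu, -⟩
    exact ⟨(hbase u hu).1, (hbase u hu).2.1⟩

end EmbeddedSubmanifold

/-! ### Pull-backs of fields of endomorphisms -/

section Pullback

variable {V H X V' H' X' V'' H'' X'' : Type*}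
  [NormedAddCommGroup V] [NormedSpace ℝ V] [TopologicalSpace H]
  {I : ModelWithCorners ℝ V H} [TopologicalSpace X] [ChartedSpace H X]
  [NormedAddCommGroup V'] [NormedSpace ℝ V'] [TopologicalSpace H']
  {I' : ModelWithCorners ℝ V' H'} [TopologicalSpace X'] [ChartedSpace H' X']
  [NormedAddCommGroup V''] [NormedSpace ℝ V''] [TopologicalSpace H'']
  {I'' : ModelWithCorners ℝ V'' H''} [TopologicalSpace X''] [ChartedSpace H'' X'']

/-- Pull-backs of endomorphisms are functorial. As `pullbackEnd` uses the inverse of the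
differential, which is `0` where that is not invertible, one of the differentials is assumed to be
invertible. -/
lemma pullbackEnd_comp {f : X → X'} {g : X' → X''}
    (K : ∀ x : X'', TangentSpace I'' x →L[ℝ] TangentSpace I'' x) {x : X}
    (hf : MDifferentiableAt I I' f x) (hg : MDifferentiableAt I' I'' g (f x))
    (hinv : (mfderiv I I' f x).IsInvertible ∨ (mfderiv I' I'' g (f x)).IsInvertible) :
    pullbackEnd (I := I) (I' := I'') (g ∘ f) K x =
      pullbackEnd (I := I) (I' := I') f (pullbackEnd (I := I') (I' := I'') g K) x := by
  have h1 : (mfderiv I I'' (g ∘ f) x : V →L[ℝ] V'') =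
    (mfderiv I' I'' g (f x) : V' →L[ℝ] V'').comp (mfderiv I I' f x : V →L[ℝ] V') :=
    mfderiv_comp x hg hf
  have h2 : ((mfderiv I' I'' g (f x) : V' →L[ℝ] V'').comp
      (mfderiv I I' f x : V →L[ℝ] V')).inverse =
      (mfderiv I I' f x : V →L[ℝ] V').inverse.comp
        (mfderiv I' I'' g (f x) : V' →L[ℝ] V'').inverse := by
    rcases hinv with h | h
    · exact ContinuousLinearMap.IsInvertible.inverse_comp_of_right h
    · exact ContinuousLinearMap.IsInvertible.inverse_comp_of_left h
  change (mfderiv I I'' (g ∘ f) x : V →L[ℝ] V'').inverse.comp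
    ((K (g (f x)) : V'' →L[ℝ] V'').comp (mfderiv I I'' (g ∘ f) x : V →L[ℝ] V'')) = _
  rw [h1, h2]
  rfl

lemma pullbackEnd_congr {f g : X → X'}
    (K : ∀ x : X', TangentSpace I' x →L[ℝ] TangentSpace I' x) {x : X} (h : f =ᶠ[𝓝 x] g) :
    pullbackEnd (I := I) (I' := I') f K x = pullbackEnd (I := I) (I' := I') g K x := by
  have h1 : (mfderiv I I' f x : V →L[ℝ] V') = mfderiv I I' g x := h.mfderiv_eq
  have h2 : (K (f x) : V' →L[ℝ] V') = K (g x) := by rw [h.self_of_nhds]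
  change (mfderiv I I' f x : V →L[ℝ] V').inverse.comp
    ((K (f x) : V' →L[ℝ] V').comp (mfderiv I I' f x : V →L[ℝ] V')) = _
  rw [h1, h2]
  rfl

lemma pullbackEnd_congr_right {f : X → X'}
    {K K' : ∀ x : X', TangentSpace I' x →L[ℝ] TangentSpace I' x} {x : X} (h : K (f x) = K' (f x)) :
    pullbackEnd (I := I) (I' := I') f K x = pullbackEnd (I := I) (I' := I') f K' x := by
  rw [pullbackEnd, pullbackEnd, h]

end Pullback

lemma pullbackEnd_scaleSnd {A B : Type*} [NormedAddCommGroup A] [NormedSpace ℝ A]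
    [NormedAddCommGroup B] [NormedSpace ℝ B] (K : A × B → A × B →L[ℝ] A × B) {t : ℝ} (ht : t ≠ 0)
    (w : A × B) :
    pullbackEnd (I := 𝓘(ℝ, A × B)) (I' := 𝓘(ℝ, A × B)) (scaleSnd t) K w =
      (scaleSnd t⁻¹).comp ((K (scaleSnd t w)).comp (scaleSnd t)) := by
  have hinv : ∀ s r : ℝ, s * r = 1 → (scaleSnd s : A × B →L[ℝ] A × B).comp (scaleSnd r) =
      ContinuousLinearMap.id ℝ (A × B) := by
    intro s r h
    refine ContinuousLinearMap.ext fun v => ?_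
    change scaleSnd s (scaleSnd r v) = v
    rw [scaleSnd_apply, scaleSnd_apply, smul_smul, h, one_smul]
  let e : (A × B) ≃L[ℝ] A × B := ContinuousLinearEquiv.equivOfInverse' (scaleSnd t) (scaleSnd t⁻¹)
    (hinv _ _ (mul_inv_cancel₀ ht)) (hinv _ _ (inv_mul_cancel₀ ht))
  have h1 : mfderiv 𝓘(ℝ, A × B) 𝓘(ℝ, A × B) (scaleSnd t : A × B →L[ℝ] A × B) w = scaleSnd t := by
    rw [mfderiv_eq_fderiv]
    exact ContinuousLinearMap.fderiv (𝕜 := ℝ) (scaleSnd t : A × B →L[ℝ] A × B)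
  have h2 : (scaleSnd t : A × B →L[ℝ] A × B).inverse = scaleSnd t⁻¹ :=
    ContinuousLinearMap.inverse_equiv e
  change (mfderiv 𝓘(ℝ, A × B) 𝓘(ℝ, A × B) (scaleSnd t : A × B →L[ℝ] A × B) w).inverse.comp
    ((K (scaleSnd t w)).comp
      (mfderiv 𝓘(ℝ, A × B) 𝓘(ℝ, A × B) (scaleSnd t : A × B →L[ℝ] A × B) w)) = _
  rw [h1, ← h2]
  rfl

namespace PartialDiffeomorph

variable {W V H X : Type*} [NormedAddCommGroup W] [NormedSpace ℝ W]
  [NormedAddCommGroup V] [NormedSpace ℝ V] [TopologicalSpace H]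
  {I : ModelWithCorners ℝ V H} [TopologicalSpace X] [ChartedSpace H X]
  {θ : PartialDiffeomorph 𝓘(ℝ, W) I W X ∞} {w : W}

variable (θ) in
/-- The field of endomorphisms with given matrix in a local parametrization. -/
def ofLocalEnd (K : W → W →L[ℝ] W) : ∀ x : X, TangentSpace I x →L[ℝ] TangentSpace I x :=
  pullbackEnd (I := I) (I' := 𝓘(ℝ, W)) θ.symm K

lemma apply_eq_localEnd (hw : w ∈ θ.source)
    (K : ∀ x : X, TangentSpace I x →L[ℝ] TangentSpace I x) :
    K (θ w) = (θ.push w).comp ((θ.localEnd K w).comp (θ.pull w)) := by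
  refine ContinuousLinearMap.ext fun v => ?_
  change _ = θ.push w (θ.localEnd K w (θ.pull w v))
  rw [push_localEnd hw, push_pull hw]

lemma ofLocalEnd_apply (hw : w ∈ θ.source) (K : W → W →L[ℝ] W) :
    θ.ofLocalEnd K (θ w) = (θ.push w).comp ((K w).comp (θ.pull w)) := by
  have h := θ.symm.inverse_mfderiv (θ.map_source_apply hw)
  have h3 := θ.inverse_mfderiv hw
  change ((mfderiv I 𝓘(ℝ, W) θ.symm (θ w)).inverse : W →L[ℝ] V).comp ((K (θ.symm (θ w))).comp
    (mfderiv I 𝓘(ℝ, W) θ.symm (θ w) : V →L[ℝ] W)) = _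
  have h2 : ((mfderiv I 𝓘(ℝ, W) θ.symm (θ w)).inverse : W →L[ℝ] V) =
    (mfderiv 𝓘(ℝ, W) I θ (θ.symm (θ w)) : W →L[ℝ] V) := h
  rw [h2, ← h3, θ.left_inv_apply hw]
  rfl

lemma localEnd_ofLocalEnd (hw : w ∈ θ.source) (K : W → W →L[ℝ] W) :
    θ.localEnd (θ.ofLocalEnd K) w = K w := by
  refine ContinuousLinearMap.ext fun v => push_injective hw ?_
  rw [push_localEnd hw, ofLocalEnd_apply hw]
  change θ.push w (K w (θ.pull w (θ.push w v))) = _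
  rw [pull_push hw]

/-- Fields of endomorphisms converge at a point if their matrices do. -/
lemma tendsto_of_localEnd {ι : Type*} {l : Filter ι} (hw : w ∈ θ.source)
    {f : ι → ∀ x : X, TangentSpace I x →L[ℝ] TangentSpace I x}
    {g : ∀ x : X, TangentSpace I x →L[ℝ] TangentSpace I x}
    (h : Tendsto (fun i => θ.localEnd (f i) w) l (𝓝 (θ.localEnd g w))) :
    Tendsto (fun i => f i (θ w)) l (𝓝 (g (θ w))) := by
  have hc : Continuous fun T : W →L[ℝ] W =>
      ((θ.push w : W →L[ℝ] V).comp (T.comp (θ.pull w : V →L[ℝ] W)) : V →L[ℝ] V) := by fun_prop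
  have h1 := (hc.tendsto _).comp h
  rw [apply_eq_localEnd hw g]
  refine Tendsto.congr (fun i => ?_) h1
  exact (apply_eq_localEnd hw (f i)).symm

/-- A field of endomorphisms is smooth where its matrix is. -/
lemma contMDiffAt_of_localEnd [FiniteDimensional ℝ V] [FiniteDimensional ℝ W]
    [IsManifold I ∞ X] [IsManifold I 1 X] (hw : w ∈ θ.source)
    {K : ∀ x : X, TangentSpace I x →L[ℝ] TangentSpace I x}
    (h : ContDiffAt ℝ ∞ (θ.localEnd K) w) :
    ContMDiffAt I (I.prod 𝓘(ℝ, V →L[ℝ] V)) ∞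
    (fun x => (⟨x, K x⟩ : TotalSpace (V →L[ℝ] V)
      (fun x : X => TangentSpace I x →L[ℝ] TangentSpace I x))) (θ w) := by
  refine contMDiffAt_end_of_apply fun Y hY => ?_
  rw [smoothFieldAt_iff hw]
  refine (h.clm_apply (contDiffAt_localField hw hY)).congr_of_eventuallyEq ?_
  filter_upwards [θ.open_source.mem_nhds hw] with z hz using localField_end hz

end PartialDiffeomorph

/-- Spaces of endomorphisms of a tangent space are Hausdorff, so limits in them are unique; the
topology is that of the model space. -/
instance {V H X : Type*} [NormedAddCommGroup V] [NormedSpace ℝ V] [TopologicalSpace H]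
    {I : ModelWithCorners ℝ V H} [TopologicalSpace X] [ChartedSpace H X] (x : X) :
    T2Space (TangentSpace I x →L[ℝ] TangentSpace I x) :=
  inferInstanceAs (T2Space (V →L[ℝ] V))

/-! ### The limit of the dilated structures -/

namespace EmbeddedSubmanifold

variable {E₁ F L E M : Type*}
    [NormedAddCommGroup E₁] [NormedSpace ℝ E₁] [NormedAddCommGroup F] [NormedSpace ℝ F]
    [NormedAddCommGroup E] [NormedSpace ℝ E]
    [TopologicalSpace L] [ChartedSpace E₁ L] [IsManifold 𝓘(ℝ, E₁) ∞ L]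
    [TopologicalSpace M] [ChartedSpace E M] [IsManifold 𝓘(ℝ, E) ∞ M]
    (S : EmbeddedSubmanifold E₁ F L E M)
    (J : ∀ x : M, TangentSpace 𝓘(ℝ, E) x →L[ℝ] TangentSpace 𝓘(ℝ, E) x)

/-- In bundle coordinates the dilatations along the fibres are dilatations of the second factor. -/
lemma dilatation_bundleParam (p₀ : L) (t : ℝ) :
    S.dilatation t ∘ S.bundleParam p₀ = S.bundleParam p₀ ∘ (scaleSnd t : E₁ × F →L[ℝ] E₁ × F) := by
  funext z
  change S.dilatation t (S.bundleParam p₀ z) = S.bundleParam p₀ (scaleSnd t z)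
  rw [scaleSnd_apply]
  change (⟨_, t • S.proj _ (S.normalLift p₀ _ z.2)⟩ : TotalSpace F S.Normal) =
    ⟨_, S.proj _ (S.normalLift p₀ _ (t • z.2))⟩
  rw [map_smul, map_smul]
  rfl

lemma bundleParam_zero {p₀ : L} {u : E₁} :
    S.bundleParam p₀ (u, 0) = S.zeroSec ((S.domChart p₀).symm u) := by
  change (⟨_, S.proj _ (S.normalLift p₀ _ 0)⟩ : TotalSpace F S.Normal) = ⟨_, 0⟩
  rw [map_zero, map_zero]

lemma mem_bundleParam_source {p₀ : L} {z : E₁ × F} :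
    z ∈ (S.bundleParam p₀).source ↔ z.1 ∈ (S.domChart p₀).target :=
  ⟨fun h => h.1, fun h => ⟨h, mem_univ _⟩⟩

lemma mem_domChart_source (p : L) : p ∈ (S.domChart p).source :=
  (S.isImmersion p).mem_domChart_source

lemma exists_bundleParam_eq (a : TotalSpace F S.Normal) :
    ∃ p₀, ∃ z ∈ (S.bundleParam p₀).source, S.bundleParam p₀ z = a :=
  have ha : a ∈ (S.bundleParam a.proj).target := S.mem_domChart_source a.proj
  ⟨_, _, (S.bundleParam a.proj).map_target_apply ha, (S.bundleParam a.proj).right_inv_apply ha⟩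

lemma mdifferentiableAt_dilatation (t : ℝ) (a : TotalSpace F S.Normal) :
    MDifferentiableAt (𝓘(ℝ, E₁).prod 𝓘(ℝ, F)) (𝓘(ℝ, E₁).prod 𝓘(ℝ, F)) (S.dilatation t) a := by
  let Ψ := S.bundleParam a.proj
  have ha : a ∈ Ψ.target := S.mem_domChart_source a.proj
  have hz := Ψ.map_target_apply ha
  have hz' : scaleSnd t (Ψ.symm a) ∈ Ψ.source := by
    rw [mem_bundleParam_source] at hz ⊢
    rw [scaleSnd_apply]
    exact hz
  have h1 : MDifferentiableAt 𝓘(ℝ, E₁ × F) 𝓘(ℝ, E₁ × F)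
      (scaleSnd t : E₁ × F →L[ℝ] E₁ × F) (Ψ.symm a) :=
    (ContinuousLinearMap.differentiableAt (𝕜 := ℝ)
      (scaleSnd t : E₁ × F →L[ℝ] E₁ × F)).mdifferentiableAt
  have h2 := ((Ψ.contMDiffAt_apply hz').mdifferentiableAt (by simp)).comp _ h1
  have h3 := h2.comp a ((Ψ.contMDiffAt_symm_apply ha).mdifferentiableAt (by simp))
  refine h3.congr_of_eventuallyEq ?_
  filter_upwards [Ψ.open_target.mem_nhds ha] with b hb
  have h4 := congrFun (S.dilatation_bundleParam a.proj t) (Ψ.symm b)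
  have h5 : Ψ (Ψ.symm b) = b := Ψ.right_inv_apply hb
  change S.dilatation t (Ψ (Ψ.symm b)) = _ at h4
  rw [h5] at h4
  exact h4

/-- The limit structure near the fibre over `p₀`: in bundle coordinates at `p₀` its matrix is the
linearization of the matrix of `J` in slice coordinates at `p₀`. -/
def linearizedEnd (p₀ : L) (a : TotalSpace F S.Normal) :
    TangentSpace (𝓘(ℝ, E₁).prod 𝓘(ℝ, F)) a →L[ℝ] TangentSpace (𝓘(ℝ, E₁).prod 𝓘(ℝ, F)) a :=
  (S.bundleParam p₀).ofLocalEnd (linearization ((S.sliceParam p₀).localEnd J)) a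

/-- The almost complex structure on the total space of the normal bundle that is the limit of the
dilated structures. -/
def normalStructure (a : TotalSpace F S.Normal) :
    TangentSpace (𝓘(ℝ, E₁).prod 𝓘(ℝ, F)) a →L[ℝ] TangentSpace (𝓘(ℝ, E₁).prod 𝓘(ℝ, F)) a :=
  S.linearizedEnd J a.proj a

variable {S J}
variable [FiniteDimensional ℝ E₁] [FiniteDimensional ℝ F] [FiniteDimensional ℝ E] [T2Space M]
  {σ : ∀ p : L, S.Normal p →L[ℝ] TangentSpace 𝓘(ℝ, E) (S.incl p)}
  {cov : (∀ x : M, TangentSpace 𝓘(ℝ, E) x) →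
      (∀ x : M, TangentSpace 𝓘(ℝ, E) x →L[ℝ] TangentSpace 𝓘(ℝ, E) x)} {U : Set M}

lemma normalExp_bundleParam {p₀ : L} {z y : E₁ × F} (hcov : IsMinimalConnectionOn J U cov)
    (h : IsExp cov U (S.incl (S.bundleParam p₀ z).proj) (σ _ (S.bundleParam p₀ z).2)
          (S.sliceParam p₀ y)) :
    S.normalExp cov U σ (S.bundleParam p₀ z) = S.sliceParam p₀ y :=
  h.expMap_eq hcov.isOpen hcov.isCovariantDerivativeOn hcov.smooth

/-- A map from the normal bundle to `M` that reads in coordinates as a map with injective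
differential is a local diffeomorphism. -/
lemma isLocalDiffeomorphAt_of_coord {p₀ : L} {φ : TotalSpace F S.Normal → M} {N : Set (E₁ × F)}
    {Φ : E₁ × F → E₁ × F} (hN : IsOpen N) (hΦ : ContDiffOn ℝ ∞ Φ N)
    (hsub : N ⊆ (S.bundleParam p₀).source) (hmaps : ∀ z ∈ N, Φ z ∈ (S.sliceParam p₀).source)
    (hinj : ∀ z ∈ N, Function.Injective (fderiv ℝ Φ z))
    (hφ : ∀ z ∈ N, φ (S.bundleParam p₀ z) = S.sliceParam p₀ (Φ z)) {z : E₁ × F} (hz : z ∈ N) :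
    IsLocalDiffeomorphAt (𝓘(ℝ, E₁).prod 𝓘(ℝ, F)) 𝓘(ℝ, E) ∞ φ (S.bundleParam p₀ z) := by
  obtain ⟨θ, hzθ, hθN, hθ⟩ := exists_partialDiffeomorph hN hΦ hinj hz
  have hl := fun {y} (hy : y ∈ N) => (S.bundleParam p₀).left_inv_apply (hsub hy)
  refine ⟨((S.bundleParam p₀).symm.trans θ).trans (S.sliceParam p₀), ⟨⟨?_, ?_⟩, ?_⟩, ?_⟩
  · exact (S.bundleParam p₀).map_source_apply (hsub hz)
  · change (S.bundleParam p₀).symm (S.bundleParam p₀ z) ∈ θ.source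
    rwa [hl hz]
  · change θ ((S.bundleParam p₀).symm (S.bundleParam p₀ z)) ∈ (S.sliceParam p₀).source
    rw [hl hz, hθ]
    exact hmaps z hz
  · rintro y ⟨⟨h1, h2⟩, -⟩
    change y ∈ (S.bundleParam p₀).target at h1
    change (S.bundleParam p₀).symm y ∈ θ.source at h2
    have h3 := hφ _ (hθN h2)
    rw [(S.bundleParam p₀).right_inv_apply h1, ← hθ] at h3
    exact h3

/-- The normal exponential map is a local diffeomorphism near the zero section. -/
theorem exists_isLocalDiffeomorphOn_normalExp (hσ : S.IsInvariantComplement J σ)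
    (hU : range S.incl ⊆ U) (hcov : IsMinimalConnectionOn J U cov) :
    ∃ O : Set (TotalSpace F S.Normal), IsOpen O ∧ range S.zeroSec ⊆ O ∧
      (∀ a ∈ O, ∃ y, IsExp cov U (S.incl a.proj) (σ a.proj a.2) y) ∧
      IsLocalDiffeomorphOn (𝓘(ℝ, E₁).prod 𝓘(ℝ, F)) 𝓘(ℝ, E) ∞ (S.normalExp cov U σ) O := by
  choose N Φ hN h0 hΦ hmain _ using fun p : L => exists_normalExp_coord hσ hU hcov
    ((S.domChart p).map_source (S.mem_domChart_source p))
  have hsub : ∀ p, N p ⊆ (S.bundleParam p).source := fun p z hz =>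
    S.mem_bundleParam_source.2 (hmain p z hz).1
  refine ⟨⋃ p, S.bundleParam p '' N p, isOpen_iUnion fun p => ?_, ?_, ?_, ?_⟩
  · exact (S.bundleParam p).toOpenPartialHomeomorph.isOpen_image_of_subset_source (hN p) (hsub p)
  · rintro _ ⟨p, rfl⟩
    refine mem_iUnion.2 ⟨p, _, h0 p, ?_⟩
    rw [S.bundleParam_zero, (S.domChart p).left_inv (S.mem_domChart_source p)]
  · intro a ha
    obtain ⟨p, z, hz, rfl⟩ := mem_iUnion.1 ha
    exact ⟨_, (hmain p z hz).2.2.1⟩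
  · rintro ⟨a, ha⟩
    obtain ⟨p, z, hz, rfl⟩ := mem_iUnion.1 ha
    exact isLocalDiffeomorphAt_of_coord (hN p) (hΦ p) (hsub p)
      (fun z hz => (hmain p z hz).2.1) (fun z hz => (hmain p z hz).2.2.2)
      (fun z hz => normalExp_bundleParam hcov (hmain p z hz).2.2.1) hz

/-- In coordinates the dilated structures converge to the linearization of `J`, whatever the
complement and the connection are. -/
theorem tendsto_localEnd_dilated (hJ : IsAlmostComplex 𝓘(ℝ, E) J) (hL : S.IsPHSubmanifold J)
    (hσ : S.IsInvariantComplement J σ)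
    (hU : range S.incl ⊆ U) (hcov : IsMinimalConnectionOn J U cov) {p₀ : L} {w : E₁ × F}
    (hw : w ∈ (S.bundleParam p₀).source) :
    Tendsto (fun t : ℝ => (S.bundleParam p₀).localEnd
      (S.dilated J (S.normalExp cov U σ) t) w) (𝓝[≠] 0)
      (𝓝 (linearization ((S.sliceParam p₀).localEnd J) w)) := by
  have hu := S.mem_bundleParam_source.1 hw
  obtain ⟨N, Φ, hN, h0, hΦ, hmain, hbase⟩ := exists_normalExp_coord hσ hU hcov hu
  have hsub : N ⊆ (S.bundleParam p₀).source := fun z hz =>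
    S.mem_bundleParam_source.2 (hmain z hz).1
  set Ψ := S.bundleParam p₀ with hΨ
  set Θ := S.sliceParam p₀ with hΘ
  set φ := S.normalExp cov U σ with hφ
  have hφΨ : ∀ z ∈ N, φ (Ψ z) = Θ (Φ z) := fun z hz =>
    normalExp_bundleParam hcov (hmain z hz).2.2.1
  have hΦat : ∀ z ∈ N, ContDiffAt ℝ ∞ Φ z := fun z hz => hΦ.contDiffAt (hN.mem_nhds hz)
  have hequiv : ∀ z ∈ N, ∃ e : (E₁ × F) ≃L[ℝ] (E₁ × F), (e : E₁ × F →L[ℝ] E₁ × F) =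
      fderiv ℝ Φ z := fun z hz =>
    ⟨(LinearEquiv.ofInjectiveEndo (fderiv ℝ Φ z).toLinearMap
      (hmain z hz).2.2.2).toContinuousLinearEquiv, ContinuousLinearMap.ext fun v => rfl⟩
  let 𝒥 := Θ.localEnd J
  let G : E₁ × F → E₁ × F →L[ℝ] E₁ × F := fun z =>
    (fderiv ℝ Φ z).inverse.comp ((𝒥 (Φ z)).comp (fderiv ℝ Φ z))
  -- the matrix of the pull-back of `J` by the normal exponential map
  have hG : ∀ z ∈ N, Ψ.localEnd (pullbackEnd (I := 𝓘(ℝ, E₁).prod 𝓘(ℝ, F)) (I' := 𝓘(ℝ, E)) φ J) z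
      = G z := by
    intro z hz
    have hd : MDifferentiableAt (𝓘(ℝ, E₁).prod 𝓘(ℝ, F)) 𝓘(ℝ, E) φ (Ψ z) :=
      (isLocalDiffeomorphAt_of_coord hN hΦ hsub (fun z hz => (hmain z hz).2.1)
        (fun z hz => (hmain z hz).2.2.2) hφΨ hz).mdifferentiableAt (by simp)
    have hΦd : DifferentiableAt ℝ Φ z := (hΦat z hz).differentiableAt (by simp)
    have e1 := pullbackEnd_comp (I := 𝓘(ℝ, E₁ × F)) J
      ((Ψ.contMDiffAt_apply (hsub hz)).mdifferentiableAt (by simp)) hd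
      (Or.inl (Ψ.isInvertible_mfderiv (hsub hz)))
    have e2 : φ ∘ Ψ =ᶠ[𝓝 z] Θ ∘ Φ := by
      filter_upwards [hN.mem_nhds hz] with y hy using hφΨ y hy
    have e3 := pullbackEnd_congr (I := 𝓘(ℝ, E₁ × F)) (I' := 𝓘(ℝ, E)) J e2
    have e4 := pullbackEnd_comp (I := 𝓘(ℝ, E₁ × F)) J hΦd.mdifferentiableAt
      ((Θ.contMDiffAt_apply (hmain z hz).2.1).mdifferentiableAt (by simp))
      (Or.inr (Θ.isInvertible_mfderiv (hmain z hz).2.1))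
    refine (e1.symm.trans (e3.trans e4)).trans ?_
    change (mfderiv 𝓘(ℝ, E₁ × F) 𝓘(ℝ, E₁ × F) Φ z).inverse.comp ((𝒥 (Φ z)).comp
      (mfderiv 𝓘(ℝ, E₁ × F) 𝓘(ℝ, E₁ × F) Φ z)) = _
    rw [mfderiv_eq_fderiv]
    rfl
  -- for small `t`, the matrix of the dilated structure is that of the pull-back, conjugated by
  -- `scaleSnd t`
  have hdil : ∀ᶠ t : ℝ in 𝓝[≠] 0, (scaleSnd t⁻¹).comp ((G (scaleSnd t w)).comp (scaleSnd t)) =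
      Ψ.localEnd (S.dilated J φ t) w := by
    have hmem : ∀ᶠ t : ℝ in 𝓝 0, scaleSnd t w ∈ N := by
      have hcont : ContinuousAt (fun t : ℝ => (w.1, t • w.2)) 0 := by fun_prop
      have : (w.1, (0 : ℝ) • w.2) ∈ N := by rwa [zero_smul]
      filter_upwards [hcont (hN.mem_nhds this)] with t ht
      rw [scaleSnd_apply]
      exact ht
    filter_upwards [hmem.filter_mono nhdsWithin_le_nhds, self_mem_nhdsWithin] with t ht ht0
    let K := pullbackEnd (I := 𝓘(ℝ, E₁).prod 𝓘(ℝ, F)) (I' := 𝓘(ℝ, E)) φ J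
    have e1 := pullbackEnd_comp (I := 𝓘(ℝ, E₁ × F)) K
      ((Ψ.contMDiffAt_apply hw).mdifferentiableAt (by simp))
      (S.mdifferentiableAt_dilatation t (Ψ w)) (Or.inl (Ψ.isInvertible_mfderiv hw))
    have e2 : S.dilatation t ∘ Ψ = Ψ ∘ (scaleSnd t : E₁ × F →L[ℝ] E₁ × F) :=
      S.dilatation_bundleParam p₀ t
    have e3 := pullbackEnd_comp (I := 𝓘(ℝ, E₁ × F)) K
      ((ContinuousLinearMap.differentiableAt (𝕜 := ℝ)
        (scaleSnd t : E₁ × F →L[ℝ] E₁ × F) (x := w)).mdifferentiableAt)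
      ((Ψ.contMDiffAt_apply (hsub ht)).mdifferentiableAt (by simp))
      (Or.inr (Ψ.isInvertible_mfderiv (hsub ht)))
    rw [e2] at e1
    rw [← pullbackEnd_scaleSnd G ht0]
    refine Eq.trans ?_ (e3.symm.trans e1)
    exact pullbackEnd_congr_right (I := 𝓘(ℝ, E₁ × F)) (I' := 𝓘(ℝ, E₁ × F)) (hG _ ht).symm
  have hΦ0 : Φ (w.1, 0) = (w.1, 0) := (hbase _ h0).1
  have h𝒥 : ContDiffAt ℝ ∞ 𝒥 (w.1, 0) :=
    PartialDiffeomorph.contDiffAt_localEnd (S.zero_mem_sliceParam_source hu) (hJ.smooth _)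
  have hDΦ : ContDiffAt ℝ ∞ (fderiv ℝ Φ) (w.1, 0) :=
    (hΦat _ h0).fderiv_right (m := ∞) (by simp)
  -- `G` is smooth, as inversion of linear maps is
  have hGs : ContDiffAt ℝ ∞ G (w.1, 0) := by
    obtain ⟨e, he⟩ := hequiv _ h0
    have h1 : ContDiffAt ℝ ∞ (fun z => (fderiv ℝ Φ z).inverse) (w.1, 0) := by
      have h2 := contDiffAt_map_inverse (𝕜 := ℝ) (n := ∞) e
      rw [he] at h2
      exact h2.comp (w.1, (0 : F)) hDΦ
    have h2 : ContDiffAt ℝ ∞ (fun z => 𝒥 (Φ z)) (w.1, 0) := by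
      refine ContDiffAt.comp (w.1, (0 : F)) ?_ (hΦat _ h0)
      rwa [hΦ0]
    exact h1.clm_comp (h2.clm_comp hDΦ)
  have hcont : ContinuousAt (fun v : E₁ => (v, (0 : F))) w.1 := by fun_prop
  have hNev : ∀ᶠ v in 𝓝 w.1, (v, (0 : F)) ∈ N := hcont (hN.mem_nhds h0)
  -- by construction `G` is conjugate to `𝒥` by `Φ`, so both have the same linearization
  obtain ⟨hG0, hlin⟩ := linearization_conj (w := w) (hΦat _ h0)
    (h𝒥.differentiableAt (by simp)) (hGs.differentiableAt (by simp))
    (hNev.mono fun u hu => (hbase u hu).1) (hNev.mono fun u hu => (hbase u hu).2)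
    (by
      filter_upwards [(S.domChart p₀).open_target.mem_nhds hu] with v hv x
      exact hL.localEnd_snd hv x)
    (by
      filter_upwards [hN.mem_nhds h0] with z hz
      obtain ⟨e, he⟩ := hequiv z hz
      refine ContinuousLinearMap.ext fun v => ?_
      change fderiv ℝ Φ z ((fderiv ℝ Φ z).inverse (𝒥 (Φ z) (fderiv ℝ Φ z v))) = _
      rw [← he, ContinuousLinearMap.inverse_equiv]
      exact e.apply_symm_apply _)
    (hmain _ h0).2.2.2
  -- the dilatations of `G` converge to its linearization
  rw [← hlin]
  exact (tendsto_dilated_linearization (hGs.of_le (by simp)) hG0).congr' hdil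

/-- The limit of the dilated structures, in bundle coordinates around any point `p₀` of `L` whose
chart contains the base point. -/
lemma tendsto_dilated_linearizedEnd (hJ : IsAlmostComplex 𝓘(ℝ, E) J) (hL : S.IsPHSubmanifold J)
    (hσ : S.IsInvariantComplement J σ)
    (hU : range S.incl ⊆ U) (hcov : IsMinimalConnectionOn J U cov) {p₀ : L}
    {a : TotalSpace F S.Normal} (ha : a.proj ∈ (S.domChart p₀).source) :
    Tendsto (fun t : ℝ => S.dilated J (S.normalExp cov U σ) t a) (𝓝[≠] 0)
      (𝓝 (S.linearizedEnd J p₀ a)) := by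
  have ha' : a ∈ (S.bundleParam p₀).target := ha
  have hw := (S.bundleParam p₀).map_target_apply ha'
  have h1 := tendsto_localEnd_dilated hJ hL hσ hU hcov hw
  rw [← (S.bundleParam p₀).localEnd_ofLocalEnd hw
    (linearization ((S.sliceParam p₀).localEnd J))] at h1
  have h2 := PartialDiffeomorph.tendsto_of_localEnd hw h1
  rwa [(S.bundleParam p₀).right_inv_apply ha'] at h2

/-- The dilated structures converge to the structure `normalStructure`. -/
theorem tendsto_dilated (hJ : IsAlmostComplex 𝓘(ℝ, E) J) (hL : S.IsPHSubmanifold J)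
    (hσ : S.IsInvariantComplement J σ)
    (hU : range S.incl ⊆ U) (hcov : IsMinimalConnectionOn J U cov) (a : TotalSpace F S.Normal) :
    Tendsto (fun t : ℝ => S.dilated J (S.normalExp cov U σ) t a) (𝓝[≠] 0)
      (𝓝 (S.normalStructure J a)) :=
  tendsto_dilated_linearizedEnd hJ hL hσ hU hcov (S.mem_domChart_source a.proj)

/-- In bundle coordinates the limit structure is the linearization of `J`; the limit does not
depend on the coordinates. -/
lemma localEnd_normalStructure (hJ : IsAlmostComplex 𝓘(ℝ, E) J) (hL : S.IsPHSubmanifold J)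
    (hσ : S.IsInvariantComplement J σ)
    (hU : range S.incl ⊆ U) (hcov : IsMinimalConnectionOn J U cov) {p₀ : L} {w : E₁ × F}
    (hw : w ∈ (S.bundleParam p₀).source) :
    (S.bundleParam p₀).localEnd (S.normalStructure J) w =
      linearization ((S.sliceParam p₀).localEnd J) w := by
  have ha := (S.bundleParam p₀).map_source_apply hw
  have h : S.normalStructure J (S.bundleParam p₀ w) =
      S.linearizedEnd J p₀ (S.bundleParam p₀ w) :=
    tendsto_nhds_unique (tendsto_dilated hJ hL hσ hU hcov _)
      (tendsto_dilated_linearizedEnd hJ hL hσ hU hcov ha)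
  rw [← (S.bundleParam p₀).localEnd_ofLocalEnd hw
    (linearization ((S.sliceParam p₀).localEnd J))]
  exact pullbackEnd_congr_right h

end EmbeddedSubmanifold

/-! ### The limit is an almost complex structure; projection and zero section -/

namespace EmbeddedSubmanifold

variable {E₁ F L E M : Type*}
    [NormedAddCommGroup E₁] [NormedSpace ℝ E₁] [NormedAddCommGroup F] [NormedSpace ℝ F]
    [NormedAddCommGroup E] [NormedSpace ℝ E]
    [TopologicalSpace L] [ChartedSpace E₁ L] [IsManifold 𝓘(ℝ, E₁) ∞ L]
    [TopologicalSpace M] [ChartedSpace E M] [IsManifold 𝓘(ℝ, E) ∞ M]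
    {S : EmbeddedSubmanifold E₁ F L E M}
    {J : ∀ x : M, TangentSpace 𝓘(ℝ, E) x →L[ℝ] TangentSpace 𝓘(ℝ, E) x}
    [FiniteDimensional ℝ E₁] [FiniteDimensional ℝ F] [FiniteDimensional ℝ E]

variable (S J) in
/-- A field of endomorphisms on the total space of the normal bundle whose matrix in all bundle
coordinates is the linearization of the matrix of `J` in slice coordinates. -/
def IsLinearizationOf (Jc : ∀ a : TotalSpace F S.Normal,
    TangentSpace (𝓘(ℝ, E₁).prod 𝓘(ℝ, F)) a →L[ℝ] TangentSpace (𝓘(ℝ, E₁).prod 𝓘(ℝ, F)) a) : Prop :=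
  ∀ (p₀ : L), ∀ w ∈ (S.bundleParam p₀).source,
    (S.bundleParam p₀).localEnd Jc w = linearization ((S.sliceParam p₀).localEnd J) w

lemma contDiffAt_localEnd_sliceParam (hJ : IsAlmostComplex 𝓘(ℝ, E) J) {p₀ : L} {u : E₁}
    (hu : u ∈ (S.domChart p₀).target) :
    ContDiffAt ℝ ∞ ((S.sliceParam p₀).localEnd J) (u, 0) :=
  PartialDiffeomorph.contDiffAt_localEnd (S.zero_mem_sliceParam_source hu) (hJ.smooth _)

/-- The restriction of an almost complex structure to a pseudoholomorphic submanifold is an almost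
complex structure. -/
lemma isAlmostComplex_restrict (hJ : IsAlmostComplex 𝓘(ℝ, E) J) (hL : S.IsPHSubmanifold J) :
    IsAlmostComplex 𝓘(ℝ, E₁) (S.restrict J) where
  smooth p := by
    have hp := S.mem_domChart_source p
    have hu : S.domChart p p ∈ (S.baseParam p).source := (S.domChart p).map_source hp
    have h1 : ContDiffAt ℝ ∞ ((S.baseParam p).localEnd (S.restrict J)) (S.domChart p p) := by
      refine contDiffAt_of_clm_apply fun x => ?_
      have h2 : ContDiffAt ℝ ∞ (fun u : E₁ => (u, (0 : F))) (S.domChart p p) := by fun_prop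
      have h3 := ((contDiffAt_localEnd_sliceParam hJ hu).comp (S.domChart p p) h2).clm_apply
        (contDiffAt_const (c := (x, (0 : F))))
      refine (contDiff_fst.contDiffAt.comp (S.domChart p p) h3).congr_of_eventuallyEq ?_
      filter_upwards [(S.baseParam p).open_source.mem_nhds hu] with v hv
      exact hL.localEnd_restrict hv x
    have h2 := PartialDiffeomorph.contMDiffAt_of_localEnd hu h1
    have h3 : S.baseParam p (S.domChart p p) = p := (S.domChart p).left_inv hp
    rwa [h3] at h2
  sq p v := by
    apply S.dincl_injective p
    rw [S.dincl_restrict J hL, S.dincl_restrict J hL, hJ.sq, map_neg]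

variable {Jc : ∀ a : TotalSpace F S.Normal,
    TangentSpace (𝓘(ℝ, E₁).prod 𝓘(ℝ, F)) a →L[ℝ] TangentSpace (𝓘(ℝ, E₁).prod 𝓘(ℝ, F)) a}

lemma IsLinearizationOf.isAlmostComplex (hJc : S.IsLinearizationOf J Jc)
    (hJ : IsAlmostComplex 𝓘(ℝ, E) J) (hL : S.IsPHSubmanifold J) :
    IsAlmostComplex (𝓘(ℝ, E₁).prod 𝓘(ℝ, F)) Jc where
  smooth a := by
    obtain ⟨p₀, z, hz, rfl⟩ := S.exists_bundleParam_eq a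
    refine PartialDiffeomorph.contMDiffAt_of_localEnd hz ?_
    refine (contDiffAt_linearization (contDiffAt_localEnd_sliceParam hJ
      (S.mem_bundleParam_source.1 hz))).congr_of_eventuallyEq ?_
    filter_upwards [(S.bundleParam p₀).open_source.mem_nhds hz] with y hy using hJc _ y hy
  sq a v := by
    obtain ⟨p₀, z, hz, rfl⟩ := S.exists_bundleParam_eq a
    have hu := S.mem_bundleParam_source.1 hz
    have h1 : ∀ x, Jc (S.bundleParam p₀ z) ((S.bundleParam p₀).push z x) =
        (S.bundleParam p₀).push z (linearization ((S.sliceParam p₀).localEnd J) z x) := by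
      intro x
      rw [← hJc p₀ z hz, PartialDiffeomorph.push_localEnd hz]
    rw [← PartialDiffeomorph.push_pull hz v, h1, h1, linearization_sq
      ((contDiffAt_localEnd_sliceParam hJ hu).differentiableAt (by simp))
      (fun x => hL.localEnd_snd hu x), map_neg]
    filter_upwards [(S.sliceParam p₀).open_source.mem_nhds (S.zero_mem_sliceParam_source hu)]
      with y hy v using PartialDiffeomorph.localEnd_sq hy (hJ.sq _) v

/-- The projection is pseudoholomorphic, as the `E₁`-component of the linearization is the
structure of `L`. -/
lemma IsLinearizationOf.isPseudoholomorphic_proj (hJc : S.IsLinearizationOf J Jc)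
    (hL : S.IsPHSubmanifold J) :
    IsPseudoholomorphic (I := 𝓘(ℝ, E₁).prod 𝓘(ℝ, F)) (I' := 𝓘(ℝ, E₁)) Jc (S.restrict J)
        (TotalSpace.proj : TotalSpace F S.Normal → L) := by
  have hsm : ContMDiff (𝓘(ℝ, E₁).prod 𝓘(ℝ, F)) 𝓘(ℝ, E₁) ∞
    (TotalSpace.proj : TotalSpace F S.Normal → L) := contMDiff_proj S.Normal
  refine ⟨hsm, fun a v => ?_⟩
  obtain ⟨p₀, z, hz, rfl⟩ := S.exists_bundleParam_eq a
  have hu := S.mem_bundleParam_source.1 hz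
  have hu' : z.1 ∈ (S.baseParam p₀).source := hu
  have hcomp : ∀ x, mfderiv (𝓘(ℝ, E₁).prod 𝓘(ℝ, F)) 𝓘(ℝ, E₁)
      (TotalSpace.proj : TotalSpace F S.Normal → L) (S.bundleParam p₀ z)
      ((S.bundleParam p₀).push z x) = (S.baseParam p₀).push z.1 x.1 := by
    intro x
    have e1 := mfderiv_comp (I := 𝓘(ℝ, E₁ × F)) z ((hsm _).mdifferentiableAt (by simp))
      (((S.bundleParam p₀).contMDiffAt_apply hz).mdifferentiableAt (by simp))
    have e2 := mfderiv_comp (I := 𝓘(ℝ, E₁ × F)) (I' := 𝓘(ℝ, E₁)) (I'' := 𝓘(ℝ, E₁)) z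
      (f := Prod.fst) (((S.baseParam p₀).contMDiffAt_apply hu').mdifferentiableAt (by simp))
      (differentiableAt_fst (𝕜 := ℝ)).mdifferentiableAt
    have e3 := e1.symm.trans e2
    rw [mfderiv_eq_fderiv, fderiv_fst] at e3
    exact DFunLike.congr_fun e3 x
  rw [← PartialDiffeomorph.push_pull hz v, ← PartialDiffeomorph.push_localEnd hz, hcomp, hcomp,
    hJc p₀ z hz, linearization_apply]
  refine Eq.trans ?_ (PartialDiffeomorph.push_localEnd (J := S.restrict J) hu' _)
  rw [hL.localEnd_restrict hu]

/-- The zero section is pseudoholomorphic, as the linearization preserves `E₁ × 0` at the points of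
`E₁ × 0`. -/
lemma IsLinearizationOf.isPseudoholomorphic_zeroSec (hJc : S.IsLinearizationOf J Jc)
    (hL : S.IsPHSubmanifold J) :
    IsPseudoholomorphic (I := 𝓘(ℝ, E₁)) (I' := 𝓘(ℝ, E₁).prod 𝓘(ℝ, F)) (S.restrict J) Jc
        S.zeroSec := by
  have hsm : ContMDiff 𝓘(ℝ, E₁) (𝓘(ℝ, E₁).prod 𝓘(ℝ, F)) ∞ S.zeroSec :=
    contMDiff_zeroSection ℝ S.Normal
  refine ⟨hsm, fun p v => ?_⟩
  obtain ⟨p₀, u, hu, hup⟩ : ∃ p₀, ∃ u ∈ (S.domChart p₀).target, (S.domChart p₀).symm u = p :=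
    ⟨p, _, (S.domChart p).map_source (S.mem_domChart_source p),
      (S.domChart p).left_inv (S.mem_domChart_source p)⟩
  have hu' : u ∈ (S.baseParam p₀).source := hu
  change S.baseParam p₀ u = p at hup
  subst hup
  have hz : (u, (0 : F)) ∈ (S.bundleParam p₀).source := S.mem_bundleParam_source.2 hu
  have hcomp : ∀ x, (mfderiv 𝓘(ℝ, E₁) (𝓘(ℝ, E₁).prod 𝓘(ℝ, F)) S.zeroSec (S.baseParam p₀ u)
      ((S.baseParam p₀).push u x) : E₁ × F) = (S.bundleParam p₀).push (u, 0) (x, 0) := by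
    intro x
    have e1 := mfderiv_comp (I := 𝓘(ℝ, E₁)) u ((hsm _).mdifferentiableAt (by simp))
      (((S.baseParam p₀).contMDiffAt_apply hu').mdifferentiableAt (by simp))
    have e2 := mfderiv_comp (I := 𝓘(ℝ, E₁)) (I' := 𝓘(ℝ, E₁ × F)) u
      (f := ContinuousLinearMap.inl ℝ E₁ F)
      (((S.bundleParam p₀).contMDiffAt_apply hz).mdifferentiableAt (by simp))
      (ContinuousLinearMap.differentiableAt _).mdifferentiableAt
    have e4 : S.bundleParam p₀ ∘ ContinuousLinearMap.inl ℝ E₁ F = S.zeroSec ∘ S.baseParam p₀ :=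
      funext fun u => S.bundleParam_zero
    rw [mfderiv_eq_fderiv, ContinuousLinearMap.fderiv, e4] at e2
    exact DFunLike.congr_fun (e1.symm.trans e2) x
  -- `bundleParam p₀ (u, 0)` and `zeroSec (baseParam p₀ u)` are equal only propositionally: the
  -- equation is transported from the former point to the latter
  have key : ∀ b, b = S.zeroSec (S.baseParam p₀ u) → (mfderiv 𝓘(ℝ, E₁)
      (𝓘(ℝ, E₁).prod 𝓘(ℝ, F)) S.zeroSec (S.baseParam p₀ u)
      (S.restrict J _ v) : E₁ × F) = (Jc b : E₁ × F →L[ℝ] E₁ × F)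
      (mfderiv 𝓘(ℝ, E₁) (𝓘(ℝ, E₁).prod 𝓘(ℝ, F)) S.zeroSec (S.baseParam p₀ u) v) →
      mfderiv 𝓘(ℝ, E₁) (𝓘(ℝ, E₁).prod 𝓘(ℝ, F)) S.zeroSec (S.baseParam p₀ u) (S.restrict J _ v) =
      Jc _ (mfderiv 𝓘(ℝ, E₁) (𝓘(ℝ, E₁).prod 𝓘(ℝ, F)) S.zeroSec (S.baseParam p₀ u) v) := by
    rintro _ rfl h
    exact h
  refine key _ (S.bundleParam_zero (p₀ := p₀) (u := u)) ?_
  rw [← PartialDiffeomorph.push_pull hu' v, ← PartialDiffeomorph.push_localEnd hu', hcomp, hcomp]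
  refine Eq.trans ?_ (PartialDiffeomorph.push_localEnd (J := Jc) hz _)
  have h00 : ((0 : E₁), (0 : F)) = 0 := rfl
  rw [hJc p₀ _ hz, linearization_apply, hL.localEnd_restrict hu]
  simp only [h00, map_zero]
  congr 1
  simp

end EmbeddedSubmanifold

/-! ### Integrability of the limit structure -/

section LocalNijenhuis

variable {A B : Type*} [NormedAddCommGroup A] [NormedSpace ℝ A] [NormedAddCommGroup B]
  [NormedSpace ℝ B]

lemma localNijenhuis_swap {W : Type*} [NormedAddCommGroup W] [NormedSpace ℝ W]
    (𝒥 : W → W →L[ℝ] W) (w x y : W) :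
    localNijenhuis 𝒥 w x y = -localNijenhuis 𝒥 w y x := by
  simp only [localNijenhuis]
  abel

/-- The Nijenhuis tensor at `w`, as a bilinear map. -/
def localNijenhuisL {W : Type*} [NormedAddCommGroup W] [NormedSpace ℝ W]
    (𝒥 : W → W →L[ℝ] W) (w : W) : W →L[ℝ] W →L[ℝ] W :=
  (fderiv ℝ 𝒥 w).comp (𝒥 w) - ((fderiv ℝ 𝒥 w).comp (𝒥 w)).flip
    - (ContinuousLinearMap.compL ℝ W W W (𝒥 w)).comp (fderiv ℝ 𝒥 w)
    + (ContinuousLinearMap.compL ℝ W W W (𝒥 w)).comp (fderiv ℝ 𝒥 w).flip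

lemma localNijenhuisL_apply {W : Type*} [NormedAddCommGroup W] [NormedSpace ℝ W]
    (𝒥 : W → W →L[ℝ] W) (w x y : W) :
    localNijenhuisL 𝒥 w x y = localNijenhuis 𝒥 w x y := rfl

lemma differentiableAt_localNijenhuisL {W : Type*} [NormedAddCommGroup W] [NormedSpace ℝ W]
    {𝒥 : W → W →L[ℝ] W} {w : W} (h : ContDiffAt ℝ ∞ 𝒥 w) :
    DifferentiableAt ℝ (localNijenhuisL 𝒥) w := by
  have h1 : DifferentiableAt ℝ 𝒥 w := h.differentiableAt (by simp)
  have h2 : DifferentiableAt ℝ (fderiv ℝ 𝒥) w :=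
    (h.fderiv_right (m := ∞) (by simp)).differentiableAt (by simp)
  have hc : DifferentiableAt ℝ (fun z => (fderiv ℝ 𝒥 z).comp (𝒥 z)) w := h2.clm_comp h1
  have hf : ∀ {f : W → W →L[ℝ] W →L[ℝ] W}, DifferentiableAt ℝ f w →
      DifferentiableAt ℝ (fun z => (f z).flip) w := fun hf =>
    (ContinuousLinearMap.flipₗᵢ ℝ W W W).toContinuousLinearEquiv.differentiableAt.comp w hf
  have hL : DifferentiableAt ℝ (fun z => ContinuousLinearMap.compL ℝ W W W (𝒥 z)) w :=
    (ContinuousLinearMap.compL ℝ W W W).differentiableAt.comp w h1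
  exact ((hc.sub (hf hc)).sub (hL.clm_comp h2)).add (hL.clm_comp (hf h2))

/-- The derivative of the Nijenhuis tensor of two vector fields. -/
lemma hasFDerivAt_localNijenhuis {W : Type*} [NormedAddCommGroup W] [NormedSpace ℝ W]
    {𝒥 : W → W →L[ℝ] W} {w : W} (h : ContDiffAt ℝ ∞ 𝒥 w) {Y Z : W → W}
    (hY : DifferentiableAt ℝ Y w) (hZ : DifferentiableAt ℝ Z w) :
    DifferentiableAt ℝ (fun z => localNijenhuis 𝒥 z (Y z) (Z z)) w ∧
    ∀ v, fderiv ℝ (fun z => localNijenhuis 𝒥 z (Y z) (Z z)) w v =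
      fderiv ℝ (fun z => localNijenhuis 𝒥 z (Y w) (Z w)) w v +
        localNijenhuis 𝒥 w (fderiv ℝ Y w v) (Z w) + localNijenhuis 𝒥 w (Y w) (fderiv ℝ Z w v) := by
  have hN := (differentiableAt_localNijenhuisL h).hasFDerivAt
  have h1 := (hN.clm_apply hY.hasFDerivAt).clm_apply hZ.hasFDerivAt
  have h2 := (hN.clm_apply (hasFDerivAt_const (Y w) w)).clm_apply (hasFDerivAt_const (Z w) w)
  refine ⟨h1.differentiableAt, fun v => ?_⟩
  have e1 := DFunLike.congr_fun h1.fderiv v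
  have e2 := DFunLike.congr_fun h2.fderiv v
  refine e1.trans ?_
  rw [show fderiv ℝ (fun z => localNijenhuis 𝒥 z (Y w) (Z w)) w v = _ from e2]
  simp [localNijenhuisL_apply]
  abel

variable {𝒥 : A × B → A × B →L[ℝ] A × B} {u : A}

/-- If `𝒥` preserves `A × 0` along `A × 0`, its derivatives along `A × 0` are those of the induced
field of endomorphisms of `A`. -/
lemma fderiv_fst_block (h : DifferentiableAt ℝ 𝒥 (u, 0)) {a : A → A →L[ℝ] A}
    (ha : ∀ᶠ v in 𝓝 u, ∀ x, 𝒥 (v, 0) (x, 0) = (a v x, 0)) (y x : A) :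
    fderiv ℝ 𝒥 (u, 0) (y, 0) (x, 0) = (fderiv ℝ (fun v => a v x) u y, 0) := by
  have h1 : HasFDerivAt (fun v : A => 𝒥 (v, 0) (x, 0))
      (((fderiv ℝ 𝒥 (u, 0)).flip (x, 0)).comp (ContinuousLinearMap.inl ℝ A B)) u := by
    have h3 : HasFDerivAt (fun v : A => 𝒥 (v, 0)) ((fderiv ℝ 𝒥 (u, 0)).comp
        (ContinuousLinearMap.inl ℝ A B)) u :=
      HasFDerivAt.comp u (f := ContinuousLinearMap.inl ℝ A B) h.hasFDerivAt
        (ContinuousLinearMap.hasFDerivAt _)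
    have h4 := h3.clm_apply (hasFDerivAt_const ((x, 0) : A × B) u)
    refine h4.congr_fderiv ?_
    ext v <;> simp
  have h2 : (fun v : A => 𝒥 (v, 0) (x, 0)) =ᶠ[𝓝 u] fun v => (a v x, 0) :=
    ha.mono fun v hv => hv x
  have h3 := h1.congr_of_eventuallyEq h2.symm
  have h4 : HasFDerivAt (fun v => a v x) _ u :=
    (ContinuousLinearMap.fst ℝ A B).hasFDerivAt.comp u h3
  have h5 : HasFDerivAt (fun _ : A => (0 : B)) _ u :=
    (ContinuousLinearMap.snd ℝ A B).hasFDerivAt.comp u h3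
  refine Prod.ext ?_ ?_
  · rw [h4.fderiv]
    rfl
  · have := DFunLike.congr_fun (h5.unique (hasFDerivAt_const _ _)) y
    exact this

/-- Along `A × 0` the Nijenhuis tensor of a field of endomorphisms that preserves `A × 0`
restricts to the Nijenhuis tensor of the induced field of endomorphisms of `A`. -/
lemma localNijenhuis_block (h : DifferentiableAt ℝ 𝒥 (u, 0)) {a : A → A →L[ℝ] A}
    (ha : ∀ᶠ v in 𝓝 u, ∀ x, 𝒥 (v, 0) (x, 0) = (a v x, 0))
    (hd : DifferentiableAt ℝ a u) (x y : A) :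
    localNijenhuis 𝒥 (u, 0) (x, 0) (y, 0) = (localNijenhuis a u x y, 0) := by
  have h0 := ha.self_of_nhds
  have hd' : ∀ x y, fderiv ℝ (fun v => a v x) u y = fderiv ℝ a u y x := by
    intro x y
    have := fderiv_clm_apply_apply hd (differentiableAt_const x) y
    simpa using this
  simp only [localNijenhuis, h0, fderiv_fst_block h ha, hd']
  ext <;> simp

end LocalNijenhuis

namespace PartialDiffeomorph

variable {W V H X : Type*} [NormedAddCommGroup W] [NormedSpace ℝ W]
  [NormedAddCommGroup V] [NormedSpace ℝ V] [TopologicalSpace H]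
  {I : ModelWithCorners ℝ V H} [TopologicalSpace X] [ChartedSpace H X]
  {θ : PartialDiffeomorph 𝓘(ℝ, W) I W X ∞} {w : W}
  [FiniteDimensional ℝ V] [FiniteDimensional ℝ W] [IsManifold I ∞ X] [IsManifold I 1 X]
  {J : ∀ x : X, TangentSpace I x →L[ℝ] TangentSpace I x}

/-- At a point of a coordinate domain, integrability can be checked in coordinates. -/
lemma nijenhuis_eq_zero_iff (hw : w ∈ θ.source) (hJ : IsAlmostComplex I J) :
    (∀ Y Z : (∀ x : X, TangentSpace I x), SmoothFieldAt I Y (θ w) → SmoothFieldAt I Z (θ w) →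
      nijenhuis J Y Z (θ w) = 0) ↔ ∀ x y, localNijenhuis (θ.localEnd J) w x y = 0 := by
  constructor
  · intro h x y
    have hY := fun x => smoothFieldAt_ofLocalField hw (Z := fun _ => x) contDiffAt_const
    have e := localField_nijenhuis hw hJ ((hY x).mdifferentiableAt (by simp))
      ((hY y).mdifferentiableAt (by simp))
    rw [localField_ofLocalField hw, localField_ofLocalField hw, localField_apply,
      h _ _ (hY x) (hY y), map_zero] at e
    exact e.symm
  · intro h Y Z hY hZ
    have e := localField_nijenhuis hw hJ (hY.mdifferentiableAt (by simp))
      (hZ.mdifferentiableAt (by simp))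
    rw [h] at e
    rw [← push_localField (θ := θ) (Y := nijenhuis J Y Z) hw, e, map_zero]

end PartialDiffeomorph

section FieldDeriv

variable {W E M : Type*} [NormedAddCommGroup W] [NormedSpace ℝ W] [FiniteDimensional ℝ W]
  [NormedAddCommGroup E] [NormedSpace ℝ E] [FiniteDimensional ℝ E]
  [TopologicalSpace M] [ChartedSpace E M] [IsManifold 𝓘(ℝ, E) ∞ M] [IsManifold 𝓘(ℝ, E) 1 M]
  {θ : PartialDiffeomorph 𝓘(ℝ, W) 𝓘(ℝ, E) W M ∞} {w : W}

/-- The derivative at a zero of a vector field can be computed in any coordinates: the term with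
the second derivative of the coordinate change is multiplied by the value of the field. -/
lemma fieldDeriv_push (hw : w ∈ θ.source) {Z : ∀ x : M, TangentSpace 𝓘(ℝ, E) x}
    (h0 : Z (θ w) = 0) (hZ : DifferentiableAt ℝ (θ.localField Z) w) (v : W) :
    fieldDeriv Z (θ w) (θ.push w v) = θ.push w (fderiv ℝ (θ.localField Z) w v) := by
  set x := θ w with hx
  set t := trivializationAt E (TangentSpace 𝓘(ℝ, E)) x with ht
  set c : W → E := extChartAt 𝓘(ℝ, E) x ∘ θ with hc
  have hxs : x ∈ (chartAt E x).source := mem_chart_source E x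
  have hcs : ContDiffAt ℝ ∞ c w := by
    refine contMDiffAt_iff_contDiffAt.1 ?_
    exact (contMDiffAt_extChartAt' (by exact hxs)).comp w (θ.contMDiffAt_apply hw)
  have hdc : DifferentiableAt ℝ (fderiv ℝ c) w :=
    (hcs.fderiv_right (m := ∞) (by simp)).differentiableAt (by simp)
  have ht2 : ∀ {y : M}, y ∈ (chartAt E x).source → ∀ a : TangentSpace 𝓘(ℝ, E) y,
      (t ⟨y, a⟩).2 = mfderiv 𝓘(ℝ, E) 𝓘(ℝ, E) (extChartAt 𝓘(ℝ, E) x) y a := by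
    intro y hy a
    rw [← TangentBundle.continuousLinearMapAt_trivializationAt hy]
    exact (t.continuousLinearMapAt_apply_of_mem ℝ hy a).symm
  have hnear : ∀ᶠ z in 𝓝 w, z ∈ θ.source ∧ θ z ∈ (chartAt E x).source := by
    refine (Filter.Eventually.and (θ.open_source.mem_nhds hw) ?_)
    exact (θ.contMDiffAt_apply hw).continuousAt ((chartAt E x).open_source.mem_nhds hxs)
  set h : M → E := fun y => (t ⟨y, Z y⟩).2 with hh
  have hcomp : h ∘ θ =ᶠ[𝓝 w] fun z => fderiv ℝ c z (θ.localField Z z) := by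
    filter_upwards [hnear] with z hz
    change (t ⟨θ z, Z (θ z)⟩).2 = _
    rw [ht2 hz.2, hc, θ.push_comp_mfderiv hz.1 hz.2, PartialDiffeomorph.push_localField hz.1]
  have hf0 : θ.localField Z w = 0 := by
    rw [PartialDiffeomorph.localField_apply]
    change θ.pull w (Z x) = 0
    rw [h0, map_zero]
  have hd : fderiv ℝ (h ∘ θ) w v = fderiv ℝ c w (fderiv ℝ (θ.localField Z) w v) := by
    rw [hcomp.fderiv_eq, fderiv_clm_apply hdc hZ]
    simp [hf0]
  have hhd : MDifferentiableAt 𝓘(ℝ, E) 𝓘(ℝ, E) h x := by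
    have h1 : DifferentiableAt ℝ (h ∘ θ) w :=
      (hdc.clm_apply hZ).congr_of_eventuallyEq hcomp
    have h2 : MDifferentiableAt 𝓘(ℝ, E) 𝓘(ℝ, E) ((h ∘ θ) ∘ θ.symm) x := by
      refine MDifferentiableAt.comp x (I' := 𝓘(ℝ, W)) ?_
        ((θ.contMDiffAt_symm_apply (θ.map_source_apply hw)).mdifferentiableAt (by simp))
      rw [hx, θ.left_inv_apply hw]
      exact h1.mdifferentiableAt
    refine h2.congr_of_eventuallyEq ?_
    filter_upwards [θ.open_target.mem_nhds (θ.map_source_apply hw)] with y hy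
    change h y = h (θ (θ.symm y))
    rw [θ.right_inv_apply hy]
  have hchain : mfderiv 𝓘(ℝ, E) 𝓘(ℝ, E) h x (θ.push w v) = fderiv ℝ (h ∘ θ) w v := by
    rw [← mfderiv_eq_fderiv, mfderiv_comp (I' := 𝓘(ℝ, E)) w hhd
      ((θ.contMDiffAt_apply hw).mdifferentiableAt (by simp))]
    rfl
  change t.symm x (show E from mfderiv 𝓘(ℝ, E) 𝓘(ℝ, E) h x (θ.push w v)) = _
  rw [hchain, hd, hc, θ.push_comp_mfderiv hw hxs, ← ht2 hxs]
  exact t.symm_apply_apply_mk hxs _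

end FieldDeriv

namespace EmbeddedSubmanifold

variable {E₁ F L E M : Type*}
    [NormedAddCommGroup E₁] [NormedSpace ℝ E₁] [NormedAddCommGroup F] [NormedSpace ℝ F]
    [NormedAddCommGroup E] [NormedSpace ℝ E]
    [TopologicalSpace L] [ChartedSpace E₁ L] [IsManifold 𝓘(ℝ, E₁) ∞ L]
    [TopologicalSpace M] [ChartedSpace E M] [IsManifold 𝓘(ℝ, E) ∞ M]
    {S : EmbeddedSubmanifold E₁ F L E M}
    {J : ∀ x : M, TangentSpace 𝓘(ℝ, E) x →L[ℝ] TangentSpace 𝓘(ℝ, E) x}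
    [FiniteDimensional ℝ E₁] [FiniteDimensional ℝ F] [FiniteDimensional ℝ E]
    {p₀ p : L} {u : E₁}

variable (S) in
lemma sliceParam_domChart (hp : p ∈ (S.domChart p₀).source) :
    S.sliceParam p₀ (S.domChart p₀ p, 0) = S.incl p := by
  rw [S.sliceParam_zero ((S.domChart p₀).map_source hp), (S.domChart p₀).left_inv hp]

lemma IsPHSubmanifold.localEnd_eq (hL : S.IsPHSubmanifold J)
    (hu : u ∈ (S.domChart p₀).target) (x : E₁) :
    (S.sliceParam p₀).localEnd J (u, 0) (x, 0) =
      ((S.baseParam p₀).localEnd (S.restrict J) u x, 0) :=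
  Prod.ext (hL.localEnd_restrict hu x).symm (hL.localEnd_snd hu x)

/-- On `TL` the Nijenhuis tensor of `J` is that of the structure induced on `L`; in particular its
normal component vanishes. -/
lemma localNijenhuis_tangent (hJ : IsAlmostComplex 𝓘(ℝ, E) J) (hL : S.IsPHSubmanifold J)
    (hu : u ∈ (S.domChart p₀).target) (x y : E₁) :
    localNijenhuis ((S.sliceParam p₀).localEnd J) (u, 0) (x, 0) (y, 0) =
      (localNijenhuis ((S.baseParam p₀).localEnd (S.restrict J)) u x y, 0) := by
  have hu' : u ∈ (S.baseParam p₀).source := hu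
  refine localNijenhuis_block ((contDiffAt_localEnd_sliceParam hJ hu).differentiableAt (by simp))
    ?_ ((PartialDiffeomorph.contDiffAt_localEnd hu'
      ((isAlmostComplex_restrict hJ hL).smooth _)).differentiableAt (by simp)) x y
  filter_upwards [(S.domChart p₀).open_target.mem_nhds hu] with v hv using hL.localEnd_eq hv

/-- The normal component of the Nijenhuis tensor on `TL` vanishes along `L`, and therefore so do its
derivatives along `L`; only the normal derivatives carry information. -/
lemma fderiv_localNijenhuis_tangent (hJ : IsAlmostComplex 𝓘(ℝ, E) J) (hL : S.IsPHSubmanifold J)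
    (hu : u ∈ (S.domChart p₀).target) (x y ξ : E₁) :
    (fderiv ℝ (fun z => localNijenhuis ((S.sliceParam p₀).localEnd J) z (x, 0) (y, 0)) (u, 0)
      (ξ, 0)).2 = 0 := by
  have hd := (hasFDerivAt_localNijenhuis (contDiffAt_localEnd_sliceParam hJ hu)
    (differentiableAt_const (x, (0 : F))) (differentiableAt_const (y, (0 : F)))).1.hasFDerivAt
  have h1 := (ContinuousLinearMap.snd ℝ E₁ F).hasFDerivAt.comp u
    (HasFDerivAt.comp u (f := ContinuousLinearMap.inl ℝ E₁ F) hd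
      (ContinuousLinearMap.hasFDerivAt _))
  have h2 := h1.congr_of_eventuallyEq (f₁ := fun _ : E₁ => (0 : F)) (by
    filter_upwards [(S.domChart p₀).open_target.mem_nhds hu] with v hv
    exact (congrArg Prod.snd (localNijenhuis_tangent hJ hL hv x y)).symm)
  exact DFunLike.congr_fun (h2.unique (hasFDerivAt_const _ _)) ξ

lemma isIntegrable_restrict_iff (hJ : IsAlmostComplex 𝓘(ℝ, E) J) (hL : S.IsPHSubmanifold J) :
    IsIntegrable (I := 𝓘(ℝ, E₁)) (S.restrict J) ↔ ∀ p₀, ∀ u ∈ (S.domChart p₀).target, ∀ x y,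
      localNijenhuis ((S.baseParam p₀).localEnd (S.restrict J)) u x y = 0 := by
  have hK := isAlmostComplex_restrict hJ hL
  constructor
  · intro h p₀ u hu
    exact (PartialDiffeomorph.nijenhuis_eq_zero_iff (θ := S.baseParam p₀) hu hK).1 (h _)
  · intro h p
    have hu := (S.domChart p).map_source (S.mem_domChart_source p)
    have h1 := (PartialDiffeomorph.nijenhuis_eq_zero_iff (θ := S.baseParam p) hu hK).2 (h p _ hu)
    have h2 : S.baseParam p (S.domChart p p) = p :=
      (S.domChart p).left_inv (S.mem_domChart_source p)
    rwa [h2] at h1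

/-- The components of the Nijenhuis tensor along `L` in slice coordinates. -/
lemma sliceCoord_nijenhuis (hJ : IsAlmostComplex 𝓘(ℝ, E) J) (hp : p ∈ (S.domChart p₀).source)
    {Y Z : ∀ x : M, TangentSpace 𝓘(ℝ, E) x} (hY : SmoothFieldAt 𝓘(ℝ, E) Y (S.incl p))
    (hZ : SmoothFieldAt 𝓘(ℝ, E) Z (S.incl p)) :
    S.sliceCoord p₀ p (nijenhuis J Y Z (S.incl p)) =
      localNijenhuis ((S.sliceParam p₀).localEnd J) (S.domChart p₀ p, 0)
        (S.sliceCoord p₀ p (Y (S.incl p))) (S.sliceCoord p₀ p (Z (S.incl p))) := by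
  have hw := S.zero_mem_sliceParam_source ((S.domChart p₀).map_source hp)
  rw [← S.sliceParam_domChart hp] at hY hZ
  rw [← S.localField_sliceParam hp, ← S.localField_sliceParam hp, ← S.localField_sliceParam hp]
  exact PartialDiffeomorph.localField_nijenhuis hw hJ (hY.mdifferentiableAt (by simp))
    (hZ.mdifferentiableAt (by simp))

/-- A vector field with constant components in the slice chart. -/
lemma exists_constant_field (hp : p ∈ (S.domChart p₀).source) (x : E₁ × F) :
    ∃ Y : ∀ x : M, TangentSpace 𝓘(ℝ, E) x, SmoothFieldAt 𝓘(ℝ, E) Y (S.incl p) ∧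
      ∀ᶠ q in 𝓝 p, S.sliceCoord p₀ q (Y (S.incl q)) = x := by
  have hw := S.zero_mem_sliceParam_source ((S.domChart p₀).map_source hp)
  have h1 := PartialDiffeomorph.smoothFieldAt_ofLocalField hw (Z := fun _ => x) contDiffAt_const
  rw [S.sliceParam_domChart hp] at h1
  refine ⟨_, h1, ?_⟩
  filter_upwards [(S.domChart p₀).open_source.mem_nhds hp] with q hq
  rw [← S.localField_sliceParam hq, PartialDiffeomorph.localField_ofLocalField
    (S.zero_mem_sliceParam_source ((S.domChart p₀).map_source hq))]

/-- The condition `N_J(TL, TM|_L) ⊆ TL` in slice coordinates. On pairs of vectors of `TL` it always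
holds, so it concerns the mixed block only. -/
lemma isNormallyIntegrable_iff (hJ : IsAlmostComplex 𝓘(ℝ, E) J) (hL : S.IsPHSubmanifold J) :
    S.IsNormallyIntegrable J ↔ ∀ p₀, ∀ u ∈ (S.domChart p₀).target, ∀ x y,
      (localNijenhuis ((S.sliceParam p₀).localEnd J) (u, 0) (x, 0) (0, y)).2 = 0 := by
  constructor
  · intro h p₀ u hu x y
    obtain ⟨p, hp, rfl⟩ : ∃ p ∈ (S.domChart p₀).source, S.domChart p₀ p = u :=
      ⟨_, (S.domChart p₀).map_target hu, (S.domChart p₀).right_inv hu⟩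
    obtain ⟨Y, hY, hYx⟩ := exists_constant_field hp (x, 0)
    obtain ⟨Z, hZ, hZx⟩ := exists_constant_field hp (0, y)
    have h1 := h p Y Z hY hZ ((S.mem_tangent_iff hp _).2 (by rw [hYx.self_of_nhds]))
    rw [S.mem_tangent_iff hp, sliceCoord_nijenhuis hJ hp hY hZ, hYx.self_of_nhds,
      hZx.self_of_nhds] at h1
    exact h1
  · intro h p Y Z hY hZ hYp
    have hp := S.mem_domChart_source p
    have hu := (S.domChart p).map_source hp
    rw [S.mem_tangent_iff hp] at hYp
    rw [S.mem_tangent_iff hp, sliceCoord_nijenhuis hJ hp hY hZ]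
    set y := S.sliceCoord p p (Y (S.incl p))
    set z := S.sliceCoord p p (Z (S.incl p))
    have hy : y = (y.1, 0) := Prod.ext rfl hYp
    have h3 := apply_split (localNijenhuisL ((S.sliceParam p).localEnd J) (S.domChart p p, 0) y) z
    rw [localNijenhuisL_apply, localNijenhuisL_apply, localNijenhuisL_apply] at h3
    rw [h3, hy, Prod.snd_add, h p _ hu, localNijenhuis_tangent hJ hL hu, add_zero]

/-- The normal component of the first derivatives, at a point of `L`, of the Nijenhuis tensor of
two vector fields tangent to `L` there. Under the first two integrability conditions the derivatives
of the vector fields do not contribute, and only the normal part of the direction matters. -/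
lemma sliceCoord_fieldDeriv_nijenhuis (hJ : IsAlmostComplex 𝓘(ℝ, E) J) (hL : S.IsPHSubmanifold J)
    (hp : p ∈ (S.domChart p₀).source)
    (h1 : ∀ x y,
      localNijenhuis ((S.baseParam p₀).localEnd (S.restrict J)) (S.domChart p₀ p) x y = 0)
    (h2 : ∀ x y, (localNijenhuis ((S.sliceParam p₀).localEnd J) (S.domChart p₀ p, 0)
      (x, 0) (0, y)).2 = 0)
    {Y Z : ∀ x : M, TangentSpace 𝓘(ℝ, E) x} (hY : SmoothFieldAt 𝓘(ℝ, E) Y (S.incl p))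
    (hZ : SmoothFieldAt 𝓘(ℝ, E) Z (S.incl p)) {x y : E₁}
    (hYx : S.sliceCoord p₀ p (Y (S.incl p)) = (x, 0))
    (hZy : S.sliceCoord p₀ p (Z (S.incl p)) = (y, 0)) (v : TangentSpace 𝓘(ℝ, E) (S.incl p)) :
    (S.sliceCoord p₀ p (fieldDeriv (nijenhuis J Y Z) (S.incl p) v)).2 =
      (fderiv ℝ (fun z => localNijenhuis ((S.sliceParam p₀).localEnd J) z (x, 0) (y, 0))
        (S.domChart p₀ p, 0) (0, (S.sliceCoord p₀ p v).2)).2 := by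
  have hu := (S.domChart p₀).map_source hp
  have hw := S.zero_mem_sliceParam_source hu
  set Θ := S.sliceParam p₀ with hΘ
  set w : E₁ × F := (S.domChart p₀ p, 0) with hwdef
  have hzero : nijenhuis J Y Z (S.incl p) = 0 := by
    apply S.sliceCoord_injective hp
    rw [sliceCoord_nijenhuis hJ hp hY hZ, hYx, hZy, localNijenhuis_tangent hJ hL hu, h1, map_zero]
    rfl
  have hYw : Θ.localField Y w = (x, 0) := (S.localField_sliceParam hp Y).trans hYx
  have hZw : Θ.localField Z w = (y, 0) := (S.localField_sliceParam hp Z).trans hZy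
  have hxw : Θ w = S.incl p := S.sliceParam_domChart hp
  have hY' := hY
  have hZ' := hZ
  rw [← hxw] at hY' hZ'
  have hdY := (PartialDiffeomorph.contDiffAt_localField hw hY').differentiableAt (by simp)
  have hdZ := (PartialDiffeomorph.contDiffAt_localField hw hZ').differentiableAt (by simp)
  have hloc : Θ.localField (nijenhuis J Y Z) =ᶠ[𝓝 w]
      fun z => localNijenhuis (Θ.localEnd J) z (Θ.localField Y z) (Θ.localField Z z) := by
    have hev : ∀ {A : ∀ x : M, TangentSpace 𝓘(ℝ, E) x}, SmoothFieldAt 𝓘(ℝ, E) A (Θ w) →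
        ∀ᶠ z in 𝓝 w, MDifferentiableAt 𝓘(ℝ, E) 𝓘(ℝ, E).tangent
          (fun y => (⟨y, A y⟩ : TangentBundle 𝓘(ℝ, E) M)) (Θ z) := by
      intro A hA
      have h3 := (contMDiffAt_iff_contMDiffAt_nhds (n := 1) (by simp)).1
        (ContMDiffAt.of_le hA (by simp))
      have h4 := (Θ.contMDiffAt_apply hw).continuousAt.eventually h3
      filter_upwards [h4] with z hz using hz.mdifferentiableAt (by simp)
    filter_upwards [hev hY', hev hZ', Θ.open_source.mem_nhds hw] with z hz₁ hz₂ hz₃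
    exact PartialDiffeomorph.localField_nijenhuis hz₃ hJ hz₁ hz₂
  obtain ⟨hd, hdv⟩ := hasFDerivAt_localNijenhuis (contDiffAt_localEnd_sliceParam hJ hu) hdY hdZ
  -- extend `v` to a vector field, in order to work in coordinates
  let A : ∀ x : M, TangentSpace 𝓘(ℝ, E) x := FiberBundle.extend E v
  have hA : A (S.incl p) = v := FiberBundle.extend_apply_self E v
  have hB := S.localField_sliceParam hp fun x => fieldDeriv (nijenhuis J Y Z) x (A x)
  have hAw := S.localField_sliceParam hp A
  rw [hA] at hB hAw
  rw [← hB, ← hAw, PartialDiffeomorph.localField_apply]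
  rw [← hxw] at hzero
  rw [← PartialDiffeomorph.push_localField (Y := A) hw, fieldDeriv_push hw hzero
    (hd.congr_of_eventuallyEq hloc), PartialDiffeomorph.pull_push hw, hloc.fderiv_eq, hdv, hYw,
    hZw]
  -- by the first two conditions `N_J(TL, TM|_L) ⊆ TL`, which removes the terms with derivatives of
  -- `Y` and `Z`
  have h2' : ∀ (a : E₁ × F) b, (localNijenhuis (Θ.localEnd J) w (b, 0) a).2 = 0 := by
    intro a b
    have h3 := apply_split (localNijenhuisL (Θ.localEnd J) w (b, 0)) a
    rw [localNijenhuisL_apply, localNijenhuisL_apply, localNijenhuisL_apply] at h3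
    rw [h3, Prod.snd_add, h2, localNijenhuis_tangent hJ hL hu, add_zero]
  rw [Prod.snd_add, Prod.snd_add, h2', localNijenhuis_swap, Prod.snd_neg, h2', neg_zero, add_zero,
    add_zero, apply_split, Prod.snd_add, fderiv_localNijenhuis_tangent hJ hL hu, zero_add]

/-- Under the first two integrability conditions, the third one says in slice coordinates that the
normal derivatives of the normal part of the Nijenhuis tensor on `TL` vanish. -/
lemma normalNijenhuisVanishesToSecondOrder_iff (hJ : IsAlmostComplex 𝓘(ℝ, E) J)
    (hL : S.IsPHSubmanifold J)
    (h1 : ∀ p₀, ∀ u ∈ (S.domChart p₀).target, ∀ x y,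
      localNijenhuis ((S.baseParam p₀).localEnd (S.restrict J)) u x y = 0)
    (h2 : ∀ p₀, ∀ u ∈ (S.domChart p₀).target, ∀ x y,
      (localNijenhuis ((S.sliceParam p₀).localEnd J) (u, 0) (x, 0) (0, y)).2 = 0) :
    S.NormalNijenhuisVanishesToSecondOrder J ↔ ∀ p₀, ∀ u ∈ (S.domChart p₀).target, ∀ x y n,
      (fderiv ℝ (fun z => localNijenhuis ((S.sliceParam p₀).localEnd J) z (x, 0) (y, 0))
        (u, 0) (0, n)).2 = 0 := by
  constructor
  · intro h p₀ u hu x y n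
    obtain ⟨p, hp, rfl⟩ : ∃ p ∈ (S.domChart p₀).source, S.domChart p₀ p = u :=
      ⟨_, (S.domChart p₀).map_target hu, (S.domChart p₀).right_inv hu⟩
    obtain ⟨Y, hY, hYx⟩ := exists_constant_field hp (x, 0)
    obtain ⟨Z, hZ, hZy⟩ := exists_constant_field hp (y, 0)
    have htan : ∀ {A : ∀ x : M, TangentSpace 𝓘(ℝ, E) x} {x : E₁},
        (∀ᶠ q in 𝓝 p, S.sliceCoord p₀ q (A (S.incl q)) = (x, 0)) → S.TangentNear A p := by
      intro A x hA
      filter_upwards [hA, (S.domChart p₀).open_source.mem_nhds hp] with q hq hq'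
      rw [S.mem_tangent_iff hq', hq]
    have h3 := (h p Y Z hY hZ (htan hYx) (htan hZy)).2 (S.normalLift p₀ p n)
    rw [S.proj_eq_zero_iff, S.mem_tangent_iff hp, sliceCoord_fieldDeriv_nijenhuis hJ hL hp
      (h1 _ _ hu) (h2 _ _ hu) hY hZ hYx.self_of_nhds hZy.self_of_nhds,
      S.sliceCoord_normalLift hp] at h3
    exact h3
  · intro h p Y Z hY hZ hYp hZp
    have hp := S.mem_domChart_source p
    have hu := (S.domChart p).map_source hp
    have hYp := (S.mem_tangent_iff hp _).1 hYp.self_of_nhds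
    have hZp := (S.mem_tangent_iff hp _).1 hZp.self_of_nhds
    obtain ⟨x, hx⟩ : ∃ x, S.sliceCoord p p (Y (S.incl p)) = (x, 0) := ⟨_, Prod.ext rfl hYp⟩
    obtain ⟨y, hy⟩ : ∃ y, S.sliceCoord p p (Z (S.incl p)) = (y, 0) := ⟨_, Prod.ext rfl hZp⟩
    refine ⟨?_, fun v => ?_⟩
    · rw [S.proj_eq_zero_iff, S.mem_tangent_iff hp, sliceCoord_nijenhuis hJ hp hY hZ, hx, hy,
        localNijenhuis_tangent hJ hL hu]
    · rw [S.proj_eq_zero_iff, S.mem_tangent_iff hp, sliceCoord_fieldDeriv_nijenhuis hJ hL hp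
        (h1 _ _ hu) (h2 _ _ hu) hY hZ hx hy]
      exact h p _ hu x y _

variable {Jc : ∀ a : TotalSpace F S.Normal,
    TangentSpace (𝓘(ℝ, E₁).prod 𝓘(ℝ, F)) a →L[ℝ] TangentSpace (𝓘(ℝ, E₁).prod 𝓘(ℝ, F)) a}

/-- Integrability of the limit structure, in coordinates. -/
lemma IsLinearizationOf.isIntegrable_iff_coord (hJc : S.IsLinearizationOf J Jc)
    (hJ : IsAlmostComplex 𝓘(ℝ, E) J) (hL : S.IsPHSubmanifold J) :
    IsIntegrable (I := 𝓘(ℝ, E₁).prod 𝓘(ℝ, F)) Jc ↔ ∀ p₀, ∀ u ∈ (S.domChart p₀).target,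
      (∀ x y, localNijenhuis ((S.baseParam p₀).localEnd (S.restrict J)) u x y = 0) ∧
      (∀ x y, (localNijenhuis ((S.sliceParam p₀).localEnd J) (u, 0) (x, 0) (0, y)).2 = 0) ∧
      ∀ x y n, (fderiv ℝ (fun z => localNijenhuis ((S.sliceParam p₀).localEnd J) z (x, 0) (y, 0))
        (u, 0) (0, n)).2 = 0 := by
  have hK := hJc.isAlmostComplex hJ hL
  have hN : ∀ p₀, ∀ w ∈ (S.bundleParam p₀).source, ∀ X X',
      localNijenhuis ((S.bundleParam p₀).localEnd Jc) w X X' =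
      (localNijenhuis ((S.baseParam p₀).localEnd (S.restrict J)) w.1 X.1 X'.1,
        (fderiv ℝ (fun z => localNijenhuis ((S.sliceParam p₀).localEnd J) z (X.1, 0) (X'.1, 0))
          (w.1, 0) (0, w.2)).2 +
        (localNijenhuis ((S.sliceParam p₀).localEnd J) (w.1, 0) (0, X.2) (X'.1, 0)).2 +
        (localNijenhuis ((S.sliceParam p₀).localEnd J) (w.1, 0) (X.1, 0) (0, X'.2)).2) := by
    intro p₀ w hw X X'
    have hu := S.mem_bundleParam_source.1 hw
    have e1 : (S.bundleParam p₀).localEnd Jc =ᶠ[𝓝 w]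
        linearization ((S.sliceParam p₀).localEnd J) := by
      filter_upwards [(S.bundleParam p₀).open_source.mem_nhds hw] with z hz using hJc p₀ z hz
    rw [localNijenhuis, e1.fderiv_eq, e1.self_of_nhds, ← localNijenhuis,
      localNijenhuis_linearization (contDiffAt_localEnd_sliceParam hJ hu) (by
        filter_upwards [(S.domChart p₀).open_target.mem_nhds hu] with v hv
        exact hL.localEnd_snd hv),
      localNijenhuis_tangent hJ hL hu]
  have h00 : ∀ 𝒥 : E₁ × F → E₁ × F →L[ℝ] E₁ × F, ∀ w v,
      localNijenhuis 𝒥 w ((0 : E₁), (0 : F)) v = 0 := fun 𝒥 w v =>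
    DFunLike.congr_fun (map_zero (localNijenhuisL 𝒥 w)) v
  have h00' : ∀ 𝒥 : E₁ × F → E₁ × F →L[ℝ] E₁ × F, ∀ w v,
      localNijenhuis 𝒥 w v ((0 : E₁), (0 : F)) = 0 := fun 𝒥 w v =>
    map_zero (localNijenhuisL 𝒥 w v)
  constructor
  · intro h p₀ u hu
    -- the mixed block is read off at the points of the zero section, on a horizontal and a vertical
    -- vector; then two horizontal vectors at `(u, n)` give the remaining conditions
    have h1 : ∀ n X X', localNijenhuis ((S.bundleParam p₀).localEnd Jc) (u, n) X X' = 0 :=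
      fun n => (PartialDiffeomorph.nijenhuis_eq_zero_iff (w := (u, n)) (θ := S.bundleParam p₀)
        (S.mem_bundleParam_source.2 hu) hK).1 (h _)
    have h2 := fun n X X' => (hN p₀ (u, n) (S.mem_bundleParam_source.2 hu) X X').symm.trans
      (h1 n X X')
    have hsw : ∀ x y,
        (localNijenhuis ((S.sliceParam p₀).localEnd J) (u, 0) (x, 0) (0, y)).2 = 0 := by
      intro x y
      have h3 := congrArg Prod.snd (h2 0 (x, 0) (0, y))
      simpa [h00, h00'] using h3
    refine ⟨fun x y => congrArg Prod.fst (h2 0 (x, 0) (y, 0)), hsw, fun x y n => ?_⟩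
    have h3 := congrArg Prod.snd (h2 n (x, 0) (y, 0))
    simpa [h00, h00'] using h3
  · intro h a
    obtain ⟨p₀, w, hw, rfl⟩ := S.exists_bundleParam_eq a
    have hu := S.mem_bundleParam_source.1 hw
    obtain ⟨h1, h2, h3⟩ := h p₀ w.1 hu
    refine (PartialDiffeomorph.nijenhuis_eq_zero_iff hw hK).2 fun X X' => ?_
    rw [hN p₀ w hw, h1, h2, h3, localNijenhuis_swap, Prod.snd_neg, h2]
    simp

/-- The limit structure is integrable if and only if `J` restricts to an integrable structure on
`L`, is normally integrable along `L`, and its normal Nijenhuis tensor vanishes on `TL` to second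
order. -/
theorem IsLinearizationOf.isIntegrable_iff (hJc : S.IsLinearizationOf J Jc)
    (hJ : IsAlmostComplex 𝓘(ℝ, E) J) (hL : S.IsPHSubmanifold J) :
    IsIntegrable (I := 𝓘(ℝ, E₁).prod 𝓘(ℝ, F)) Jc ↔
      IsIntegrable (I := 𝓘(ℝ, E₁)) (S.restrict J) ∧ S.IsNormallyIntegrable J ∧
        S.NormalNijenhuisVanishesToSecondOrder J := by
  rw [hJc.isIntegrable_iff_coord hJ hL, isIntegrable_restrict_iff hJ hL,
    isNormallyIntegrable_iff hJ hL]
  constructor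
  · intro h
    have h1 := fun p₀ u hu => (h p₀ u hu).1
    have h2 := fun p₀ u hu => (h p₀ u hu).2.1
    exact ⟨h1, h2, (normalNijenhuisVanishesToSecondOrder_iff hJ hL h1 h2).2
      fun p₀ u hu => (h p₀ u hu).2.2⟩
  · rintro ⟨h1, h2, h3⟩ p₀ u hu
    exact ⟨h1 p₀ u hu, h2 p₀ u hu,
      (normalNijenhuisVanishesToSecondOrder_iff hJ hL h1 h2).1 h3 p₀ u hu⟩

end EmbeddedSubmanifold

/-! ### Existence of invariant complements -/

namespace EmbeddedSubmanifold

variable {E₁ F L E M : Type*}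
    [NormedAddCommGroup E₁] [NormedSpace ℝ E₁] [NormedAddCommGroup F] [NormedSpace ℝ F]
    [NormedAddCommGroup E] [NormedSpace ℝ E]
    [TopologicalSpace L] [ChartedSpace E₁ L] [IsManifold 𝓘(ℝ, E₁) ∞ L]
    [TopologicalSpace M] [ChartedSpace E M] [IsManifold 𝓘(ℝ, E) ∞ M]
    {S : EmbeddedSubmanifold E₁ F L E M}
    {J : ∀ x : M, TangentSpace 𝓘(ℝ, E) x →L[ℝ] TangentSpace 𝓘(ℝ, E) x}
    {VX HX X : Type*} [NormedAddCommGroup VX] [NormedSpace ℝ VX]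
    [TopologicalSpace HX] {IX : ModelWithCorners ℝ VX HX} [TopologicalSpace X] [ChartedSpace HX X]

/-- The projection `TM|_L → N_LM` is smooth. -/
lemma contMDiffAt_proj {b : X → L} {v : ∀ x, TangentSpace 𝓘(ℝ, E) (S.incl (b x))} {x₀ : X}
    (hb : ContMDiffAt IX 𝓘(ℝ, E₁) ∞ b x₀)
    (hv : ContMDiffAt IX 𝓘(ℝ, E).tangent ∞
      (fun x => (⟨S.incl (b x), v x⟩ : TangentBundle 𝓘(ℝ, E) M)) x₀) :
    ContMDiffAt IX (𝓘(ℝ, E₁).prod 𝓘(ℝ, F)) ∞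
      (fun x => (⟨b x, S.proj (b x) (v x)⟩ : TotalSpace F S.Normal)) x₀ := by
  refine contMDiffAt_totalSpace.2 ⟨hb, ?_⟩
  have hp := S.mem_domChart_source (b x₀)
  have h1 := contMDiffAt_sliceCoord (p₀ := b x₀) hv hb.continuousAt hp
  have h2 := (contDiff_snd (𝕜 := ℝ) (E := E₁) (F := F) (n := ∞)).contMDiff.contMDiffAt.comp x₀ h1
  refine h2.congr_of_eventuallyEq ?_
  filter_upwards [hb.continuousAt ((S.domChart (b x₀)).open_source.mem_nhds hp)] with x hx
  exact S.normalCoordQ_proj (b x₀) hx (v x)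

/-- The lift of normal vectors to `TM|_L` by a slice chart is smooth. -/
lemma contMDiffAt_normalLift {p₀ : L} {b : X → L} {f : X → F} {x₀ : X}
    (hb : ContMDiffAt IX 𝓘(ℝ, E₁) ∞ b x₀) (hx₀ : b x₀ ∈ (S.domChart p₀).source)
    (hf : ContMDiffAt IX 𝓘(ℝ, F) ∞ f x₀) :
    ContMDiffAt IX 𝓘(ℝ, E).tangent ∞
      (fun x => (⟨S.incl (b x), S.normalLift p₀ (b x) (f x)⟩ : TangentBundle 𝓘(ℝ, E) M)) x₀ := by
  refine contMDiffAt_of_sliceCoord hb hx₀ ?_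
  have h4 : ContDiff ℝ ∞ fun n : F => ((0 : E₁), n) := by fun_prop
  refine (h4.contMDiff.contMDiffAt.comp x₀ hf).congr_of_eventuallyEq ?_
  filter_upwards [hb.continuousAt ((S.domChart p₀).open_source.mem_nhds hx₀)] with x hx
  exact S.sliceCoord_normalLift hx (f x)

variable [FiniteDimensional ℝ E₁] [FiniteDimensional ℝ F]

/-- There are smooth complements of `TL` in `TM|_L`: a partition of unity glues those given by
slice charts. -/
lemma exists_complement [T2Space L] [SigmaCompactSpace L] :
    ∃ σ : ∀ p : L, S.Normal p →L[ℝ] TangentSpace 𝓘(ℝ, E) (S.incl p),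
      (∀ p n, S.proj p (σ p n) = n) ∧
      ContMDiff (𝓘(ℝ, E₁).prod 𝓘(ℝ, F)) 𝓘(ℝ, E).tangent ∞ (fun a : TotalSpace F S.Normal =>
        (⟨S.incl a.proj, σ a.proj a.2⟩ : TangentBundle 𝓘(ℝ, E) M)) := by
  obtain ⟨ρ, hρ⟩ := SmoothPartitionOfUnity.exists_isSubordinate 𝓘(ℝ, E₁) (s := (univ : Set L))
    isClosed_univ (fun i : L => (S.domChart i).source) (fun i => (S.domChart i).open_source)
    (fun p _ => mem_iUnion.2 ⟨p, S.mem_domChart_source p⟩)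
  let σi : L → ∀ p : L, S.Normal p →L[ℝ] TangentSpace 𝓘(ℝ, E) (S.incl p) := fun i p =>
    (S.normalLift i p).comp (S.normalCoordQ i p)
  let σ : ∀ p : L, S.Normal p →L[ℝ] TangentSpace 𝓘(ℝ, E) (S.incl p) := fun p =>
    ∑ i ∈ ρ.finsupport p, ρ i p • σi i p
  have hsupp : ∀ {p i}, i ∈ ρ.finsupport p → p ∈ (S.domChart i).source := fun hi =>
    hρ _ (subset_tsupport _ ((ρ.mem_finsupport _).1 hi))
  have hσ : ∀ p n, σ p n = ∑ i ∈ ρ.finsupport p, ρ i p • σi i p n := by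
    intro p n
    exact _root_.sum_apply _ _ _
  refine ⟨σ, ?_, ?_⟩
  · intro p n
    rw [hσ, map_sum]
    have h1 : ∀ i ∈ ρ.finsupport p, S.proj p (ρ i p • σi i p n) = ρ i p • n := by
      intro i hi
      rw [map_smul]
      exact congrArg (ρ i p • ·) (S.proj_lift_normalCoordQ i (hsupp hi) n)
    rw [Finset.sum_congr rfl h1, ← Finset.sum_smul, ρ.sum_finsupport p (mem_univ p), one_smul]
  · intro a
    have hproj : ContMDiff (𝓘(ℝ, E₁).prod 𝓘(ℝ, F)) 𝓘(ℝ, E₁) ∞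
      (TotalSpace.proj : TotalSpace F S.Normal → L) := contMDiff_proj S.Normal
    have ha := S.mem_domChart_source a.proj
    refine contMDiffAt_of_sliceCoord (p₀ := a.proj) hproj.contMDiffAt ha ?_
    -- the sum over the supports at nearby points is a sum over the support near the point
    let s := ρ.fintsupport a.proj
    have h1 : ContMDiffAt (𝓘(ℝ, E₁).prod 𝓘(ℝ, F)) 𝓘(ℝ, E₁ × F) ∞
        (fun b : TotalSpace F S.Normal => ∑ i ∈ s, ρ i b.proj •
          S.sliceCoord a.proj b.proj (σi i b.proj b.2)) a := by
      refine ContMDiffAt.sum fun i hi => ?_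
      have hi' : a.proj ∈ (S.domChart i).source := hρ i ((ρ.mem_fintsupport_iff _ i).1 hi)
      refine ContMDiffAt.smul ((ρ i).contMDiff.contMDiffAt.comp a hproj.contMDiffAt) ?_
      refine contMDiffAt_sliceCoord ?_ hproj.contMDiffAt.continuousAt ha
      refine contMDiffAt_normalLift hproj.contMDiffAt hi' ?_
      have hi2 : a ∈ (S.bundleParam i).target := hi'
      exact contDiff_snd.contMDiff.contMDiffAt.comp a
        ((S.bundleParam i).contMDiffAt_symm_apply hi2)
    refine h1.congr_of_eventuallyEq ?_
    filter_upwards [hproj.continuous.continuousAt.eventually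
      (ρ.eventually_finsupport_subset a.proj)] with b hb
    rw [hσ, map_sum]
    rw [Finset.sum_subset hb]
    · exact Finset.sum_congr rfl fun i _ => map_smul _ _ _
    · intro i _ hi
      have : ρ i b.proj = 0 := by
        by_contra h
        exact hi ((ρ.mem_finsupport _).2 h)
      rw [this, zero_smul, map_zero]

/-- There are smooth `J`-invariant complements of `TL` in `TM|_L`. -/
theorem exists_isInvariantComplement [FiniteDimensional ℝ E] [T2Space L] [SigmaCompactSpace L]
    (hJ : IsAlmostComplex 𝓘(ℝ, E) J) (hL : S.IsPHSubmanifold J) :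
    ∃ σ, S.IsInvariantComplement J σ := by
  obtain ⟨τ, hτ, hτs⟩ := S.exists_complement
  -- the complex linear part `(τ - J τ χ J τ) / 2` of `τ`; here `χ J τ` is the complex structure
  -- that `J` induces on the normal spaces
  let σ : ∀ p : L, S.Normal p →L[ℝ] TangentSpace 𝓘(ℝ, E) (S.incl p) := fun p =>
    (1 / 2 : ℝ) • (τ p - (J (S.incl p)).comp ((τ p).comp ((S.proj p).comp
      ((J (S.incl p)).comp (τ p)))))
  have hσ : ∀ p n, σ p n = (1 / 2 : ℝ) • (τ p n -
      J (S.incl p) (τ p (S.proj p (J (S.incl p) (τ p n))))) := fun p n => rfl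
  have hq : ∀ p v, S.proj p (J (S.incl p) (τ p (S.proj p v))) = S.proj p (J (S.incl p) v) := by
    intro p v
    rw [← sub_eq_zero, ← map_sub, ← map_sub, S.proj_eq_zero_iff]
    apply hL
    rw [← S.proj_eq_zero_iff, map_sub, hτ, sub_self]
  refine ⟨σ, ?_, ?_, ?_⟩
  · intro p n
    rw [hσ, map_smul, map_sub, hq, hτ, hJ.sq, map_neg, hτ, sub_neg_eq_add, ← two_smul ℝ, smul_smul]
    norm_num
  · intro p n
    refine ⟨S.proj p (J (S.incl p) (τ p n)), ?_⟩
    rw [hσ, hσ, map_smul, map_sub, hJ.sq, hq, hJ.sq, map_neg, map_neg, map_neg, hτ,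
      sub_neg_eq_add, sub_neg_eq_add, add_comm]
  · have hproj : ContMDiff (𝓘(ℝ, E₁).prod 𝓘(ℝ, F)) 𝓘(ℝ, E₁) ∞
      (TotalSpace.proj : TotalSpace F S.Normal → L) := contMDiff_proj S.Normal
    have hJs : ∀ {v : ∀ a : TotalSpace F S.Normal, TangentSpace 𝓘(ℝ, E) (S.incl a.proj)},
        ContMDiff (𝓘(ℝ, E₁).prod 𝓘(ℝ, F)) 𝓘(ℝ, E).tangent ∞ (fun a : TotalSpace F S.Normal =>
          (⟨S.incl a.proj, v a⟩ : TangentBundle 𝓘(ℝ, E) M)) →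
        ContMDiff (𝓘(ℝ, E₁).prod 𝓘(ℝ, F)) 𝓘(ℝ, E).tangent ∞ (fun a : TotalSpace F S.Normal =>
          (⟨S.incl a.proj, J _ (v a)⟩ : TangentBundle 𝓘(ℝ, E) M)) := by
      intro v hv a
      exact ContMDiffAt.clm_bundle_apply (hJ.smooth.contMDiffAt.comp a
        (S.isImmersion.contMDiff.contMDiffAt.comp a hproj.contMDiffAt)) hv.contMDiffAt
    have h1 := hJs hτs
    have h2 : ContMDiff (𝓘(ℝ, E₁).prod 𝓘(ℝ, F)) (𝓘(ℝ, E₁).prod 𝓘(ℝ, F)) ∞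
        (fun a : TotalSpace F S.Normal =>
          (⟨a.proj, S.proj _ (J _ (τ a.proj a.2))⟩ : TotalSpace F S.Normal)) := fun a =>
      contMDiffAt_proj hproj.contMDiffAt h1.contMDiffAt
    have hc : ContMDiff (𝓘(ℝ, E₁).prod 𝓘(ℝ, F)) 𝓘(ℝ, E).tangent ∞
        (fun a : TotalSpace F S.Normal => (⟨S.incl a.proj,
          τ a.proj (S.proj a.proj (J _ (τ a.proj a.2)))⟩ : TangentBundle 𝓘(ℝ, E) M)) :=
      hτs.comp h2
    have h3 := hJs (v := fun a => τ a.proj (S.proj a.proj (J _ (τ a.proj a.2)))) hc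
    intro a
    have ha := S.mem_domChart_source a.proj
    refine contMDiffAt_of_sliceCoord (p₀ := a.proj) hproj.contMDiffAt ha ?_
    have e1 := contMDiffAt_sliceCoord (p₀ := a.proj) hτs.contMDiffAt
      hproj.contMDiffAt.continuousAt ha
    have e2 := contMDiffAt_sliceCoord (p₀ := a.proj) h3.contMDiffAt
      hproj.contMDiffAt.continuousAt ha
    have e0 : ContMDiffAt (𝓘(ℝ, E₁).prod 𝓘(ℝ, F)) 𝓘(ℝ, ℝ) ∞
        (fun _ : TotalSpace F S.Normal => (1 / 2 : ℝ)) a := contMDiffAt_const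
    have e3 : ContMDiffAt (𝓘(ℝ, E₁).prod 𝓘(ℝ, F)) 𝓘(ℝ, E₁ × F) ∞
        (fun b : TotalSpace F S.Normal => (1 / 2 : ℝ) • (S.sliceCoord a.proj b.proj (τ b.proj b.2) -
          S.sliceCoord a.proj b.proj (J _ (τ b.proj (S.proj b.proj (J _ (τ b.proj b.2))))))) a :=
      e0.smul (e1.sub e2)
    refine e3.congr_of_eventuallyEq (Eventually.of_forall fun b => ?_)
    exact (congrArg (S.sliceCoord a.proj b.proj) (hσ b.proj b.2)).trans
      ((map_smul _ _ _).trans (congrArg ((1 / 2 : ℝ) • ·) (map_sub _ _ _)))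

end EmbeddedSubmanifold

/-! ### Existence of minimal connections -/

section LocalMinimal

variable {W : Type*} [NormedAddCommGroup W] [NormedSpace ℝ W]

/-- The coefficients of a minimal connection for the field `𝒥` of complex structures on a vector
space: they are obtained from the flat connection by first averaging it to a complex connection
and then by correcting the torsion with a tensor that commutes with `𝒥`. -/
def minimalCoefficients (𝒥 : W → W →L[ℝ] W) (w : W) : W →L[ℝ] W →L[ℝ] W :=
  (-(1 / 2) : ℝ) • ((ContinuousLinearMap.compL ℝ W W W (𝒥 w)).comp (fderiv ℝ 𝒥 w)).flip
    - (1 / 4 : ℝ) • ((fderiv ℝ 𝒥 w).comp (𝒥 w)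
      + (ContinuousLinearMap.compL ℝ W W W (𝒥 w)).comp (fderiv ℝ 𝒥 w))

variable {𝒥 : W → W →L[ℝ] W} {w : W}

lemma minimalCoefficients_apply (y v : W) :
    minimalCoefficients 𝒥 w y v = (-(1 / 2) : ℝ) • 𝒥 w (fderiv ℝ 𝒥 w v y)
      - (1 / 4 : ℝ) • (fderiv ℝ 𝒥 w (𝒥 w y) v + 𝒥 w (fderiv ℝ 𝒥 w y v)) := rfl

lemma contDiffAt_minimalCoefficients (h : ContDiffAt ℝ ∞ 𝒥 w) :
    ContDiffAt ℝ ∞ (minimalCoefficients 𝒥) w := by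
  have h2 : ContDiffAt ℝ ∞ (fderiv ℝ 𝒥) w := h.fderiv_right (m := ∞) (by simp)
  have hc : ContDiffAt ℝ ∞ (fun z => (fderiv ℝ 𝒥 z).comp (𝒥 z)) w := h2.clm_comp h
  have hL : ContDiffAt ℝ ∞ (fun z => (ContinuousLinearMap.compL ℝ W W W (𝒥 z)).comp
      (fderiv ℝ 𝒥 z)) w :=
    ((ContinuousLinearMap.compL ℝ W W W).contDiff.contDiffAt.comp w h).clm_comp h2
  have hf : ContDiffAt ℝ ∞ (fun z => ((ContinuousLinearMap.compL ℝ W W W (𝒥 z)).comp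
      (fderiv ℝ 𝒥 z)).flip) w :=
    (ContinuousLinearMap.flipₗᵢ ℝ W W W).toContinuousLinearEquiv.contDiff.contDiffAt.comp w hL
  exact (hf.const_smul (-(1 / 2) : ℝ)).sub ((hc.add hL).const_smul (1 / 4 : ℝ))

/-- The derivative of a field of complex structures anticommutes with it. -/
lemma fderiv_anticomm (h : DifferentiableAt ℝ 𝒥 w) (hsq : ∀ᶠ z in 𝓝 w, ∀ x, 𝒥 z (𝒥 z x) = -x)
    (v x : W) : fderiv ℝ 𝒥 w v (𝒥 w x) = -𝒥 w (fderiv ℝ 𝒥 w v x) := by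
  have h1 : DifferentiableAt ℝ (fun z => 𝒥 z x) w := h.clm_apply (differentiableAt_const x)
  have e1 : (fun z => 𝒥 z (𝒥 z x)) =ᶠ[𝓝 w] fun _ => -x := hsq.mono fun z hz => hz x
  have e2 := fderiv_clm_apply_apply h h1 v
  have e3 := fderiv_clm_apply_apply h (differentiableAt_const x) v
  rw [e3, e1.fderiv_eq] at e2
  simp at e2
  exact eq_neg_of_add_eq_zero_left e2.symm

/-- The connection is complex. -/
lemma minimalCoefficients_comm (h : DifferentiableAt ℝ 𝒥 w)
    (hsq : ∀ᶠ z in 𝓝 w, ∀ x, 𝒥 z (𝒥 z x) = -x) (y v : W) :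
    fderiv ℝ 𝒥 w v y + minimalCoefficients 𝒥 w (𝒥 w y) v =
      𝒥 w (minimalCoefficients 𝒥 w y v) := by
  have hs := hsq.self_of_nhds
  simp only [minimalCoefficients_apply, map_sub, map_add, map_smul, hs, fderiv_anticomm h hsq,
    map_neg, _root_.neg_apply]
  module

/-- The torsion of the connection is a quarter of the Nijenhuis tensor. -/
lemma minimalCoefficients_torsion (y z : W) :
    minimalCoefficients 𝒥 w z y - minimalCoefficients 𝒥 w y z =
      (1 / 4 : ℝ) • localNijenhuis 𝒥 w y z := by
  simp only [minimalCoefficients_apply, localNijenhuis]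
  module

end LocalMinimal

section Connection

variable {W E M : Type*} [NormedAddCommGroup W] [NormedSpace ℝ W] [FiniteDimensional ℝ W]
  [NormedAddCommGroup E] [NormedSpace ℝ E] [FiniteDimensional ℝ E]
  [TopologicalSpace M] [ChartedSpace E M] [IsManifold 𝓘(ℝ, E) ∞ M] [IsManifold 𝓘(ℝ, E) 1 M]
  {J : ∀ x : M, TangentSpace 𝓘(ℝ, E) x →L[ℝ] TangentSpace 𝓘(ℝ, E) x}

namespace PartialDiffeomorph

/-- The minimal connection on the image of a local parametrization with the coefficients
`minimalCoefficients`. -/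
def minimalConnection (θ : PartialDiffeomorph 𝓘(ℝ, W) 𝓘(ℝ, E) W M ∞)
    (J : ∀ x : M, TangentSpace 𝓘(ℝ, E) x →L[ℝ] TangentSpace 𝓘(ℝ, E) x) :
    (∀ x : M, TangentSpace 𝓘(ℝ, E) x) →
      ∀ x : M, TangentSpace 𝓘(ℝ, E) x →L[ℝ] TangentSpace 𝓘(ℝ, E) x :=
  θ.coordConnection (minimalCoefficients (θ.localEnd J))

variable {θ : PartialDiffeomorph 𝓘(ℝ, W) 𝓘(ℝ, E) W M ∞}

/-- The three conditions are `minimalCoefficients_comm`, `minimalCoefficients_torsion`, and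
smoothness of the coefficients. -/
lemma isMinimalConnectionOn_minimalConnection (hJ : IsAlmostComplex 𝓘(ℝ, E) J) :
    IsMinimalConnectionOn J θ.target (θ.minimalConnection J) := by
  have hpt : ∀ {x}, x ∈ θ.target → ∃ w ∈ θ.source, θ w = x := fun hx =>
    ⟨θ.symm _, θ.map_target_apply hx, θ.right_inv_apply hx⟩
  have hd : ∀ {w}, w ∈ θ.source → ContDiffAt ℝ ∞ (θ.localEnd J) w := fun hw =>
    contDiffAt_localEnd hw (hJ.smooth _)
  refine ⟨θ.open_target, isCovariantDerivativeOn_coordConnection, ⟨?_⟩, ?_, ?_⟩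
  · intro Y hY x hx
    obtain ⟨w, hw, rfl⟩ := hpt hx
    exact (contMDiffAt_coordConnection hw (contDiffAt_minimalCoefficients (hd hw))
      ((hY _ hx).contMDiffAt (θ.open_target.mem_nhds hx))).contMDiffWithinAt
  · intro x hx Y hY v
    obtain ⟨w, hw, rfl⟩ := hpt hx
    have hsq : ∀ᶠ z in 𝓝 w, ∀ x, θ.localEnd J z (θ.localEnd J z x) = -x := by
      filter_upwards [θ.open_source.mem_nhds hw] with z hz using localEnd_sq hz (hJ.sq _)
    have hc : θ.localField (fun x => J x (Y x)) =ᶠ[𝓝 w]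
        fun z => θ.localEnd J z (θ.localField Y z) := by
      filter_upwards [θ.open_source.mem_nhds hw] with z hz using localField_end hz
    have hd' := (hd hw).differentiableAt (by simp)
    obtain ⟨v, rfl⟩ : ∃ u, θ.push w u = v := ⟨_, push_pull hw v⟩
    rw [minimalConnection, coordConnection_apply hw, coordConnection_apply hw, ← push_localEnd hw,
      hc.fderiv_eq, hc.self_of_nhds, fderiv_clm_apply_apply hd'
        (differentiableAt_localField hw (hY.mdifferentiableAt (by simp))),
      map_add (θ.localEnd J w), ← minimalCoefficients_comm hd' hsq]
    congr 1
    beta_reduce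
    abel
  · intro x hx Y Z hY hZ
    obtain ⟨w, hw, rfl⟩ := hpt hx
    have hY' := hY.mdifferentiableAt (n := ∞) (by simp)
    have hZ' := hZ.mdifferentiableAt (n := ∞) (by simp)
    have hN := localField_nijenhuis hw hJ hY' hZ'
    have hB := localField_mlieBracket hw hY' hZ'
    rw [← push_localField (Y := nijenhuis J Y Z) hw, hN,
      ← push_localField (Y := VectorField.mlieBracket 𝓘(ℝ, E) Y Z) hw, hB,
      ← push_localField (Y := Y) hw, ← push_localField (Y := Z) hw, minimalConnection,
      coordConnection_apply hw, coordConnection_apply hw, ← map_sub, ← map_sub, ← map_smul,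
      ← minimalCoefficients_torsion, VectorField.lieBracket]
    congr 1
    abel

end PartialDiffeomorph

end Connection

section Gluing

variable {E M : Type*} [NormedAddCommGroup E] [NormedSpace ℝ E] [FiniteDimensional ℝ E]
  [TopologicalSpace M] [ChartedSpace E M] [IsManifold 𝓘(ℝ, E) ∞ M]

/-- A partition of unity on the union of a family of open sets, extended by zero. -/
lemma exists_partitionOfUnity_iUnion [T2Space M] [SigmaCompactSpace M] {ι : Type*} {V : ι → Set M}
    (hV : ∀ i, IsOpen (V i)) :
    ∃ f : ι → M → ℝ, (∀ i, ∀ x ∈ ⋃ i, V i, ContMDiffAt 𝓘(ℝ, E) 𝓘(ℝ, ℝ) ∞ (f i) x) ∧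
      ∀ x ∈ ⋃ i, V i, ∃ s : Finset ι, (∀ i ∈ s, x ∈ V i) ∧
        ∀ᶠ y in 𝓝 x, (∀ i, i ∉ s → f i y = 0) ∧ ∑ i ∈ s, f i y = 1 := by
  classical
  -- the partition of unity lives on the union, as an open submanifold
  let U : TopologicalSpace.Opens M := ⟨⋃ i, V i, isOpen_iUnion hV⟩
  have : SecondCountableTopology M := ChartedSpace.secondCountable_of_sigmaCompact E M
  have : LocallyCompactSpace M := ChartedSpace.locallyCompactSpace E M
  have : LocallyCompactSpace U := U.isOpen.locallyCompactSpace
  have : SigmaCompactSpace U := inferInstance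
  obtain ⟨ρ, hρ⟩ := SmoothPartitionOfUnity.exists_isSubordinate 𝓘(ℝ, E) (s := (univ : Set U))
    isClosed_univ (fun i => ((↑) : U → M) ⁻¹' V i) (fun i => (hV i).preimage continuous_subtype_val)
    (fun x _ => by
      obtain ⟨i, hi⟩ := mem_iUnion.1 x.2
      exact mem_iUnion.2 ⟨i, hi⟩)
  let f : ι → M → ℝ := fun i x => if h : x ∈ U then ρ i ⟨x, h⟩ else 0
  have hf : ∀ i (x : U), f i x = ρ i x := fun i x => dif_pos x.2
  refine ⟨f, fun i x hx => ?_, fun x hx => ?_⟩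
  · refine (contMDiffAt_subtype_iff (U := U) (x := ⟨x, hx⟩)).1 ?_
    exact (ρ i).contMDiff.contMDiffAt.congr_of_eventuallyEq (Eventually.of_forall (hf i))
  · refine ⟨ρ.fintsupport ⟨x, hx⟩, fun i hi => hρ i ((ρ.mem_fintsupport_iff _ i).1 hi), ?_⟩
    have h1 := ρ.eventually_finsupport_subset ⟨x, hx⟩
    rw [← map_nhds_subtype_coe_eq_nhds hx (U.isOpen.mem_nhds hx), eventually_map]
    filter_upwards [h1] with y hy
    have h0 : ∀ i, i ∉ ρ.fintsupport ⟨x, hx⟩ → ρ i y = 0 := by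
      intro i hi
      by_contra h
      exact hi (hy ((ρ.mem_finsupport _).2 h))
    refine ⟨fun i hi => (hf i y).trans (h0 i hi), ?_⟩
    rw [Finset.sum_congr rfl fun i _ => hf i y, ← ρ.sum_finsupport y (mem_univ y)]
    exact (Finset.sum_subset hy fun i _ hi => by
      by_contra h
      exact hi ((ρ.mem_finsupport _).2 h)).symm

variable [IsManifold 𝓘(ℝ, E) 1 M]

/-- Minimal connections can be glued: at each point the conditions are affine, and the glued
connection is a combination with coefficients of sum one. -/
lemma exists_isMinimalConnectionOn_iUnion [T2Space M] [SigmaCompactSpace M]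
    {J : ∀ x : M, TangentSpace 𝓘(ℝ, E) x →L[ℝ] TangentSpace 𝓘(ℝ, E) x} {ι : Type*} {V : ι → Set M}
    {c : ι → (∀ x : M, TangentSpace 𝓘(ℝ, E) x) →
      (∀ x : M, TangentSpace 𝓘(ℝ, E) x →L[ℝ] TangentSpace 𝓘(ℝ, E) x)}
    (hc : ∀ i, IsMinimalConnectionOn J (V i) (c i)) :
    ∃ cov, IsMinimalConnectionOn J (⋃ i, V i) cov ∧ ∀ x ∈ ⋃ i, V i, ∃ (s : Finset ι) (a : ι → ℝ),
      (∀ i ∈ s, x ∈ V i) ∧ ∀ Y, cov Y x = ∑ i ∈ s, a i • c i Y x := by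
  obtain ⟨f, hf, hs⟩ := exists_partitionOfUnity_iUnion (E := E) fun i => (hc i).isOpen
  let cov : (∀ x : M, TangentSpace 𝓘(ℝ, E) x) →
      (∀ x : M, TangentSpace 𝓘(ℝ, E) x →L[ℝ] TangentSpace 𝓘(ℝ, E) x) := fun Y x =>
    ∑ᶠ i, f i x • c i Y x
  -- the sum is locally finite: near each point it is the sum over a fixed finite set
  have hcov : ∀ x (s : Finset ι), (∀ i, i ∉ s → f i x = 0) → ∀ Y,
      cov Y x = ∑ i ∈ s, f i x • c i Y x := by
    intro x s h Y
    refine finsum_eq_sum_of_support_subset _ fun i hi => ?_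
    by_contra h'
    exact hi (by simp only [h i h', zero_smul])
  have key : ∀ x ∈ ⋃ i, V i, ∃ s : Finset ι, (∀ i ∈ s, x ∈ V i) ∧
      (∀ Y, cov Y x = ∑ i ∈ s, f i x • c i Y x) ∧ ∑ i ∈ s, f i x = 1 := by
    intro x hx
    obtain ⟨s, h1, h2⟩ := hs x hx
    exact ⟨s, h1, hcov x s h2.self_of_nhds.1, h2.self_of_nhds.2⟩
  refine ⟨cov, ⟨isOpen_iUnion fun i => (hc i).isOpen, ⟨?_, ?_⟩, ⟨?_⟩, ?_, ?_⟩, fun x hx => ?_⟩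
  · intro Y Z x hY hZ hx
    obtain ⟨s, h1, h2, -⟩ := key x hx
    rw [h2, h2, h2, ← Finset.sum_add_distrib]
    refine Finset.sum_congr rfl fun i hi => ?_
    rw [(hc i).isCovariantDerivativeOn.add hY hZ (h1 i hi), smul_add]
  · intro Y g x hY hg hx
    obtain ⟨s, h1, h2, h3⟩ := key x hx
    rw [h2, h2, Finset.smul_sum]
    have e : ∀ i ∈ s, f i x • c i (g • Y) x = g x • f i x • c i Y x +
        f i x • (show TangentSpace 𝓘(ℝ, E) x →L[ℝ] ℝ from
          mfderiv 𝓘(ℝ, E) 𝓘(ℝ, ℝ) g x).smulRight (Y x) := by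
      intro i hi
      rw [(hc i).isCovariantDerivativeOn.leibniz hY hg (h1 i hi), smul_add, smul_comm]
      rfl
    rw [Finset.sum_congr rfl e, Finset.sum_add_distrib, ← Finset.sum_smul, h3, one_smul]
    rfl
  · intro Y hY x hx
    obtain ⟨s, h1, h2⟩ := hs x hx
    have h3 : ContMDiffAt 𝓘(ℝ, E) (𝓘(ℝ, E).prod 𝓘(ℝ, E →L[ℝ] E)) ∞
        (fun y => (⟨y, ∑ i ∈ s, f i y • c i Y y⟩ : TotalSpace (E →L[ℝ] E)
          (fun x : M => TangentSpace 𝓘(ℝ, E) x →L[ℝ] TangentSpace 𝓘(ℝ, E) x))) x := by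
      refine ContMDiffAt.sum_section fun i hi => ?_
      refine ContMDiffAt.smul_section (hf i x hx) ?_
      have hV := (hc i).isOpen.mem_nhds (h1 i hi)
      exact ((hc i).smooth.contMDiff (hY.mono (subset_iUnion V i))).contMDiffAt hV
    refine (h3.congr_of_eventuallyEq ?_).contMDiffWithinAt
    filter_upwards [h2] with y hy
    rw [hcov y s hy.1]
  · intro x hx Y hY v
    obtain ⟨s, h1, h2, -⟩ := key x hx
    rw [h2, h2, _root_.sum_apply, _root_.sum_apply, map_sum]
    refine Finset.sum_congr rfl fun i hi => ?_
    rw [_root_.smul_apply, _root_.smul_apply, map_smul, (hc i).preserves x (h1 i hi) Y hY]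
  · intro x hx Y Z hY hZ
    obtain ⟨s, h1, h2, h3⟩ := key x hx
    have e : ∀ i ∈ s, f i x • (c i Z x (Y x) - c i Y x (Z x)
        - VectorField.mlieBracket 𝓘(ℝ, E) Y Z x) = f i x • (1 / 4 : ℝ) • nijenhuis J Y Z x :=
      fun i hi => congrArg (f i x • ·) ((hc i).torsion x (h1 i hi) Y Z hY hZ)
    have e2 := Finset.sum_congr rfl e
    rw [← Finset.sum_smul, h3, one_smul] at e2
    rw [h2, h2, _root_.sum_apply, _root_.sum_apply, ← e2]
    simp only [smul_sub, Finset.sum_sub_distrib, ← Finset.sum_smul, h3, one_smul,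
      _root_.smul_apply]
  · obtain ⟨s, h1, h2, -⟩ := key x hx
    exact ⟨s, fun i => f i x, h1, h2⟩

end Gluing

namespace EmbeddedSubmanifold

variable {E₁ F L E M : Type*}
    [NormedAddCommGroup E₁] [NormedSpace ℝ E₁] [FiniteDimensional ℝ E₁]
    [NormedAddCommGroup F] [NormedSpace ℝ F] [FiniteDimensional ℝ F]
    [NormedAddCommGroup E] [NormedSpace ℝ E] [FiniteDimensional ℝ E]
    [TopologicalSpace L] [ChartedSpace E₁ L] [IsManifold 𝓘(ℝ, E₁) ∞ L]
    [TopologicalSpace M] [ChartedSpace E M] [IsManifold 𝓘(ℝ, E) ∞ M]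
    {S : EmbeddedSubmanifold E₁ F L E M}
    {J : ∀ x : M, TangentSpace 𝓘(ℝ, E) x →L[ℝ] TangentSpace 𝓘(ℝ, E) x}

/-- In slice coordinates `TL` is invariant under the coefficients of the minimal connection,
since `𝒥` and its derivatives along `L` preserve `E₁ × 0`. -/
lemma minimalConnection_mem_tangent (hJ : IsAlmostComplex 𝓘(ℝ, E) J) (hL : S.IsPHSubmanifold J)
    (p₀ : L) {p : L} (hp : p ∈ (S.domChart p₀).source)
    {Y : ∀ x : M, TangentSpace 𝓘(ℝ, E) x} (hY : SmoothFieldAt 𝓘(ℝ, E) Y (S.incl p))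
    (hYt : S.TangentNear Y p) {v : TangentSpace 𝓘(ℝ, E) (S.incl p)} (hv : v ∈ S.tangent p) :
    (S.sliceParam p₀).minimalConnection J Y (S.incl p) v ∈ S.tangent p := by
  have hu := (S.domChart p₀).map_source hp
  have hw := S.zero_mem_sliceParam_source hu
  rw [S.mem_tangent_iff hp] at hv ⊢
  obtain ⟨ξ, hξ⟩ : ∃ ξ, S.sliceCoord p₀ p v = (ξ, 0) := ⟨_, Prod.ext rfl hv⟩
  have hd : DifferentiableAt ℝ ((S.sliceParam p₀).localEnd J) (S.domChart p₀ p, 0) :=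
    (contDiffAt_localEnd_sliceParam hJ hu).differentiableAt (by simp)
  have hYd : DifferentiableAt ℝ ((S.sliceParam p₀).localField Y) (S.domChart p₀ p, 0) := by
    refine PartialDiffeomorph.differentiableAt_localField hw ?_
    rw [S.sliceParam_domChart hp]
    exact hY.mdifferentiableAt (by simp)
  -- the components of `Y` along `L`
  have hYL : ∀ᶠ u in 𝓝 (S.domChart p₀ p), ((S.sliceParam p₀).localField Y (u, 0)).2 = 0 := by
    have h1 : Tendsto (S.domChart p₀).symm (𝓝 (S.domChart p₀ p)) (𝓝 p) := by
      have := (S.domChart p₀).tendsto_symm hp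
      exact this
    filter_upwards [h1.eventually hYt, (S.domChart p₀).open_target.mem_nhds hu] with u h hu'
    have h2 := S.localField_sliceParam ((S.domChart p₀).map_target hu') Y
    rw [(S.domChart p₀).right_inv hu'] at h2
    rw [h2]
    exact (S.mem_tangent_iff ((S.domChart p₀).map_target hu') _).1 h
  obtain ⟨y, hy⟩ : ∃ y, (S.sliceParam p₀).localField Y (S.domChart p₀ p, 0) = (y, 0) :=
    ⟨_, Prod.ext rfl hYL.self_of_nhds⟩
  have hdY : (fderiv ℝ ((S.sliceParam p₀).localField Y) (S.domChart p₀ p, 0) (ξ, 0)).2 = 0 := by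
    have h1 := (ContinuousLinearMap.snd ℝ E₁ F).hasFDerivAt.comp (S.domChart p₀ p)
      (HasFDerivAt.comp (S.domChart p₀ p) (f := ContinuousLinearMap.inl ℝ E₁ F) hYd.hasFDerivAt
        (ContinuousLinearMap.hasFDerivAt _))
    have h2 := h1.congr_of_eventuallyEq (f₁ := fun _ => (0 : F)) (hYL.mono fun u hu => hu.symm)
    exact DFunLike.congr_fun (h2.unique (hasFDerivAt_const _ _)) ξ
  have hJL : ∀ x, (S.sliceParam p₀).localEnd J (S.domChart p₀ p, 0) (x, 0) =
      ((S.baseParam p₀).localEnd (S.restrict J) (S.domChart p₀ p) x, 0) := hL.localEnd_eq hu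
  have hJe : ∀ᶠ u in 𝓝 (S.domChart p₀ p), ∀ x, (S.sliceParam p₀).localEnd J (u, 0) (x, 0) =
      ((S.baseParam p₀).localEnd (S.restrict J) u x, 0) := by
    filter_upwards [(S.domChart p₀).open_target.mem_nhds hu] with u hu x using hL.localEnd_eq hu x
  have hD := fun η x => fderiv_fst_block hd hJe η x
  have hθ := (S.sliceParam p₀).symm.mfderiv_inverse_apply (x := S.incl p)
    (S.incl_mem_sliceParam_target.2 hp)
  rw [S.mfderiv_sliceParam_symm hp] at hθ
  rw [PartialDiffeomorph.minimalConnection, PartialDiffeomorph.coordConnection,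
    S.mfderiv_sliceParam_symm hp, S.sliceParam_symm_incl hp]
  refine (congrArg Prod.snd (hθ _)).trans ?_
  change (fderiv ℝ ((S.sliceParam p₀).localField Y) (S.domChart p₀ p, 0) (S.sliceCoord p₀ p v) +
    minimalCoefficients ((S.sliceParam p₀).localEnd J) (S.domChart p₀ p, 0)
      ((S.sliceParam p₀).localField Y (S.domChart p₀ p, 0)) (S.sliceCoord p₀ p v)).2 = 0
  rw [hξ, Prod.snd_add, hdY, hy, minimalCoefficients_apply, hJL, hD, hD, hD, hJL, hJL]
  simp

/-- There is a minimal connection near `L` for which `L` is totally geodesic. -/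
theorem exists_isMinimalConnectionOn [T2Space M] [SigmaCompactSpace M]
    (hJ : IsAlmostComplex 𝓘(ℝ, E) J) (hL : S.IsPHSubmanifold J) :
    ∃ U cov, range S.incl ⊆ U ∧ IsMinimalConnectionOn J U cov ∧ S.IsTotallyGeodesic cov := by
  obtain ⟨cov, h1, h2⟩ := exists_isMinimalConnectionOn_iUnion
    (fun p₀ : L => (S.sliceParam p₀).isMinimalConnectionOn_minimalConnection hJ)
  have hU : range S.incl ⊆ ⋃ p₀ : L, (S.sliceParam p₀).target := by
    rintro _ ⟨p, rfl⟩
    exact mem_iUnion.2 ⟨p, S.incl_mem_sliceParam_target.2 (S.mem_domChart_source p)⟩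
  refine ⟨_, cov, hU, h1, fun p Y hY hYt v hv => ?_⟩
  obtain ⟨s, a, h3, h4⟩ := h2 (S.incl p) (hU ⟨p, rfl⟩)
  rw [h4, _root_.sum_apply]
  refine Submodule.sum_mem _ fun i hi => Submodule.smul_mem _ _ ?_
  exact minimalConnection_mem_tangent hJ hL i (S.incl_mem_sliceParam_target.1 (h3 i hi)) hY hYt hv

end EmbeddedSubmanifold

end

theorem mainTheorem3 {E₁ F L E M : Type*}
    [NormedAddCommGroup E₁] [NormedSpace ℝ E₁] [FiniteDimensional ℝ E₁]
    [NormedAddCommGroup F] [NormedSpace ℝ F] [FiniteDimensional ℝ F]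
    [NormedAddCommGroup E] [NormedSpace ℝ E] [FiniteDimensional ℝ E]
    [TopologicalSpace L] [ChartedSpace E₁ L] [IsManifold 𝓘(ℝ, E₁) ∞ L]
    [TopologicalSpace M] [ChartedSpace E M] [IsManifold 𝓘(ℝ, E) ∞ M]
    [T2Space M] [SigmaCompactSpace M]
    (S : EmbeddedSubmanifold E₁ F L E M)
    (J : ∀ x : M, TangentSpace 𝓘(ℝ, E) x →L[ℝ] TangentSpace 𝓘(ℝ, E) x)
    (hJ : IsAlmostComplex 𝓘(ℝ, E) J) (hL : S.IsPHSubmanifold J) :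
    -- the auxiliary choices exist
    (∃ σ, S.IsInvariantComplement J σ) ∧
    (∃ U cov, range S.incl ⊆ U ∧ IsMinimalConnectionOn J U cov ∧ S.IsTotallyGeodesic cov) ∧
    ∃! Jc : ∀ a : TotalSpace F S.Normal, TangentSpace (𝓘(ℝ, E₁).prod 𝓘(ℝ, F)) a →L[ℝ]
        TangentSpace (𝓘(ℝ, E₁).prod 𝓘(ℝ, F)) a,
      IsAlmostComplex (𝓘(ℝ, E₁).prod 𝓘(ℝ, F)) Jc ∧
      -- for all choices, `Jc` is the limit of the dilated structures
      (∀ σ U cov, S.IsInvariantComplement J σ → range S.incl ⊆ U →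
        IsMinimalConnectionOn J U cov →
        (∃ O : Set (TotalSpace F S.Normal), IsOpen O ∧ range S.zeroSec ⊆ O ∧
          (∀ a ∈ O, ∃ y, IsExp cov U (S.incl a.proj) (σ a.proj a.2) y) ∧
          IsLocalDiffeomorphOn (𝓘(ℝ, E₁).prod 𝓘(ℝ, F)) 𝓘(ℝ, E) ∞ (S.normalExp cov U σ) O) ∧
        ∀ a, Tendsto (fun t : ℝ => S.dilated J (S.normalExp cov U σ) t a) (𝓝[≠] 0) (𝓝 (Jc a))) ∧
      IsPseudoholomorphic (I := 𝓘(ℝ, E₁).prod 𝓘(ℝ, F)) (I' := 𝓘(ℝ, E₁)) Jc (S.restrict J)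
        (TotalSpace.proj : TotalSpace F S.Normal → L) ∧
      IsPseudoholomorphic (I := 𝓘(ℝ, E₁)) (I' := 𝓘(ℝ, E₁).prod 𝓘(ℝ, F)) (S.restrict J) Jc
        S.zeroSec ∧
      (IsIntegrable (I := 𝓘(ℝ, E₁).prod 𝓘(ℝ, F)) Jc ↔
        IsIntegrable (I := 𝓘(ℝ, E₁)) (S.restrict J) ∧ S.IsNormallyIntegrable J ∧
          S.NormalNijenhuisVanishesToSecondOrder J) 
:= by
  -- `L` inherits the topological properties of `M` needed for partitions of unity
  have : T2Space L := S.isEmbedding.t2Space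
  have : SecondCountableTopology M := ChartedSpace.secondCountable_of_sigmaCompact E M
  have : SecondCountableTopology L := S.isEmbedding.secondCountableTopology
  have : LocallyCompactSpace L := ChartedSpace.locallyCompactSpace E₁ L
  have : SigmaCompactSpace L := inferInstance
  obtain ⟨σ, hσ⟩ := EmbeddedSubmanifold.exists_isInvariantComplement hJ hL
  obtain ⟨U, cov, hU, hcov, htot⟩ := EmbeddedSubmanifold.exists_isMinimalConnectionOn hJ hL
  refine ⟨⟨σ, hσ⟩, ⟨U, cov, hU, hcov, htot⟩, S.normalStructure J, ?_, ?_⟩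
  · have hJc : S.IsLinearizationOf J (S.normalStructure J) := fun p₀ w hw =>
      EmbeddedSubmanifold.localEnd_normalStructure hJ hL hσ hU hcov hw
    refine ⟨hJc.isAlmostComplex hJ hL, fun σ' U' cov' hσ' hU' hcov' => ⟨?_, fun a => ?_⟩,
      hJc.isPseudoholomorphic_proj hL, hJc.isPseudoholomorphic_zeroSec hL,
      hJc.isIntegrable_iff hJ hL⟩
    · exact EmbeddedSubmanifold.exists_isLocalDiffeomorphOn_normalExp hσ' hU' hcov'
    · exact EmbeddedSubmanifold.tendsto_dilated hJ hL hσ' hU' hcov' a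
  · rintro Jc ⟨-, hlim, -⟩
    funext a
    exact tendsto_nhds_unique ((hlim σ U cov hσ hU hcov).2 a)
      (EmbeddedSubmanifold.tendsto_dilated hJ hL hσ hU hcov a)
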